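/- **Setting.** A typed combinatory algebra (tca) $\mathcal T$ consists of a set of types closed under $\times,\to,+$ with distinguished types $\bot,\top,N$, a set $|S|$ of realizers for every type $S$, a total application $|S\to T|\times|S|\to|T|$, and elements $\mathsf{exf},\mathsf t,\mathsf k,\mathsf s,\mathsf{pair},\mathsf{fst},\mathsf{snd},\mathsf{inl},\mathsf{inr},\mathsf{case},0,\mathsf{succ},\mathsf R$ of the usual types satisfying the usual equations. It is consistent if $0\neq\mathsf{succ}\,0$. Every partial combinatory algebra $\mathcal A$ gives a tca: the types are the subsets of $\mathcal A$ with $|X|=X$, and $X\to Y=\{e : \forall a\in X,\ ea\text{ is defined and }ea\in Y\}$. Let $\mathcal K_1$ be the tca arising in this way from Kleene's first algebra ($\mathbb N$ with partial recursive application), and $\mathcal K_2^{\mathrm{rec}}$ the one arising from the recursive submodel of Kleene's second algebra (the total recursive functions with continuous application). For a consistent tca $\mathcal T$, a $\mathcal T$-apartness type is $(A,T_A,T_A^-,\#_A)$ with types $T_A,T_A^-$ of $\mathcal T$, an inhabited subset $A\subseteq|T_A|$, $|T_A^-|$ inhabited, and a relation $\#_A\subseteq A\times A\times|T_A^-|$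 (write $n:a\,\#_A\,b$) such that never $n:a\,\#_A\,a$, and symmetry and the comparison property ($n:a\,\#_A\,b$ and $c \in A$ yield evidence of $a\,\#_A\,c$ or of $b\,\#_A\,c$) are witnessed by elements of $\mathcal T$. A premorphism is a pair of realizers $f\in|T_A\to T_B|$, $f^-\in|T_A\to T_A\to T_B^-\to T_A^-|$ such that $f$ maps $A$ into $B$ and $n:fa_0\,\#_B\,fa_1$ implies $f^-a_0a_1n:a_0\,\#_A\,a_1$ for $a_0,a_1\in A$. The apartness types form a tca $\mathbf{ApType}_{\mathcal T}$ with $|A|=A/{\sim}$, where $a\sim b$ iff there is no $n$ with $n:a\,\#_A\,b$, with $\mathcal A\to\mathcal B$ the apartness type of premorphisms, where $n:f\,\#\,g$ iff $\mathsf{fst}\,n\in A$ and $\mathsf{snd}\,n:f(\mathsf{fst}\,n)\,\#_B\,g(\mathsf{fst}\,n)$, and with $N$ the apartness type of numerals, where anything is evidence that distinct numerals are apart. An assembly over a tca is $(X,A,\alpha)$ with $X$ a set, $A$ a type and $\alpha$ assigning to each $x\in X$ an inhabited subset of $|A|$; morphisms are the functions tracked by a realizer. A predicate on it is $(B,\beta)$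 with $B$ a type and $\beta:X\to\mathcal P(|B|)$ such that some $f\in|B\to A|$ satisfies $b\in\beta(x)\Rightarrow fb\in\alpha(x)$; $(B,\beta)\le(C,\gamma)$ iff some $f\in|B\to C|$ satisfies $b\in\beta(x)\Rightarrow fb\in\gamma(x)$ for all $x$. Predicates form a first-order hyperdoctrine, in which formulas in assemblies are interpreted; a formula holds if it is interpreted by a top predicate. $\mathbf{ApAsm}_{\mathcal T}$ is the category of assemblies over $\mathbf{ApType}_{\mathcal T}$. An assembly is modest if $\alpha(x)\cap\alpha(y)\ne\emptyset$ implies $x=y$, exhaustive if every $a\in|A|$ lies in some $\alpha(x)$, and basic if it is modest and exhaustive and each $\alpha(x)$ is a singleton. The finite types are generated from $\top$ and $N$ by $\times,\to$; they are interpreted by the terminal assembly, the natural numbers object, products and exponentials. Write $0:=N$ and $n+1:=(n\to N)$. **Principles.** * $\mathsf{IP}$: $(\neg\varphi\to\exists y^Y\psi(y))\to\exists y^Y(\neg\varphi\to\psi(y))$ for all predicates $\varphi$ and $\psi$, in any context, and all $Y$ that are modest and exhaustive, as well as all finite types $Y$. * $\mathsf{AC}$: $\forall x^X\exists y^Y\varphi(x,y)\to\exists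 f^{X\to Y}\forall x^X\varphi(x,fx)$ for all predicates $\varphi$, in any context, and all basic assemblies $X,Y$, as well as all finite types $X,Y$. * $\mathsf{CE}_n$: $\exists X^{n+2\to n+1\to n+1\to n}\,\forall\Phi^{n+2}\,\forall f^{n+1},g^{n+1}\,\big(\Phi f\ne_0\Phi g\to f(X\Phi fg)\ne_0 g(X\Phi fg)\big)$. * $\mathsf{MP}_n$: $\forall f^{n+1}\,\big(\neg\neg\exists x^n\,fx=_00\to\exists x^n\,fx=_00\big)$; $\mathsf{MP}:=\mathsf{MP}_0$. **Theorem.** 1. In $\mathbf{ApAsm}_{\mathcal K_1}$ the principles $\mathsf{IP}$, $\mathsf{AC}$ and $\mathsf{CE}_0$ hold, but $\mathsf{MP}$ does not. 2. In $\mathbf{ApAsm}_{\mathcal K_2^{\mathrm{rec}}}$ the principles $\mathsf{IP}$, $\mathsf{AC}$, $\mathsf{CE}_0$ and $\mathsf{CE}_1$ hold, but $\mathsf{MP}$ does not. 3. Hence, for $n=0,1$, extensional Heyting arithmetic in all finite types $\mathsf{E}\text{-}\mathsf{HA}^\omega$, together with the axiom scheme $\forall x^\sigma\exists y^\tau\varphi(x,y)\to\exists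 f^{\sigma\to\tau}\forall x^\sigma\varphi(x,fx)$ for all finite types $\sigma,\tau$ and all formulas $\varphi$, and with the axiom $\mathsf{CE}_n$, does not prove $\mathsf{MP}_n$. -/

import Mathlib

namespace ConvExt

/-! ### Typed combinatory algebras -/

/-- A typed combinatory algebra (total application, with unit, empty, sum and number types). -/
structure TCA where
  Ty : Type
  prod : Ty → Ty → Ty
  arr : Ty → Ty → Ty
  sum : Ty → Ty → Ty
  bot : Ty
  top : Ty
  nat : Ty
  El : Ty → Type
  app : ∀ {S U : Ty}, El (arr S U) → El S → El U
  exf : ∀ S, El (arr bot S)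
  tt : El top
  k : ∀ S U, El (arr S (arr U S))
  s : ∀ S U V, El (arr (arr S (arr U V)) (arr (arr S U) (arr S V)))
  pair : ∀ S U, El (arr S (arr U (prod S U)))
  fst : ∀ S U, El (arr (prod S U) S)
  snd : ∀ S U, El (arr (prod S U) U)
  inl : ∀ S U, El (arr S (sum S U))
  inr : ∀ S U, El (arr U (sum S U))
  case : ∀ S U V, El (arr (arr S V) (arr (arr U V) (arr (sum S U) V)))
  zero : El nat
  succ : El (arr nat nat)
  recN : ∀ S, El (arr S (arr (arr nat (arr S S)) (arr nat S)))
  k_eq : ∀ {S U} (a : El S) (b : El U), app (app (k S U) a) b = a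
  s_eq : ∀ {S U V} (a : El (arr S (arr U V))) (b : El (arr S U)) (c : El S),
    app (app (app (s S U V) a) b) c = app (app a c) (app b c)
  fst_eq : ∀ {S U} (a : El S) (b : El U), app (fst S U) (app (app (pair S U) a) b) = a
  snd_eq : ∀ {S U} (a : El S) (b : El U), app (snd S U) (app (app (pair S U) a) b) = b
  case_inl : ∀ {S U V} (a : El (arr S V)) (b : El (arr U V)) (x : El S),
    app (app (app (case S U V) a) b) (app (inl S U) x) = app a x
  case_inr : ∀ {S U V} (a : El (arr S V)) (b : El (arr U V)) (x : El U),
    app (app (app (case S U V) a) b) (app (inr S U) x) = app b x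
  rec_zero : ∀ {S} (a : El S) (b : El (arr nat (arr S S))),
    app (app (app (recN S) a) b) zero = a
  rec_succ : ∀ {S} (a : El S) (b : El (arr nat (arr S S))) (n : El nat),
    app (app (app (recN S) a) b) (app succ n) = app (app b n) (app (app (app (recN S) a) b) n)

namespace TCA

variable (T : TCA)

/-- The tca is consistent when `0 ≠ succ 0`. -/
def Consistent : Prop := T.zero ≠ T.app T.succ T.zero

/-- The numeral of `n`. -/
def numeral : ℕ → T.El T.nat
  | 0 => T.zero
  | n + 1 => T.app T.succ (numeral n)

variable {T}

/-- The pairing of two realizers. -/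
def pr {S U : T.Ty} (a : T.El S) (b : T.El U) : T.El (T.prod S U) := T.app (T.app (T.pair S U) a) b
def p1 {S U : T.Ty} (x : T.El (T.prod S U)) : T.El S := T.app (T.fst S U) x
def p2 {S U : T.Ty} (x : T.El (T.prod S U)) : T.El U := T.app (T.snd S U) x
def il {S : T.Ty} (U : T.Ty) (a : T.El S) : T.El (T.sum S U) := T.app (T.inl S U) a
def ir (S : T.Ty) {U : T.Ty} (a : T.El U) : T.El (T.sum S U) := T.app (T.inr S U) a

@[simp] theorem p1_pr {S U : T.Ty} (a : T.El S) (b : T.El U) : p1 (pr a b) = a := T.fst_eq a b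
@[simp] theorem p2_pr {S U : T.Ty} (a : T.El S) (b : T.El U) : p2 (pr a b) = b := T.snd_eq a b

/-! Functions represented by a realizer. -/

/-- `F` is represented by some realizer. -/
def Repr {S U : T.Ty} (F : T.El S → T.El U) : Prop := ∃ e : T.El (T.arr S U), ∀ x, T.app e x = F x

namespace Repr

variable {S U V W : T.Ty}

theorem elt (e : T.El (T.arr S U)) : Repr (fun x => T.app e x) := ⟨e, fun _ => rfl⟩

theorem const (c : T.El U) : Repr (fun _ : T.El S => c) := ⟨T.app (T.k U S) c, fun x => T.k_eq c x⟩

theorem id : Repr (fun x : T.El S => x) :=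
  ⟨T.app (T.app (T.s S (T.arr S S) S) (T.k S (T.arr S S))) (T.k S S), fun x => by
    rw [T.s_eq, T.k_eq]⟩

theorem app {F : T.El S → T.El (T.arr U V)} {G : T.El S → T.El U} (hF : Repr F) (hG : Repr G) :
    Repr (fun x => T.app (F x) (G x)) := by
  obtain ⟨f, hf⟩ := hF
  obtain ⟨g, hg⟩ := hG
  exact ⟨T.app (T.app (T.s S U V) f) g, fun x => by rw [T.s_eq, hf, hg]⟩

theorem capp (e : T.El (T.arr U V)) {G : T.El S → T.El U} (hG : Repr G) :
    Repr (fun x => T.app e (G x)) := (const e).app hG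

theorem comp {F : T.El U → T.El V} {G : T.El S → T.El U} (hF : Repr F) (hG : Repr G) :
    Repr (fun x => F (G x)) := by
  obtain ⟨f, hf⟩ := hF
  exact (capp f hG).imp fun e he x => by rw [he x]; exact hf _

theorem p1 {G : T.El S → T.El (T.prod U V)} (hG : Repr G) : Repr (fun x => TCA.p1 (G x)) :=
  capp _ hG
theorem p2 {G : T.El S → T.El (T.prod U V)} (hG : Repr G) : Repr (fun x => TCA.p2 (G x)) :=
  capp _ hG
theorem il {G : T.El S → T.El U} (hG : Repr G) : Repr (fun x => TCA.il V (G x)) := capp _ hG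
theorem ir {G : T.El S → T.El U} (hG : Repr G) : Repr (fun x => TCA.ir V (G x)) := capp _ hG
theorem pr {F : T.El S → T.El U} {G : T.El S → T.El V} (hF : Repr F) (hG : Repr G) :
    Repr (fun x => TCA.pr (F x) (G x)) := (capp _ hF).app hG

theorem curry {F : T.El (T.prod S U) → T.El V} (hF : Repr F) :
    ∃ G : T.El S → T.El (T.arr U V), Repr G ∧ ∀ x y, T.app (G x) y = F (TCA.pr x y) := by
  obtain ⟨f, hf⟩ := hF
  refine ⟨fun x => T.app (T.app (T.s U (T.prod S U) V) (T.app (T.k _ U) f)) (T.app (T.pair S U) x),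
    capp _ (capp _ id), fun x y => ?_⟩
  rw [T.s_eq, T.k_eq, hf]; rfl

theorem case {N : T.El S → T.El (T.sum U V)} {F : T.El (T.prod S U) → T.El W}
    {G : T.El (T.prod S V) → T.El W} (hN : Repr N) (hF : Repr F) (hG : Repr G) :
    ∃ H : T.El S → T.El W, Repr H ∧ (∀ x y, N x = TCA.il V y → H x = F (TCA.pr x y)) ∧
      ∀ x y, N x = TCA.ir U y → H x = G (TCA.pr x y) := by
  obtain ⟨f, hf, hf'⟩ := hF.curry
  obtain ⟨g, hg, hg'⟩ := hG.curry
  refine ⟨fun x => T.app (T.app (T.app (T.case U V W) (f x)) (g x)) (N x),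
    ((capp _ hf).app hg).app hN, fun x y h => ?_, fun x y h => ?_⟩
  · simp only [h]; rw [← hf']; exact T.case_inl _ _ _
  · simp only [h]; rw [← hg']; exact T.case_inr _ _ _

/-- Abstraction over two arguments. -/
theorem abs2 {F : T.El (T.prod S U) → T.El V} (hF : Repr F) :
    ∃ e : T.El (T.arr S (T.arr U V)), ∀ x y, T.app (T.app e x) y = F (TCA.pr x y) := by
  obtain ⟨g, ⟨e, he⟩, h⟩ := hF.curry
  exact ⟨e, fun x y => by rw [he, h]⟩

theorem abs3 {F : T.El (T.prod (T.prod S U) V) → T.El W} (hF : Repr F) :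
    ∃ e : T.El (T.arr S (T.arr U (T.arr V W))), ∀ x y z,
      T.app (T.app (T.app e x) y) z = F (TCA.pr (TCA.pr x y) z) := by
  obtain ⟨g, hg, h⟩ := hF.curry
  obtain ⟨e, he⟩ := hg.abs2
  exact ⟨e, fun x y z => by rw [he, h]⟩

theorem abs4 {X : T.Ty} {F : T.El (T.prod (T.prod (T.prod S U) V) W) → T.El X} (hF : Repr F) :
    ∃ e : T.El (T.arr S (T.arr U (T.arr V (T.arr W X)))), ∀ x y z w,
      T.app (T.app (T.app (T.app e x) y) z) w = F (TCA.pr (TCA.pr (TCA.pr x y) z) w) := by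
  obtain ⟨g, hg, h⟩ := hF.curry
  obtain ⟨e, he⟩ := hg.abs3
  exact ⟨e, fun x y z w => by rw [he, h]⟩

/-- Primitive recursion with parameters. -/
theorem natRec {Z : T.El S → T.El U} {F : T.El (T.prod (T.prod S T.nat) U) → T.El U}
    {N : T.El S → T.El T.nat} (hZ : Repr Z) (hF : Repr F) (hN : Repr N) :
    ∃ H : T.El S → T.El U, Repr H ∧ ∀ x n, N x = T.numeral n →
      H x = Nat.rec (Z x) (fun m v => F (TCA.pr (TCA.pr x (T.numeral m)) v)) n := by
  obtain ⟨g, hg, h⟩ := hF.curry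
  obtain ⟨g', hg', h'⟩ := hg.curry
  refine ⟨fun x => T.app (T.app (T.app (T.recN U) (Z x)) (g' x)) (N x),
    ((capp _ hZ).app hg').app hN, fun x n hn => ?_⟩
  simp only [hn]
  clear hn
  induction n with
  | zero => exact T.rec_zero _ _
  | succ n ih =>
    change T.app _ (T.app T.succ (T.numeral n)) = _
    rw [T.rec_succ, ih, h', h]

end Repr

theorem il_inj {S U : T.Ty} {a b : T.El S} (h : il U a = il U b) : a = b := by
  obtain ⟨e, he⟩ := Repr.id (S := S)
  have h2 := congrArg (T.app (T.app (T.app (T.case S U S) e) (T.app (T.k S U) a))) h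
  unfold il at h2
  rwa [T.case_inl, T.case_inl, he, he] at h2

theorem ir_inj {S U : T.Ty} {a b : T.El U} (h : ir S a = ir S b) : a = b := by
  obtain ⟨e, he⟩ := Repr.id (S := U)
  have h2 := congrArg (T.app (T.app (T.app (T.case S U U) (T.app (T.k U S) a)) e)) h
  unfold ir at h2
  rwa [T.case_inr, T.case_inr, he, he] at h2

theorem Consistent.il_ne_ir (hT : T.Consistent) {S U : T.Ty} (a : T.El S) (b : T.El U) :
    il U a ≠ ir S b := fun h => by
  have h2 := congrArg (T.app (T.app (T.app (T.case S U T.nat) (T.app (T.k _ S) T.zero))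
    (T.app (T.k _ U) (T.app T.succ T.zero)))) h
  unfold il ir at h2
  rw [T.case_inl, T.case_inr, T.k_eq, T.k_eq] at h2
  exact hT h2

/-- Equality of numerals is decided by a represented function. -/
theorem exists_natEq (T : TCA) : ∃ H : T.El (T.prod T.nat T.nat) → T.El T.nat, Repr H ∧
    ∀ m n : ℕ, H (pr (T.numeral m) (T.numeral n)) = T.numeral (if m = n then 1 else 0) := by
  -- `chi` tests for zero
  obtain ⟨chi, hchi, hchi'⟩ := Repr.natRec (S := T.nat) (Repr.const (T.numeral 1))
    (Repr.const (T.numeral 0)) Repr.id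
  -- predecessor
  obtain ⟨pd, hpr, hpr'⟩ := Repr.natRec (S := T.nat) (Repr.const (T.numeral 0))
    (Repr.p2 (Repr.p1 Repr.id)) Repr.id
  have hpr0 : ∀ n, pd (T.numeral n) = T.numeral (n - 1) := fun n => by
    rw [hpr' _ n rfl]; cases n <;> simp
  have hchi0 : ∀ n, chi (T.numeral n) = T.numeral (if n = 0 then 1 else 0) := fun n => by
    rw [hchi' _ n rfl]; cases n <;> simp
  -- truncated subtraction
  obtain ⟨sb, hsb, hsb'⟩ := Repr.natRec (S := T.prod T.nat T.nat) (Repr.p1 Repr.id)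
    (hpr.comp (Repr.p2 Repr.id)) (Repr.p2 Repr.id)
  have hsb0 : ∀ m n, sb (pr (T.numeral m) (T.numeral n)) = T.numeral (m - n) := fun m n => by
    rw [hsb' _ n (by simp)]
    simp only [p1_pr, p2_pr]
    induction n with
    | zero => rfl
    | succ n ih => simp only [ih, hpr0]; rfl
  -- addition
  obtain ⟨ad, had, had'⟩ := Repr.natRec (S := T.prod T.nat T.nat) (Repr.p1 Repr.id)
    (Repr.capp T.succ (Repr.p2 Repr.id)) (Repr.p2 Repr.id)
  have had0 : ∀ m n, ad (pr (T.numeral m) (T.numeral n)) = T.numeral (m + n) := fun m n => by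
    rw [had' _ n (by simp)]
    simp only [p1_pr, p2_pr]
    induction n with
    | zero => rfl
    | succ n ih => simp only [ih]; rfl
  refine ⟨fun x => chi (ad (pr (sb x) (sb (pr (p2 x) (p1 x))))),
    hchi.comp (had.comp (hsb.pr (hsb.comp ((Repr.p2 Repr.id).pr (Repr.p1 Repr.id))))),
    fun m n => ?_⟩
  simp only [hsb0, p1_pr, p2_pr, had0, hchi0]
  congr 1
  by_cases h : m = n
  · simp [h]
  · rw [if_neg h, if_neg (by omega)]

theorem Consistent.numeral_inj (hT : T.Consistent) {m n : ℕ} (h : T.numeral m = T.numeral n) :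
    m = n := by
  obtain ⟨H, -, hH⟩ := exists_natEq T
  by_contra hne
  have h1 := hH m n
  rw [h, hH n n, if_pos rfl, if_neg hne] at h1
  exact hT h1.symm

end TCA

/-! ### Apartness types -/

open TCA (p1 p2 pr il ir Repr)

/-- An apartness type over `T`; `apart a b n` is read `n : a # b`. -/
structure ApType (T : TCA) where
  pos : T.Ty
  neg : T.Ty
  carrier : Set (T.El pos)
  apart : T.El pos → T.El pos → T.El neg → Prop
  mem_of_apart : ∀ {a b n}, apart a b n → a ∈ carrier ∧ b ∈ carrier
  carrier_nonempty : carrier.Nonempty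
  neg_nonempty : Nonempty (T.El neg)
  irrefl : ∀ a n, ¬ apart a a n
  symm : ∃ s : T.El (T.arr pos (T.arr pos (T.arr neg neg))), ∀ a b n, apart a b n →
    apart b a (T.app (T.app (T.app s a) b) n)
  trans : ∃ t : T.El (T.arr pos (T.arr pos (T.arr pos (T.arr neg (T.sum neg neg))))),
    ∀ a b, ∀ c ∈ carrier, ∀ n, apart a b n →
      (∃ m, T.app (T.app (T.app (T.app t a) b) c) n = il neg m ∧ apart a c m) ∨
      (∃ m, T.app (T.app (T.app (T.app t a) b) c) n = ir neg m ∧ apart b c m)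

namespace ApType

variable {T : TCA}

/-- Two elements are equivalent when there is no evidence that they are apart. -/
def Sim (A : ApType T) (a b : A.carrier) : Prop := ∀ n, ¬ A.apart a b n

theorem Sim.symm' {A : ApType T} {a b : A.carrier} (h : A.Sim a b) : A.Sim b a := fun n hn => by
  obtain ⟨s, hs⟩ := A.symm
  exact h _ (hs _ _ _ hn)

instance setoid (A : ApType T) : Setoid A.carrier where
  r := A.Sim
  iseqv := ⟨fun _ _ => A.irrefl _ _, Sim.symm', fun {a b c} h1 h2 n hn => by
    obtain ⟨t, ht⟩ := A.trans
    rcases ht _ _ _ b.2 _ hn with ⟨m, -, hm⟩ | ⟨m, -, hm⟩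
    · exact h1 _ hm
    · exact Sim.symm' h2 _ hm⟩

/-- The premorphisms from `A` to `B`. -/
def IsPremorphism (A B : ApType T)
    (f : T.El (T.prod (T.arr A.pos B.pos) (T.arr A.pos (T.arr A.pos (T.arr B.neg A.neg))))) : Prop :=
  (∀ a ∈ A.carrier, T.app (p1 f) a ∈ B.carrier) ∧
  ∀ a₀ ∈ A.carrier, ∀ a₁ ∈ A.carrier, ∀ n, B.apart (T.app (p1 f) a₀) (T.app (p1 f) a₁) n →
    A.apart a₀ a₁ (T.app (T.app (T.app (p2 f) a₀) a₁) n)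

/-- Symmetry and transitivity in terms of represented functions. -/
theorem exists_symm (A : ApType T) : ∃ s : T.El (T.prod (T.prod A.pos A.pos) A.neg) → T.El A.neg,
    Repr s ∧ ∀ a b n, A.apart a b n → A.apart b a (s (pr (pr a b) n)) := by
  obtain ⟨s, hs⟩ := A.symm
  refine ⟨fun x => T.app (T.app (T.app s (p1 (p1 x))) (p2 (p1 x))) (p2 x),
    ((Repr.capp s (Repr.id.p1.p1)).app Repr.id.p1.p2).app Repr.id.p2, fun a b n h => ?_⟩
  simpa using hs a b n h

theorem exists_trans (A : ApType T) :
    ∃ t : T.El (T.prod (T.prod (T.prod A.pos A.pos) A.pos) A.neg) → T.El (T.sum A.neg A.neg),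
    Repr t ∧ ∀ a b, ∀ c ∈ A.carrier, ∀ n, A.apart a b n →
      (∃ m, t (pr (pr (pr a b) c) n) = il A.neg m ∧ A.apart a c m) ∨
      (∃ m, t (pr (pr (pr a b) c) n) = ir A.neg m ∧ A.apart b c m) := by
  obtain ⟨t, ht⟩ := A.trans
  refine ⟨fun x => T.app (T.app (T.app (T.app t (p1 (p1 (p1 x)))) (p2 (p1 (p1 x)))) (p2 (p1 x)))
    (p2 x), (((Repr.capp t Repr.id.p1.p1.p1).app Repr.id.p1.p1.p2).app Repr.id.p1.p2).app
    Repr.id.p2, fun a b c hc n h => ?_⟩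
  simpa using ht a b c hc n h

/-- The terminal apartness type. -/
@[reducible] def one (T : TCA) : ApType T where
  pos := T.top
  neg := T.top
  carrier := {T.tt}
  apart _ _ _ := False
  mem_of_apart h := h.elim
  carrier_nonempty := ⟨_, rfl⟩
  neg_nonempty := ⟨T.tt⟩
  irrefl _ _ h := h
  symm := (Repr.abs3 (Repr.p2 Repr.id)).imp fun _ _ _ _ _ h => h.elim
  trans := (Repr.abs4 (Repr.il (Repr.p2 Repr.id))).imp fun _ _ _ _ _ _ _ h => h.elim

/-- The binary product. -/
@[reducible] def prod (A B : ApType T) : ApType T where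
  pos := T.prod A.pos B.pos
  neg := T.sum A.neg B.neg
  carrier := {x | p1 x ∈ A.carrier ∧ p2 x ∈ B.carrier}
  apart x y n := x ∈ {x | p1 x ∈ A.carrier ∧ p2 x ∈ B.carrier} ∧
    y ∈ {x | p1 x ∈ A.carrier ∧ p2 x ∈ B.carrier} ∧
    ((∃ m, n = il B.neg m ∧ A.apart (p1 x) (p1 y) m) ∨
      ∃ m, n = ir A.neg m ∧ B.apart (p2 x) (p2 y) m)
  mem_of_apart h := ⟨h.1, h.2.1⟩
  carrier_nonempty := by
    obtain ⟨a, ha⟩ := A.carrier_nonempty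
    obtain ⟨b, hb⟩ := B.carrier_nonempty
    exact ⟨pr a b, by simp [ha, hb]⟩
  neg_nonempty := A.neg_nonempty.map (il B.neg)
  irrefl a n := by
    rintro ⟨-, -, ⟨m, -, h⟩ | ⟨m, -, h⟩⟩
    · exact A.irrefl _ _ h
    · exact B.irrefl _ _ h
  symm := by
    obtain ⟨sA, hsA, hA⟩ := A.exists_symm
    obtain ⟨sB, hsB, hB⟩ := B.exists_symm
    obtain ⟨H, hH, h1, h2⟩ := Repr.case
      (S := T.prod (T.prod (T.prod A.pos B.pos) (T.prod A.pos B.pos)) (T.sum A.neg B.neg))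
      (Repr.p2 Repr.id)
      ((hsA.comp (((Repr.id.p1.p1.p1.p1).pr Repr.id.p1.p1.p2.p1).pr Repr.id.p2)).il (V := B.neg))
      ((hsB.comp (((Repr.id.p1.p1.p1.p2).pr Repr.id.p1.p1.p2.p2).pr Repr.id.p2)).ir (V := A.neg))
    obtain ⟨e, he⟩ := hH.abs3
    refine ⟨e, fun a b n => ?_⟩
    rw [he]
    rintro ⟨ha, hb, ⟨m, rfl, h⟩ | ⟨m, rfl, h⟩⟩ <;> refine ⟨hb, ha, ?_⟩
    · rw [h1 _ m (by simp)]
      exact Or.inl ⟨_, rfl, by simpa using hA _ _ _ h⟩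
    · rw [h2 _ m (by simp)]
      exact Or.inr ⟨_, rfl, by simpa using hB _ _ _ h⟩
  trans := by
    obtain ⟨tA, htA, hA⟩ := A.exists_trans
    obtain ⟨tB, htB, hB⟩ := B.exists_trans
    -- redistribute evidence
    obtain ⟨dA, hdA, hdA1, hdA2⟩ := Repr.case (S := T.sum A.neg A.neg) Repr.id
      ((Repr.id.p2.il (V := B.neg)).il (V := T.sum A.neg B.neg))
      ((Repr.id.p2.il (V := B.neg)).ir (V := T.sum A.neg B.neg))
    obtain ⟨dB, hdB, hdB1, hdB2⟩ := Repr.case (S := T.sum B.neg B.neg) Repr.id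
      ((Repr.id.p2.ir (V := A.neg)).il (V := T.sum A.neg B.neg))
      ((Repr.id.p2.ir (V := A.neg)).ir (V := T.sum A.neg B.neg))
    obtain ⟨H, hH, h1, h2⟩ := Repr.case
      (S := T.prod (T.prod (T.prod (T.prod A.pos B.pos) (T.prod A.pos B.pos))
        (T.prod A.pos B.pos)) (T.sum A.neg B.neg))
      (Repr.p2 Repr.id)
      (hdA.comp (htA.comp ((((Repr.id.p1.p1.p1.p1.p1).pr Repr.id.p1.p1.p1.p2.p1).pr
        Repr.id.p1.p1.p2.p1).pr Repr.id.p2)))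
      (hdB.comp (htB.comp ((((Repr.id.p1.p1.p1.p1.p2).pr Repr.id.p1.p1.p1.p2.p2).pr
        Repr.id.p1.p1.p2.p2).pr Repr.id.p2)))
    obtain ⟨e, he⟩ := hH.abs4
    refine ⟨e, fun a b c hc n => ?_⟩
    rw [he]
    rintro ⟨ha, hb, ⟨m, rfl, h⟩ | ⟨m, rfl, h⟩⟩
    · rw [h1 _ m (by simp)]
      simp only [TCA.p1_pr, TCA.p2_pr]
      rcases hA _ _ _ hc.1 _ h with ⟨m', e', h'⟩ | ⟨m', e', h'⟩
      · exact Or.inl ⟨_, by rw [e', hdA1 _ _ rfl, TCA.p2_pr], ha, hc, Or.inl ⟨_, rfl, h'⟩⟩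
      · exact Or.inr ⟨_, by rw [e', hdA2 _ _ rfl, TCA.p2_pr], hb, hc, Or.inl ⟨_, rfl, h'⟩⟩
    · rw [h2 _ m (by simp)]
      simp only [TCA.p1_pr, TCA.p2_pr]
      rcases hB _ _ _ hc.2 _ h with ⟨m', e', h'⟩ | ⟨m', e', h'⟩
      · exact Or.inl ⟨_, by rw [e', hdB1 _ _ rfl, TCA.p2_pr], ha, hc, Or.inr ⟨_, rfl, h'⟩⟩
      · exact Or.inr ⟨_, by rw [e', hdB2 _ _ rfl, TCA.p2_pr], hb, hc, Or.inr ⟨_, rfl, h'⟩⟩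

/-- The exponential: premorphisms, with apartness witnessed at a point. -/
@[reducible] def arr (A B : ApType T) : ApType T where
  pos := T.prod (T.arr A.pos B.pos) (T.arr A.pos (T.arr A.pos (T.arr B.neg A.neg)))
  neg := T.prod A.pos B.neg
  carrier := {f | IsPremorphism A B f}
  apart f g n := IsPremorphism A B f ∧ IsPremorphism A B g ∧ p1 n ∈ A.carrier ∧
    B.apart (T.app (p1 f) (p1 n)) (T.app (p1 g) (p1 n)) (p2 n)
  mem_of_apart h := ⟨h.1, h.2.1⟩
  carrier_nonempty := by
    obtain ⟨b, hb⟩ := B.carrier_nonempty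
    obtain ⟨e, he⟩ := Repr.const (S := A.pos) b
    obtain ⟨m⟩ := A.neg_nonempty
    obtain ⟨r, hr⟩ := Repr.abs3 (S := A.pos) (U := A.pos) (V := B.neg) (Repr.const m)
    refine ⟨pr e r, fun a _ => by simpa [he] using hb, fun a _ a' _ n h => ?_⟩
    simp only [TCA.p1_pr, he] at h
    exact (B.irrefl _ _ h).elim
  neg_nonempty := by
    obtain ⟨a, _⟩ := A.carrier_nonempty
    exact B.neg_nonempty.map (pr a)
  irrefl f n h := B.irrefl _ _ h.2.2.2
  symm := by
    obtain ⟨sB, hsB, hB⟩ := B.exists_symm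
    obtain ⟨e, he⟩ := (Repr.pr (Repr.p1 (Repr.p2 Repr.id)) (hsB.comp
      (((Repr.app (Repr.id.p1.p1.p1) Repr.id.p2.p1).pr
        (Repr.app (Repr.id.p1.p2.p1) Repr.id.p2.p1)).pr Repr.id.p2.p2))).abs3
      (S := T.prod (T.arr A.pos B.pos) (T.arr A.pos (T.arr A.pos (T.arr B.neg A.neg))))
      (U := T.prod (T.arr A.pos B.pos) (T.arr A.pos (T.arr A.pos (T.arr B.neg A.neg))))
      (V := T.prod A.pos B.neg)
    refine ⟨e, fun f g n ⟨hf, hg, hn, h⟩ => ?_⟩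
    rw [he]
    exact ⟨hg, hf, by simpa using hn, by simpa using hB _ _ _ h⟩
  trans := by
    obtain ⟨tB, htB, hB⟩ := B.exists_trans
    obtain ⟨H, hH, h1, h2⟩ := Repr.case (S := T.prod A.pos (T.sum B.neg B.neg))
      (Repr.id.p2) ((Repr.pr Repr.id.p1.p1 Repr.id.p2).il (V := T.prod A.pos B.neg))
      ((Repr.pr Repr.id.p1.p1 Repr.id.p2).ir (V := T.prod A.pos B.neg))
    obtain ⟨e, he⟩ := (hH.comp (Repr.pr (Repr.p1 (Repr.p2 Repr.id)) (htB.comp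
      ((((Repr.app (Repr.id.p1.p1.p1.p1) Repr.id.p2.p1).pr
        (Repr.app (Repr.id.p1.p1.p2.p1) Repr.id.p2.p1)).pr
        (Repr.app (Repr.id.p1.p2.p1) Repr.id.p2.p1)).pr Repr.id.p2.p2)))).abs4
      (S := T.prod (T.arr A.pos B.pos) (T.arr A.pos (T.arr A.pos (T.arr B.neg A.neg))))
      (U := T.prod (T.arr A.pos B.pos) (T.arr A.pos (T.arr A.pos (T.arr B.neg A.neg))))
      (V := T.prod (T.arr A.pos B.pos) (T.arr A.pos (T.arr A.pos (T.arr B.neg A.neg))))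
      (W := T.prod A.pos B.neg)
    refine ⟨e, fun f g k hk n ⟨hf, hg, hn, h⟩ => ?_⟩
    rw [he]
    simp only [TCA.p1_pr, TCA.p2_pr]
    rcases hB _ _ _ (hk.1 _ hn) _ h with ⟨m, e', h'⟩ | ⟨m, e', h'⟩
    · exact Or.inl ⟨_, by rw [e', h1 _ _ (TCA.p2_pr _ _)], hf, hk, by simpa using hn,
        by simpa using h'⟩
    · exact Or.inr ⟨_, by rw [e', h2 _ _ (TCA.p2_pr _ _)], hg, hk, by simpa using hn,
        by simpa using h'⟩

/-- The binary sum. -/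
@[reducible] def sum (hT : T.Consistent) (A B : ApType T) : ApType T where
  pos := T.sum A.pos B.pos
  neg := T.prod A.neg B.neg
  carrier := {x | (∃ a ∈ A.carrier, x = il B.pos a) ∨ ∃ b ∈ B.carrier, x = ir A.pos b}
  apart x y n :=
    (∃ a a', x = il B.pos a ∧ y = il B.pos a' ∧ A.apart a a' (p1 n)) ∨
    (∃ b b', x = ir A.pos b ∧ y = ir A.pos b' ∧ B.apart b b' (p2 n)) ∨
    (∃ a ∈ A.carrier, ∃ b ∈ B.carrier, x = il B.pos a ∧ y = ir A.pos b) ∨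
    (∃ a ∈ A.carrier, ∃ b ∈ B.carrier, x = ir A.pos b ∧ y = il B.pos a)
  mem_of_apart := by
    rintro x y n (⟨a, a', rfl, rfl, h⟩ | ⟨b, b', rfl, rfl, h⟩ | ⟨a, ha, b, hb, rfl, rfl⟩ |
      ⟨a, ha, b, hb, rfl, rfl⟩)
    · exact ⟨Or.inl ⟨a, (A.mem_of_apart h).1, rfl⟩, Or.inl ⟨a', (A.mem_of_apart h).2, rfl⟩⟩
    · exact ⟨Or.inr ⟨b, (B.mem_of_apart h).1, rfl⟩, Or.inr ⟨b', (B.mem_of_apart h).2, rfl⟩⟩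
    · exact ⟨Or.inl ⟨a, ha, rfl⟩, Or.inr ⟨b, hb, rfl⟩⟩
    · exact ⟨Or.inr ⟨b, hb, rfl⟩, Or.inl ⟨a, ha, rfl⟩⟩
  carrier_nonempty := by
    obtain ⟨a, ha⟩ := A.carrier_nonempty
    exact ⟨_, Or.inl ⟨a, ha, rfl⟩⟩
  neg_nonempty := by
    obtain ⟨m⟩ := A.neg_nonempty
    exact B.neg_nonempty.map (pr m)
  irrefl x n := by
    rintro (⟨a, a', rfl, h, h'⟩ | ⟨b, b', rfl, h, h'⟩ | ⟨a, ha, b, hb, rfl, h⟩ |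
      ⟨a, ha, b, hb, rfl, h⟩)
    · rw [TCA.il_inj h] at h'
      exact A.irrefl _ _ h'
    · rw [TCA.ir_inj h] at h'
      exact B.irrefl _ _ h'
    · exact hT.il_ne_ir _ _ h
    · exact hT.il_ne_ir _ _ h.symm
  symm := by
    obtain ⟨sA, hsA, hA⟩ := A.exists_symm
    obtain ⟨sB, hsB, hB⟩ := B.exists_symm
    -- symmetry when the second element is on the left, on the right
    obtain ⟨HA, hHA, hA1, hA2⟩ := Repr.case
      (S := T.prod (T.prod (T.sum A.pos B.pos) (T.prod A.neg B.neg)) A.pos) Repr.id.p1.p1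
      ((hsA.comp ((Repr.id.p2.pr Repr.id.p1.p2).pr Repr.id.p1.p1.p2.p1)).pr Repr.id.p1.p1.p2.p2)
      Repr.id.p1.p1.p2
    obtain ⟨HB, hHB, hB1, hB2⟩ := Repr.case
      (S := T.prod (T.prod (T.sum A.pos B.pos) (T.prod A.neg B.neg)) B.pos) Repr.id.p1.p1
      Repr.id.p1.p1.p2
      (Repr.id.p1.p1.p2.p1.pr (hsB.comp ((Repr.id.p2.pr Repr.id.p1.p2).pr Repr.id.p1.p1.p2.p2)))
    obtain ⟨H, hH, h1, h2⟩ := Repr.case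
      (S := T.prod (T.prod (T.sum A.pos B.pos) (T.sum A.pos B.pos)) (T.prod A.neg B.neg))
      Repr.id.p1.p2
      (hHA.comp ((Repr.id.p1.p1.p1.pr Repr.id.p1.p2).pr Repr.id.p2))
      (hHB.comp ((Repr.id.p1.p1.p1.pr Repr.id.p1.p2).pr Repr.id.p2))
    obtain ⟨e, he⟩ := hH.abs3
    refine ⟨e, ?_⟩
    simp only [he]
    rintro x y n (⟨a, a', rfl, rfl, h⟩ | ⟨b, b', rfl, rfl, h⟩ | ⟨a, ha, b, hb, rfl, rfl⟩ |
      ⟨a, ha, b, hb, rfl, rfl⟩)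
    · refine Or.inl ⟨a', a, rfl, rfl, ?_⟩
      rw [h1 _ a' (by simp), hA1 _ a (by simp)]
      simpa using hA _ _ _ h
    · refine Or.inr (Or.inl ⟨b', b, rfl, rfl, ?_⟩)
      rw [h2 _ b' (by simp), hB2 _ b (by simp)]
      simpa using hB _ _ _ h
    · exact Or.inr (Or.inr (Or.inr ⟨a, ha, b, hb, rfl, rfl⟩))
    · exact Or.inr (Or.inr (Or.inl ⟨a, ha, b, hb, rfl, rfl⟩))
  trans := by
    obtain ⟨tA, htA, hA⟩ := A.exists_trans
    obtain ⟨tB, htB, hB⟩ := B.exists_trans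
    obtain ⟨mA⟩ := A.neg_nonempty
    obtain ⟨mB⟩ := B.neg_nonempty
    -- redistribute evidence
    obtain ⟨dA, hdA, hdA1, hdA2⟩ := Repr.case (S := T.sum A.neg A.neg) Repr.id
      ((Repr.id.p2.pr (Repr.const mB)).il (V := T.prod A.neg B.neg))
      ((Repr.id.p2.pr (Repr.const mB)).ir (V := T.prod A.neg B.neg))
    obtain ⟨dB, hdB, hdB1, hdB2⟩ := Repr.case (S := T.sum B.neg B.neg) Repr.id
      (((Repr.const mA).pr Repr.id.p2).il (V := T.prod A.neg B.neg))
      (((Repr.const mA).pr Repr.id.p2).ir (V := T.prod A.neg B.neg))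
    -- `x` and `y` on the left; `x` and `y` on the right
    obtain ⟨FA, hFA, hFA1, hFA2⟩ := Repr.case
      (S := T.prod (T.prod (T.prod A.pos A.pos) (T.sum A.pos B.pos)) (T.prod A.neg B.neg))
      Repr.id.p1.p2
      (hdA.comp (htA.comp ((Repr.id.p1.p1.p1.pr Repr.id.p2).pr Repr.id.p1.p2.p1)))
      (Repr.id.p1.p2.il (V := T.prod A.neg B.neg))
    obtain ⟨FB, hFB, hFB1, hFB2⟩ := Repr.case
      (S := T.prod (T.prod (T.prod B.pos B.pos) (T.sum A.pos B.pos)) (T.prod A.neg B.neg))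
      Repr.id.p1.p2
      (Repr.id.p1.p2.il (V := T.prod A.neg B.neg))
      (hdB.comp (htB.comp ((Repr.id.p1.p1.p1.pr Repr.id.p2).pr Repr.id.p1.p2.p2)))
    -- `x` on the left and `y` on the right; `x` on the right and `y` on the left
    obtain ⟨FC, hFC, hFC1, hFC2⟩ := Repr.case
      (S := T.prod (T.sum A.pos B.pos) (T.prod A.neg B.neg)) Repr.id.p1
      (Repr.id.p1.p2.ir (V := T.prod A.neg B.neg)) (Repr.id.p1.p2.il (V := T.prod A.neg B.neg))
    obtain ⟨FD, hFD, hFD1, hFD2⟩ := Repr.case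
      (S := T.prod (T.sum A.pos B.pos) (T.prod A.neg B.neg)) Repr.id.p1
      (Repr.id.p1.p2.il (V := T.prod A.neg B.neg)) (Repr.id.p1.p2.ir (V := T.prod A.neg B.neg))
    obtain ⟨HA, hHA, hA1, hA2⟩ := Repr.case
      (S := T.prod (T.prod (T.prod (T.sum A.pos B.pos) (T.sum A.pos B.pos))
        (T.prod A.neg B.neg)) A.pos) Repr.id.p1.p1.p1
      (hFA.comp (((Repr.id.p1.p2.pr Repr.id.p2).pr Repr.id.p1.p1.p1.p2).pr Repr.id.p1.p1.p2))
      (hFC.comp (Repr.id.p1.p1.p1.p2.pr Repr.id.p1.p1.p2))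
    obtain ⟨HB, hHB, hB1, hB2⟩ := Repr.case
      (S := T.prod (T.prod (T.prod (T.sum A.pos B.pos) (T.sum A.pos B.pos))
        (T.prod A.neg B.neg)) B.pos) Repr.id.p1.p1.p1
      (hFD.comp (Repr.id.p1.p1.p1.p2.pr Repr.id.p1.p1.p2))
      (hFB.comp (((Repr.id.p1.p2.pr Repr.id.p2).pr Repr.id.p1.p1.p1.p2).pr Repr.id.p1.p1.p2))
    obtain ⟨H, hH, h1, h2⟩ := Repr.case
      (S := T.prod (T.prod (T.prod (T.sum A.pos B.pos) (T.sum A.pos B.pos)) (T.sum A.pos B.pos))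
        (T.prod A.neg B.neg)) Repr.id.p1.p1.p1
      (hHA.comp (((Repr.id.p1.p1.p1.p2.pr Repr.id.p1.p1.p2).pr Repr.id.p1.p2).pr Repr.id.p2))
      (hHB.comp (((Repr.id.p1.p1.p1.p2.pr Repr.id.p1.p1.p2).pr Repr.id.p1.p2).pr Repr.id.p2))
    obtain ⟨e, he⟩ := hH.abs4
    refine ⟨e, ?_⟩
    simp only [he]
    rintro x y z hz n (⟨a, a', rfl, rfl, h⟩ | ⟨b, b', rfl, rfl, h⟩ | ⟨a, ha, b, hb, rfl, rfl⟩ |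
      ⟨a, ha, b, hb, rfl, rfl⟩)
    · rw [h1 _ a (by simp), hA1 _ a' (by simp)]
      rcases hz with ⟨c, hc, rfl⟩ | ⟨c, hc, rfl⟩
      · rw [hFA1 _ c (by simp)]
        simp only [TCA.p1_pr, TCA.p2_pr]
        rcases hA _ _ _ hc _ h with ⟨m, e', h'⟩ | ⟨m, e', h'⟩
        · exact Or.inl ⟨_, by rw [e', hdA1 _ _ rfl, TCA.p2_pr],
            Or.inl ⟨_, _, rfl, rfl, by simpa using h'⟩⟩
        · exact Or.inr ⟨_, by rw [e', hdA2 _ _ rfl, TCA.p2_pr],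
            Or.inl ⟨_, _, rfl, rfl, by simpa using h'⟩⟩
      · rw [hFA2 _ c (by simp)]
        exact Or.inl ⟨_, rfl, Or.inr (Or.inr (Or.inl ⟨a, (A.mem_of_apart h).1, c, hc, rfl, rfl⟩))⟩
    · rw [h2 _ b (by simp), hB2 _ b' (by simp)]
      rcases hz with ⟨c, hc, rfl⟩ | ⟨c, hc, rfl⟩
      · rw [hFB1 _ c (by simp)]
        exact Or.inl ⟨_, rfl, Or.inr (Or.inr (Or.inr ⟨c, hc, b, (B.mem_of_apart h).1, rfl, rfl⟩))⟩
      · rw [hFB2 _ c (by simp)]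
        simp only [TCA.p1_pr, TCA.p2_pr]
        rcases hB _ _ _ hc _ h with ⟨m, e', h'⟩ | ⟨m, e', h'⟩
        · exact Or.inl ⟨_, by rw [e', hdB1 _ _ rfl, TCA.p2_pr],
            Or.inr (Or.inl ⟨_, _, rfl, rfl, by simpa using h'⟩)⟩
        · exact Or.inr ⟨_, by rw [e', hdB2 _ _ rfl, TCA.p2_pr],
            Or.inr (Or.inl ⟨_, _, rfl, rfl, by simpa using h'⟩)⟩
    · rw [h1 _ a (by simp), hA2 _ b (by simp)]
      rcases hz with ⟨c, hc, rfl⟩ | ⟨c, hc, rfl⟩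
      · rw [hFC1 _ c (by simp)]
        exact Or.inr ⟨_, rfl, Or.inr (Or.inr (Or.inr ⟨c, hc, b, hb, rfl, rfl⟩))⟩
      · rw [hFC2 _ c (by simp)]
        exact Or.inl ⟨_, rfl, Or.inr (Or.inr (Or.inl ⟨a, ha, c, hc, rfl, rfl⟩))⟩
    · rw [h2 _ b (by simp), hB1 _ a (by simp)]
      rcases hz with ⟨c, hc, rfl⟩ | ⟨c, hc, rfl⟩
      · rw [hFD1 _ c (by simp)]
        exact Or.inl ⟨_, rfl, Or.inr (Or.inr (Or.inr ⟨c, hc, b, hb, rfl, rfl⟩))⟩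
      · rw [hFD2 _ c (by simp)]
        exact Or.inr ⟨_, rfl, Or.inr (Or.inr (Or.inl ⟨a, ha, c, hc, rfl, rfl⟩))⟩

/-- The natural numbers object: numerals, where anything is evidence that distinct ones are apart. -/
@[reducible] def nat (hT : T.Consistent) : ApType T where
  pos := T.nat
  neg := T.nat
  carrier := Set.range T.numeral
  apart x y _ := x ∈ Set.range T.numeral ∧ y ∈ Set.range T.numeral ∧ x ≠ y
  mem_of_apart h := ⟨h.1, h.2.1⟩
  carrier_nonempty := ⟨_, 0, rfl⟩
  neg_nonempty := ⟨T.zero⟩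
  irrefl x n h := h.2.2 rfl
  symm := (Repr.abs3 (Repr.p2 Repr.id)).imp fun _ _ _ _ _ h => ⟨h.2.1, h.1, h.2.2.symm⟩
  trans := by
    obtain ⟨E, hE, hE'⟩ := T.exists_natEq
    -- left or right according to a number being zero
    obtain ⟨D, hD, hD'⟩ := Repr.natRec (S := T.prod T.nat T.nat) (Repr.id.p1.il (V := T.nat))
      (Repr.id.p1.p1.p1.ir (V := T.nat)) Repr.id.p2
    obtain ⟨e, he⟩ := (hD.comp (Repr.id.p2.pr (hE.comp (Repr.id.p1.p1.p1.pr
      Repr.id.p1.p2)))).abs4 (S := T.nat) (U := T.nat) (V := T.nat) (W := T.nat)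
    refine ⟨e, ?_⟩
    rintro _ _ _ ⟨k, rfl⟩ n ⟨⟨i, rfl⟩, ⟨j, rfl⟩, hne⟩
    simp only [he, TCA.p1_pr, TCA.p2_pr, hE']
    by_cases h : i = k
    · subst h
      rw [if_pos rfl, hD' _ 1 (by simp)]
      exact Or.inr ⟨n, by simp, ⟨j, rfl⟩, ⟨i, rfl⟩, hne.symm⟩
    · rw [if_neg h, hD' _ 0 (by simp)]
      exact Or.inl ⟨n, by simp, ⟨i, rfl⟩, ⟨k, rfl⟩, fun h' => h (hT.numeral_inj h')⟩

end ApType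

namespace ApType

variable {T : TCA}

/-- The realizers of an apartness type: its elements up to equivalence. -/
def El (A : ApType T) : Type := Quotient A.setoid

/-- Application of (classes of) premorphisms to (classes of) elements. -/
def app {A B : ApType T} : (arr A B).El → A.El → B.El :=
  Quotient.lift₂ (fun f a => Quotient.mk B.setoid ⟨T.app (p1 f.1) a.1, f.2.1 _ a.2⟩) (by
    intro f a g b hf ha
    apply Quotient.sound
    apply Setoid.trans (b := (⟨T.app (p1 f.1) b.1, f.2.1 _ b.2⟩ : B.carrier))
    · exact fun n hn => ha _ (f.2.2 _ a.2 _ b.2 _ hn)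
    · exact fun n hn => hf (pr b.1 n) ⟨f.2, g.2, by simp, by simpa using hn⟩)

/-- `F` is given by a premorphism. -/
def IsMor (A B : ApType T) (F : T.El A.pos → T.El B.pos) : Prop :=
  Repr F ∧ (∀ a ∈ A.carrier, F a ∈ B.carrier) ∧
  ∃ r : T.El (T.prod (T.prod A.pos A.pos) B.neg) → T.El A.neg, Repr r ∧
    ∀ a₀ ∈ A.carrier, ∀ a₁ ∈ A.carrier, ∀ n, B.apart (F a₀) (F a₁) n →
      A.apart a₀ a₁ (r (pr (pr a₀ a₁) n))

namespace IsMor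

variable {A B C D : ApType T}

theorem exists_mem {F : T.El A.pos → T.El B.pos} (h : IsMor A B F) :
    ∃ f : (arr A B).carrier, ∀ a, T.app (p1 f.1) a = F a := by
  obtain ⟨⟨e, he⟩, h1, r, hr, h2⟩ := h
  obtain ⟨e', he'⟩ := hr.abs3
  refine ⟨⟨pr e e', fun a ha => by simpa [he] using h1 a ha, fun a ha b hb n hn => ?_⟩,
    fun a => by simp [he]⟩
  simp only [TCA.p1_pr, TCA.p2_pr, he, he'] at hn ⊢
  exact h2 a ha b hb n hn

theorem id : IsMor A A (fun x => x) :=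
  ⟨Repr.id, fun _ h => h, _, Repr.id.p2, fun _ _ _ _ _ h => by simpa using h⟩

theorem const {b : T.El B.pos} (hb : b ∈ B.carrier) : IsMor A B (fun _ => b) := by
  obtain ⟨m⟩ := A.neg_nonempty
  exact ⟨Repr.const b, fun _ _ => hb, _, Repr.const m, fun _ _ _ _ _ h => (B.irrefl _ _ h).elim⟩

theorem comp {F : T.El B.pos → T.El C.pos} {G : T.El A.pos → T.El B.pos}
    (hF : IsMor B C F) (hG : IsMor A B G) : IsMor A C (fun x => F (G x)) := by
  obtain ⟨hF0, hF1, r, hr, hF2⟩ := hF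
  obtain ⟨hG0, hG1, r', hr', hG2⟩ := hG
  refine ⟨hF0.comp hG0, fun a ha => hF1 _ (hG1 a ha), _, hr'.comp (Repr.id.p1.pr (hr.comp
    (((hG0.comp Repr.id.p1.p1).pr (hG0.comp Repr.id.p1.p2)).pr Repr.id.p2))),
    fun a ha b hb n hn => ?_⟩
  simpa using hG2 a ha b hb _ (hF2 _ (hG1 a ha) _ (hG1 b hb) n hn)

theorem fst : IsMor (prod A B) A p1 :=
  ⟨Repr.id.p1, fun _ h => h.1, _, Repr.id.p2.il, fun _ ha _ hb n hn =>
    ⟨ha, hb, Or.inl ⟨n, by simp, hn⟩⟩⟩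

theorem snd : IsMor (prod A B) B p2 :=
  ⟨Repr.id.p2, fun _ h => h.2, _, Repr.id.p2.ir, fun _ ha _ hb n hn =>
    ⟨ha, hb, Or.inr ⟨n, by simp, hn⟩⟩⟩

theorem p1 {F : T.El A.pos → T.El (prod B C).pos} (h : IsMor A (prod B C) F) :
    IsMor A B (fun x => TCA.p1 (F x)) := fst.comp h

theorem p2 {F : T.El A.pos → T.El (prod B C).pos} (h : IsMor A (prod B C) F) :
    IsMor A C (fun x => TCA.p2 (F x)) := snd.comp h

theorem pr {F : T.El A.pos → T.El B.pos} {G : T.El A.pos → T.El C.pos}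
    (hF : IsMor A B F) (hG : IsMor A C G) : IsMor A (prod B C) (fun x => TCA.pr (F x) (G x)) := by
  obtain ⟨hF0, hF1, r, hr, hF2⟩ := hF
  obtain ⟨hG0, hG1, r', hr', hG2⟩ := hG
  obtain ⟨H, hH, h1, h2⟩ := Repr.case
    (S := T.prod (T.prod A.pos A.pos) (T.sum B.neg C.neg)) Repr.id.p2
    (hr.comp (Repr.id.p1.p1.pr Repr.id.p2)) (hr'.comp (Repr.id.p1.p1.pr Repr.id.p2))
  refine ⟨hF0.pr hG0, fun a ha => ⟨by simpa using hF1 a ha, by simpa using hG1 a ha⟩, H, hH, ?_⟩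
  rintro a ha b hb n ⟨-, -, ⟨m, rfl, hm⟩ | ⟨m, rfl, hm⟩⟩
  · rw [h1 _ m (by simp)]
    simp only [TCA.p1_pr, TCA.p2_pr] at hm ⊢
    exact hF2 a ha b hb m hm
  · rw [h2 _ m (by simp)]
    simp only [TCA.p1_pr, TCA.p2_pr] at hm ⊢
    exact hG2 a ha b hb m hm

theorem app {F : T.El A.pos → T.El (arr B C).pos} {G : T.El A.pos → T.El B.pos}
    (hF : IsMor A (arr B C) F) (hG : IsMor A B G) :
    IsMor A C (fun x => T.app (TCA.p1 (F x)) (G x)) := by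
  suffices h : IsMor (prod (arr B C) B) C (fun x => T.app (TCA.p1 (TCA.p1 x)) (TCA.p2 x)) by
    simpa using h.comp (hF.pr hG)
  obtain ⟨s, hs, hs'⟩ := C.exists_symm
  obtain ⟨t, ht, ht'⟩ := C.exists_trans
  -- the state consists of the two arguments and evidence
  let S := T.prod (T.prod (T.prod (arr B C).pos B.pos) (T.prod (arr B C).pos B.pos)) C.neg
  have hx : Repr (fun x : T.El S => T.app (TCA.p1 (TCA.p1 (TCA.p1 (TCA.p1 x))))
      (TCA.p2 (TCA.p1 (TCA.p1 x)))) := Repr.id.p1.p1.p1.p1.app Repr.id.p1.p1.p2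
  have hy : Repr (fun x : T.El S => T.app (TCA.p1 (TCA.p1 (TCA.p2 (TCA.p1 x))))
      (TCA.p2 (TCA.p2 (TCA.p1 x)))) := Repr.id.p1.p2.p1.p1.app Repr.id.p1.p2.p2
  have hz : Repr (fun x : T.El S => T.app (TCA.p1 (TCA.p1 (TCA.p1 (TCA.p1 x))))
      (TCA.p2 (TCA.p2 (TCA.p1 x)))) := Repr.id.p1.p1.p1.p1.app Repr.id.p1.p2.p2
  obtain ⟨H, hH, h1, h2⟩ := Repr.case (ht.comp (((hx.pr hy).pr hz).pr Repr.id.p2))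
    ((((Repr.id.p1.p1.p1.p1.p2.app Repr.id.p1.p1.p1.p2).app Repr.id.p1.p1.p2.p2).app
      Repr.id.p2).ir (V := T.prod B.pos C.neg))
    ((Repr.id.p1.p1.p2.p2.pr (hs.comp (((hy.comp Repr.id.p1).pr (hz.comp Repr.id.p1)).pr
      Repr.id.p2))).il (V := B.neg))
  refine ⟨Repr.id.p1.p1.app Repr.id.p2, fun a ha => ha.1.1 _ ha.2, H, hH,
    fun a ha b hb n hn => ⟨ha, hb, ?_⟩⟩
  rcases ht' _ _ (T.app (TCA.p1 (TCA.p1 a)) (TCA.p2 b)) (ha.1.1 _ hb.2) n hn with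
    ⟨m, e, hm⟩ | ⟨m, e, hm⟩
  · rw [h1 _ m (by simpa using e)]
    refine Or.inr ⟨_, rfl, ?_⟩
    simpa using ha.1.2 _ ha.2 _ hb.2 _ hm
  · rw [h2 _ m (by simpa using e)]
    refine Or.inl ⟨_, rfl, ha.1, hb.1, by simpa using hb.2, ?_⟩
    simpa using hs' _ _ _ hm

theorem curry {F : T.El (prod A B).pos → T.El C.pos} (h : IsMor (prod A B) C F) :
    ∃ G, IsMor A (arr B C) G ∧ ∀ a b, T.app (TCA.p1 (G a)) b = F (TCA.pr a b) := by
  obtain ⟨hF0, hF1, r, hr, hF2⟩ := h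
  obtain ⟨mA⟩ := A.neg_nonempty
  obtain ⟨mB⟩ := B.neg_nonempty
  obtain ⟨dA, hdA, hdA1, -⟩ := Repr.case (S := T.sum A.neg B.neg) Repr.id Repr.id.p2 (Repr.const mA)
  obtain ⟨dB, hdB, -, hdB2⟩ := Repr.case (S := T.sum A.neg B.neg) Repr.id (Repr.const mB) Repr.id.p2
  obtain ⟨g, hg⟩ := hF0.abs2
  obtain ⟨q, hq⟩ := (hdB.comp (hr.comp (((Repr.id.p1.p1.p1.pr Repr.id.p1.p1.p2).pr
    (Repr.id.p1.p1.p1.pr Repr.id.p1.p2)).pr Repr.id.p2))).abs4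
    (S := A.pos) (U := B.pos) (V := B.pos) (W := C.neg)
  have hgq : ∀ a ∈ A.carrier, TCA.pr (T.app g a) (T.app q a) ∈ (arr B C).carrier := by
    refine fun a ha => ⟨fun b hb => ?_, fun b hb b' hb' n hn => ?_⟩
    · rw [TCA.p1_pr, hg]
      exact hF1 _ ⟨by simpa using ha, by simpa using hb⟩
    · simp only [TCA.p1_pr, TCA.p2_pr, hg, hq] at hn ⊢
      obtain ⟨-, -, ⟨m, e, hm⟩ | ⟨m, e, hm⟩⟩ := hF2 _ ⟨by simpa using ha, by simpa using hb⟩ _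
        ⟨by simpa using ha, by simpa using hb'⟩ n hn
      · simp only [TCA.p1_pr] at hm
        exact (A.irrefl _ _ hm).elim
      · rw [e, hdB2 _ _ rfl]
        simpa using hm
  refine ⟨fun a => TCA.pr (T.app g a) (T.app q a), ⟨(Repr.elt g).pr (Repr.elt q), hgq, _,
    hdA.comp (hr.comp (((Repr.id.p1.p1.pr Repr.id.p2.p1).pr
      (Repr.id.p1.p2.pr Repr.id.p2.p1)).pr Repr.id.p2.p2)), ?_⟩, fun a b => by rw [TCA.p1_pr, hg]⟩
  rintro a ha a' ha' n ⟨-, -, hn, hn'⟩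
  simp only [TCA.p1_pr, TCA.p2_pr, hg] at hn' ⊢
  obtain ⟨-, -, ⟨m, e, hm⟩ | ⟨m, e, hm⟩⟩ := hF2 _ ⟨by simpa using ha, by simpa using hn⟩ _
    ⟨by simpa using ha', by simpa using hn⟩ _ hn'
  · rw [e, hdA1 _ _ rfl]
    simpa using hm
  · simp only [TCA.p2_pr] at hm
    exact (B.irrefl _ _ hm).elim

theorem inl (hT : T.Consistent) : IsMor A (sum hT A B) (il B.pos) := by
  refine ⟨Repr.id.il, fun a ha => Or.inl ⟨a, ha, rfl⟩, _, Repr.id.p2.p1, ?_⟩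
  rintro a - a' - n (⟨b, b', h, h', hn⟩ | ⟨b, b', h, h', hn⟩ | ⟨b, hb, b', hb', h, h'⟩ |
    ⟨b, hb, b', hb', h, h'⟩)
  · rw [TCA.il_inj h, TCA.il_inj h', TCA.p2_pr]
    exact hn
  · exact (hT.il_ne_ir _ _ h).elim
  · exact (hT.il_ne_ir _ _ h').elim
  · exact (hT.il_ne_ir _ _ h).elim

theorem inr (hT : T.Consistent) : IsMor B (sum hT A B) (ir A.pos) := by
  refine ⟨Repr.id.ir, fun a ha => Or.inr ⟨a, ha, rfl⟩, _, Repr.id.p2.p2, ?_⟩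
  rintro a - a' - n (⟨b, b', h, h', hn⟩ | ⟨b, b', h, h', hn⟩ | ⟨b, hb, b', hb', h, h'⟩ |
    ⟨b, hb, b', hb', h, h'⟩)
  · exact (hT.il_ne_ir _ _ h.symm).elim
  · rw [TCA.ir_inj h, TCA.ir_inj h', TCA.p2_pr]
    exact hn
  · exact (hT.il_ne_ir _ _ h.symm).elim
  · exact (hT.il_ne_ir _ _ h'.symm).elim

theorem copair (hT : T.Consistent) {F : T.El A.pos → T.El C.pos} {G : T.El B.pos → T.El C.pos}
    (hF : IsMor A C F) (hG : IsMor B C G) : ∃ K, IsMor (sum hT A B) C K ∧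
      (∀ a, K (il B.pos a) = F a) ∧ ∀ b, K (ir A.pos b) = G b := by
  obtain ⟨hF0, hF1, r, hr, hF2⟩ := hF
  obtain ⟨hG0, hG1, r', hr', hG2⟩ := hG
  obtain ⟨mA⟩ := A.neg_nonempty
  obtain ⟨mB⟩ := B.neg_nonempty
  obtain ⟨K, hK, hK1, hK2⟩ := Repr.case (S := T.sum A.pos B.pos) Repr.id
    (hF0.comp Repr.id.p2) (hG0.comp Repr.id.p2)
  have hK1' : ∀ a, K (il B.pos a) = F a := fun a => by rw [hK1 _ a rfl, TCA.p2_pr]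
  have hK2' : ∀ b, K (ir A.pos b) = G b := fun b => by rw [hK2 _ b rfl, TCA.p2_pr]
  -- evidence when the first argument is on the left, on the right
  obtain ⟨P, hP, hP1, -⟩ := Repr.case
    (S := T.prod (T.prod A.pos (T.sum A.pos B.pos)) C.neg) Repr.id.p1.p2
    ((hr.comp ((Repr.id.p1.p1.p1.pr Repr.id.p2).pr Repr.id.p1.p2)).pr (Repr.const mB))
    (Repr.const (TCA.pr mA mB))
  obtain ⟨Q, hQ, -, hQ2⟩ := Repr.case
    (S := T.prod (T.prod B.pos (T.sum A.pos B.pos)) C.neg) Repr.id.p1.p2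
    (Repr.const (TCA.pr mA mB))
    ((Repr.const mA).pr (hr'.comp ((Repr.id.p1.p1.p1.pr Repr.id.p2).pr Repr.id.p1.p2)))
  obtain ⟨H, hH, h1, h2⟩ := Repr.case
    (S := T.prod (T.prod (T.sum A.pos B.pos) (T.sum A.pos B.pos)) C.neg) Repr.id.p1.p1
    (hP.comp ((Repr.id.p2.pr Repr.id.p1.p1.p2).pr Repr.id.p1.p2))
    (hQ.comp ((Repr.id.p2.pr Repr.id.p1.p1.p2).pr Repr.id.p1.p2))
  refine ⟨K, ⟨hK, ?_, H, hH, ?_⟩, hK1', hK2'⟩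
  · rintro _ (⟨a, ha, rfl⟩ | ⟨b, hb, rfl⟩)
    · rw [hK1']; exact hF1 a ha
    · rw [hK2']; exact hG1 b hb
  · rintro _ (⟨a, ha, rfl⟩ | ⟨b, hb, rfl⟩) _ (⟨a', ha', rfl⟩ | ⟨b', hb', rfl⟩) n hn
    · rw [hK1', hK1'] at hn
      refine Or.inl ⟨a, a', rfl, rfl, ?_⟩
      rw [h1 _ a (by simp), hP1 _ a' (by simp)]
      simpa using hF2 a ha a' ha' n hn
    · exact Or.inr (Or.inr (Or.inl ⟨a, ha, b', hb', rfl, rfl⟩))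
    · exact Or.inr (Or.inr (Or.inr ⟨a', ha', b, hb, rfl, rfl⟩))
    · rw [hK2', hK2'] at hn
      refine Or.inr (Or.inl ⟨b, b', rfl, rfl, ?_⟩)
      rw [h2 _ b (by simp), hQ2 _ b' (by simp)]
      simpa using hG2 b hb b' hb' n hn

theorem succ (hT : T.Consistent) : IsMor (nat hT) (nat hT) (T.app T.succ) := by
  refine ⟨Repr.elt _, ?_, _, Repr.id.p2, ?_⟩
  · rintro _ ⟨n, rfl⟩
    exact ⟨n + 1, rfl⟩
  · rintro a ha b hb n ⟨-, -, h⟩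
    exact ⟨ha, hb, fun e => h (by rw [e])⟩

theorem natRec (hT : T.Consistent) {z : T.El A.pos} (hz : z ∈ A.carrier)
    {F : T.El (prod (nat hT) A).pos → T.El A.pos} (hF : IsMor (prod (nat hT) A) A F) :
    ∃ K, IsMor (nat hT) A K ∧ K (T.numeral 0) = z ∧
      ∀ n, K (T.numeral (n + 1)) = F (TCA.pr (T.numeral n) (K (T.numeral n))) := by
  obtain ⟨K, hK, hK'⟩ := Repr.natRec (S := T.nat) (Repr.const z)
    (hF.1.comp (Repr.id.p1.p2.pr Repr.id.p2)) Repr.id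
  have h0 : K (T.numeral 0) = z := hK' _ 0 rfl
  have h1 : ∀ n, K (T.numeral (n + 1)) = F (TCA.pr (T.numeral n) (K (T.numeral n))) := fun n => by
    have e : ∀ m : ℕ, K (T.numeral m) =
        Nat.rec z (fun m v => F (TCA.pr (T.numeral m) v)) m := fun m => by
      rw [hK' _ m rfl]; simp only [TCA.p1_pr, TCA.p2_pr]
    rw [e, e]
  refine ⟨K, ⟨hK, ?_, _, Repr.const T.zero, ?_⟩, h0, h1⟩
  · rintro _ ⟨n, rfl⟩
    induction n with
    | zero => rw [h0]; exact hz
    | succ n ih => rw [h1]; exact hF.2.1 _ ⟨by rw [TCA.p1_pr]; exact ⟨n, rfl⟩, by simpa using ih⟩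
  · intro a ha b hb n hn
    refine ⟨ha, hb, fun e => ?_⟩
    rw [e] at hn
    exact A.irrefl _ _ hn

end IsMor

/-- The class of an element. -/
def cls {A : ApType T} (a : T.El A.pos) (ha : a ∈ A.carrier) : A.El := Quotient.mk A.setoid ⟨a, ha⟩

/-- The morphism given by a premorphism. -/
noncomputable def ofMor {A B : ApType T} (F : T.El A.pos → T.El B.pos) (h : IsMor A B F) :
    (arr A B).El := Quotient.mk _ h.exists_mem.choose

theorem app_ofMor {A B : ApType T} {F : T.El A.pos → T.El B.pos} (h : IsMor A B F)
    (a : T.El A.pos) (ha : a ∈ A.carrier) :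
    app (ofMor F h) (cls a ha) = cls (F a) (h.2.1 a ha) := by
  exact congrArg (Quotient.mk B.setoid) (Subtype.ext (h.exists_mem.choose_spec a))

theorem exists_k (A B : ApType T) : ∃ k : (arr A (arr B A)).El, ∀ a b, app (app k a) b = a := by
  obtain ⟨G, hG, h⟩ := (IsMor.fst (A := A) (B := B)).curry
  refine ⟨ofMor G hG, ?_⟩
  rintro ⟨a, ha⟩ ⟨b, hb⟩
  refine (congrArg (app · _) (app_ofMor hG a ha)).trans ?_
  change cls _ _ = cls _ _
  congr 1
  simp [h]

theorem exists_s (A B C : ApType T) :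
    ∃ s : (arr (arr A (arr B C)) (arr (arr A B) (arr A C))).El, ∀ a b c,
      app (app (app s a) b) c = app (app a c) (app b c) := by
  have hM : IsMor (prod (prod (arr A (arr B C)) (arr A B)) A) C _ :=
    (IsMor.app (IsMor.app IsMor.id.p1.p1 IsMor.id.p2) (IsMor.app IsMor.id.p1.p2 IsMor.id.p2))
  obtain ⟨G, hG, h⟩ := hM.curry
  obtain ⟨K, hK, h'⟩ := hG.curry
  refine ⟨ofMor K hK, ?_⟩
  rintro ⟨a, ha⟩ ⟨b, hb⟩ ⟨c, hc⟩
  refine (congrArg (fun x => app (app x _) _) (app_ofMor hK a ha)).trans ?_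
  change cls _ _ = cls _ _
  congr 1
  simp [h, h']

theorem exists_pair (A B : ApType T) : ∃ p : (arr A (arr B (prod A B))).El,
    ∀ (a : A.carrier) (b : B.carrier), app (app p (cls a.1 a.2)) (cls b.1 b.2) =
      cls (A := prod A B) (pr a.1 b.1)
        ⟨by rw [TCA.p1_pr]; exact a.2, by rw [TCA.p2_pr]; exact b.2⟩ := by
  obtain ⟨G, hG, h⟩ := (IsMor.id (A := prod A B)).curry
  refine ⟨ofMor G hG, ?_⟩
  rintro ⟨a, ha⟩ ⟨b, hb⟩
  refine (congrArg (app · _) (app_ofMor hG a ha)).trans ?_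
  change cls _ _ = cls _ _
  congr 1
  simp [h]

theorem exists_case (hT : T.Consistent) (A B C : ApType T) :
    ∃ c : (arr (arr A C) (arr (arr B C) (arr (sum hT A B) C))).El,
      (∀ f g x, app (app (app c f) g) (app (ofMor _ (IsMor.inl hT)) x) = app f x) ∧
      ∀ f g x, app (app (app c f) g) (app (ofMor _ (IsMor.inr hT)) x) = app g x := by
  have h1 : IsMor (prod A (prod (arr A C) (arr B C))) C _ := IsMor.app IsMor.id.p2.p1 IsMor.id.p1
  have h2 : IsMor (prod B (prod (arr A C) (arr B C))) C _ := IsMor.app IsMor.id.p2.p2 IsMor.id.p1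
  obtain ⟨G1, hG1, e1⟩ := h1.curry
  obtain ⟨G2, hG2, e2⟩ := h2.curry
  obtain ⟨K, hK, hK1, hK2⟩ := IsMor.copair hT hG1 hG2
  have hM : IsMor (prod (prod (arr A C) (arr B C)) (sum hT A B)) C _ :=
    IsMor.app (hK.comp IsMor.id.p2) IsMor.id.p1
  obtain ⟨G, hG, h⟩ := hM.curry
  obtain ⟨L, hL, h'⟩ := hG.curry
  refine ⟨ofMor L hL, ?_, ?_⟩
  · rintro ⟨f, hf⟩ ⟨g, hg⟩ ⟨x, hx⟩
    refine (congrArg₂ (fun x y => app (app x _) y) (app_ofMor hL f hf)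
      (app_ofMor (IsMor.inl hT) x hx)).trans ?_
    change cls _ _ = cls _ _
    congr 1
    simp [h, h', hK1, e1]
  · rintro ⟨f, hf⟩ ⟨g, hg⟩ ⟨x, hx⟩
    refine (congrArg₂ (fun x y => app (app x _) y) (app_ofMor hL f hf)
      (app_ofMor (IsMor.inr hT) x hx)).trans ?_
    change cls _ _ = cls _ _
    congr 1
    simp [h, h', hK2, e2]

theorem exists_rec (hT : T.Consistent) (A : ApType T) :
    ∃ r : (arr A (arr (arr (nat hT) (arr A A)) (arr (nat hT) A))).El,
      (∀ a b, app (app (app r a) b) (cls (A := nat hT) T.zero ⟨0, rfl⟩) = a) ∧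
      ∀ a b n, app (app (app r a) b) (app (ofMor _ (IsMor.succ hT)) n) =
        app (app b n) (app (app (app r a) b) n) := by
  let W := arr (prod A (arr (nat hT) (arr A A))) A
  obtain ⟨z, hz⟩ := (IsMor.fst (A := A) (B := arr (nat hT) (arr A A))).exists_mem
  have hS : IsMor (prod (prod (nat hT) W) (prod A (arr (nat hT) (arr A A)))) A _ :=
    IsMor.app (IsMor.app IsMor.id.p2.p2 IsMor.id.p1.p1) (IsMor.app IsMor.id.p1.p2 IsMor.id.p2)
  obtain ⟨F, hF, eF⟩ := hS.curry
  obtain ⟨K, hK, hK0, hK1⟩ := IsMor.natRec hT z.2 hF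
  have hM : IsMor (prod (prod A (arr (nat hT) (arr A A))) (nat hT)) A _ :=
    IsMor.app (hK.comp IsMor.id.p2) IsMor.id.p1
  obtain ⟨G, hG, h⟩ := hM.curry
  obtain ⟨L, hL, h'⟩ := hG.curry
  refine ⟨ofMor L hL, ?_, ?_⟩
  · rintro ⟨a, ha⟩ ⟨b, hb⟩
    refine (congrArg (fun x => app (app x _) _) (app_ofMor hL a ha)).trans ?_
    change cls _ _ = cls _ _
    congr 1
    simp only [h, h', TCA.p1_pr, TCA.p2_pr]
    change T.app (p1 (K (T.numeral 0))) _ = _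
    rw [hK0, hz, TCA.p1_pr]
  · rintro ⟨a, ha⟩ ⟨b, hb⟩ ⟨_, n, rfl⟩
    refine (congrArg₂ (fun x y => app (app x _) y) (app_ofMor hL a ha)
      (app_ofMor (IsMor.succ hT) (T.numeral n) ⟨n, rfl⟩)).trans ?_
    refine Eq.trans ?_ (congrArg (fun x => app _ (app (app x _) _)) (app_ofMor hL a ha)).symm
    change cls _ _ = cls _ _
    congr 1
    simp only [h, h', TCA.p1_pr, TCA.p2_pr]
    change T.app (p1 (K (T.numeral (n + 1)))) _ = _
    rw [hK1, eF]
    simp only [TCA.p1_pr, TCA.p2_pr]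

end ApType

/-- The tca of apartness types over a consistent tca. -/
noncomputable def ApTypes (T : TCA) (hT : T.Consistent) : TCA where
  Ty := ApType T
  prod := ApType.prod
  arr := ApType.arr
  sum := ApType.sum hT
  bot := ApType.one T
  top := ApType.one T
  nat := ApType.nat hT
  El := ApType.El
  app := ApType.app
  exf A := ApType.ofMor _ (ApType.IsMor.const A.carrier_nonempty.choose_spec)
  tt := ApType.cls (A := ApType.one T) T.tt rfl
  k A B := (ApType.exists_k A B).choose
  s A B C := (ApType.exists_s A B C).choose
  pair A B := (ApType.exists_pair A B).choose
  fst _ _ := ApType.ofMor _ ApType.IsMor.fst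
  snd _ _ := ApType.ofMor _ ApType.IsMor.snd
  inl _ _ := ApType.ofMor _ (ApType.IsMor.inl hT)
  inr _ _ := ApType.ofMor _ (ApType.IsMor.inr hT)
  case A B C := (ApType.exists_case hT A B C).choose
  zero := ApType.cls (A := ApType.nat hT) T.zero ⟨0, rfl⟩
  succ := ApType.ofMor _ (ApType.IsMor.succ hT)
  recN A := (ApType.exists_rec hT A).choose
  k_eq := (ApType.exists_k _ _).choose_spec
  s_eq := (ApType.exists_s _ _ _).choose_spec
  fst_eq := by
    rintro A B ⟨a⟩ ⟨b⟩
    refine (congrArg _ ((ApType.exists_pair A B).choose_spec a b)).trans ?_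
    rw [ApType.app_ofMor]
    simp only [TCA.p1_pr]; rfl
  snd_eq := by
    rintro A B ⟨a⟩ ⟨b⟩
    refine (congrArg _ ((ApType.exists_pair A B).choose_spec a b)).trans ?_
    rw [ApType.app_ofMor]
    simp only [TCA.p2_pr]; rfl
  case_inl := (ApType.exists_case hT _ _ _).choose_spec.1
  case_inr := (ApType.exists_case hT _ _ _).choose_spec.2
  rec_zero := (ApType.exists_rec hT _).choose_spec.1
  rec_succ := (ApType.exists_rec hT _).choose_spec.2

/-! ### Kleene's algebras -/

/-- A partial combinatory algebra, together with codings of pairs, sums and numbers. -/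
structure PCA where
  A : Type
  ap : A → A → Part A
  star : A
  pair : A → A → A
  inl : A → A
  inr : A → A
  num : ℕ → A
  exists_k : ∃ k, ∀ a, ∃ f ∈ ap k a, ∀ b, a ∈ ap f b
  exists_s : ∃ s, ∀ a, ∃ f ∈ ap s a, ∀ b, ∃ g ∈ ap f b, ∀ c,
    ∀ x ∈ ap a c, ∀ y ∈ ap b c, ∀ v ∈ ap x y, v ∈ ap g c
  exists_pair : ∃ p, ∀ a, ∃ f ∈ ap p a, ∀ b, pair a b ∈ ap f b
  exists_fst : ∃ p, ∀ a b, a ∈ ap p (pair a b)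
  exists_snd : ∃ p, ∀ a b, b ∈ ap p (pair a b)
  exists_inl : ∃ p, ∀ a, inl a ∈ ap p a
  exists_inr : ∃ p, ∀ a, inr a ∈ ap p a
  exists_case : ∃ e, ∀ a, ∃ f ∈ ap e a, ∀ b, ∃ g ∈ ap f b, ∀ x,
    (∀ v ∈ ap a x, v ∈ ap g (inl x)) ∧ ∀ v ∈ ap b x, v ∈ ap g (inr x)
  exists_succ : ∃ p, ∀ n, num (n + 1) ∈ ap p (num n)
  exists_rec : ∃ r, ∀ a, ∃ f ∈ ap r a, ∀ b, ∃ g ∈ ap f b, ∀ v : ℕ → A, v 0 = a →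
    (∀ n, ∃ w ∈ ap b (num n), v (n + 1) ∈ ap w (v n)) → ∀ n, v n ∈ ap g (num n)

namespace PCA

variable (P : PCA)

/-- The elements mapping `X` into `Y`. -/
def arr (X Y : Set P.A) : Set P.A := {e | ∀ a ∈ X, ∃ v ∈ P.ap e a, v ∈ Y}

variable {P}

noncomputable def app {X Y : Set P.A} (e : P.arr X Y) (a : X) : Y :=
  ⟨(e.2 a.1 a.2).choose, (e.2 a.1 a.2).choose_spec.2⟩

theorem app_mem {X Y : Set P.A} (e : P.arr X Y) (a : X) : (app e a).1 ∈ P.ap e.1 a.1 :=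
  (e.2 a.1 a.2).choose_spec.1

theorem app_eq {X Y : Set P.A} {e : P.arr X Y} {a : X} {v : P.A} (h : v ∈ P.ap e.1 a.1) :
    (app e a).1 = v := Part.mem_unique (app_mem e a) h

variable (P)

theorem k_mem (S U : Set P.A) : P.exists_k.choose ∈ P.arr S (P.arr U S) := fun a ha => by
  obtain ⟨f, hf, h⟩ := P.exists_k.choose_spec a
  exact ⟨f, hf, fun b _ => ⟨a, h b, ha⟩⟩

theorem s_mem (S U V : Set P.A) : P.exists_s.choose ∈
    P.arr (P.arr S (P.arr U V)) (P.arr (P.arr S U) (P.arr S V)) := fun a ha => by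
  obtain ⟨f, hf, h⟩ := P.exists_s.choose_spec a
  refine ⟨f, hf, fun b hb => ?_⟩
  obtain ⟨g, hg, h'⟩ := h b
  refine ⟨g, hg, fun c hc => ?_⟩
  obtain ⟨x, hx, hx'⟩ := ha c hc
  obtain ⟨y, hy, hy'⟩ := hb c hc
  obtain ⟨v, hv, hv'⟩ := hx' y hy'
  exact ⟨v, h' c x hx y hy v hv, hv'⟩

theorem pair_mem (S U : Set P.A) : P.exists_pair.choose ∈
    P.arr S (P.arr U (Set.image2 P.pair S U)) := fun a ha => by
  obtain ⟨f, hf, h⟩ := P.exists_pair.choose_spec a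
  exact ⟨f, hf, fun b hb => ⟨_, h b, a, ha, b, hb, rfl⟩⟩

theorem fst_mem (S U : Set P.A) : P.exists_fst.choose ∈ P.arr (Set.image2 P.pair S U) S := by
  rintro _ ⟨a, ha, b, hb, rfl⟩
  exact ⟨a, P.exists_fst.choose_spec a b, ha⟩

theorem snd_mem (S U : Set P.A) : P.exists_snd.choose ∈ P.arr (Set.image2 P.pair S U) U := by
  rintro _ ⟨a, ha, b, hb, rfl⟩
  exact ⟨b, P.exists_snd.choose_spec a b, hb⟩

theorem inl_mem (S U : Set P.A) : P.exists_inl.choose ∈ P.arr S (P.inl '' S ∪ P.inr '' U) :=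
  fun a ha => ⟨_, P.exists_inl.choose_spec a, Or.inl ⟨a, ha, rfl⟩⟩

theorem inr_mem (S U : Set P.A) : P.exists_inr.choose ∈ P.arr U (P.inl '' S ∪ P.inr '' U) :=
  fun a ha => ⟨_, P.exists_inr.choose_spec a, Or.inr ⟨a, ha, rfl⟩⟩

theorem case_mem (S U V : Set P.A) : P.exists_case.choose ∈
    P.arr (P.arr S V) (P.arr (P.arr U V) (P.arr (P.inl '' S ∪ P.inr '' U) V)) := fun a ha => by
  obtain ⟨f, hf, h⟩ := P.exists_case.choose_spec a
  refine ⟨f, hf, fun b hb => ?_⟩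
  obtain ⟨g, hg, h'⟩ := h b
  refine ⟨g, hg, ?_⟩
  rintro _ (⟨x, hx, rfl⟩ | ⟨x, hx, rfl⟩)
  · obtain ⟨v, hv, hv'⟩ := ha x hx
    exact ⟨v, (h' x).1 v hv, hv'⟩
  · obtain ⟨v, hv, hv'⟩ := hb x hx
    exact ⟨v, (h' x).2 v hv, hv'⟩

theorem succ_mem : P.exists_succ.choose ∈ P.arr (Set.range P.num) (Set.range P.num) := by
  rintro _ ⟨n, rfl⟩
  exact ⟨_, P.exists_succ.choose_spec n, n + 1, rfl⟩

/-- Iteration inside the algebra. -/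
theorem exists_iter {S : Set P.A} (a : S) (b : P.arr (Set.range P.num) (P.arr S S)) :
    ∃ v : ℕ → S, v 0 = a ∧ ∀ n, v (n + 1) = app (app b ⟨P.num n, n, rfl⟩) (v n) :=
  ⟨fun n => Nat.rec a (fun n w => app (app b ⟨P.num n, n, rfl⟩) w) n, rfl, fun _ => rfl⟩

theorem rec_mem (S : Set P.A) : P.exists_rec.choose ∈
    P.arr S (P.arr (P.arr (Set.range P.num) (P.arr S S)) (P.arr (Set.range P.num) S)) :=
  fun a ha => by
  obtain ⟨f, hf, h⟩ := P.exists_rec.choose_spec a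
  refine ⟨f, hf, fun b hb => ?_⟩
  obtain ⟨g, hg, h'⟩ := h b
  refine ⟨g, hg, ?_⟩
  rintro _ ⟨n, rfl⟩
  obtain ⟨v, hv0, hv⟩ := P.exists_iter ⟨a, ha⟩ ⟨b, hb⟩
  refine ⟨v n, h' (fun n => v n) (by rw [hv0]) (fun n => ⟨_, app_mem ⟨b, hb⟩ ⟨P.num n, n, rfl⟩, ?_⟩)
    n, (v n).2⟩
  rw [hv]
  exact app_mem _ _

/-- The tca of subsets of a partial combinatory algebra. -/
noncomputable def toTCA : TCA where
  Ty := Set P.A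
  prod X Y := Set.image2 P.pair X Y
  arr X Y := P.arr X Y
  sum X Y := P.inl '' X ∪ P.inr '' Y
  bot := ∅
  top := {P.star}
  nat := Set.range P.num
  El X := X
  app e a := app e a
  exf _ := ⟨P.star, fun _ h => h.elim⟩
  tt := ⟨P.star, rfl⟩
  k S U := ⟨_, P.k_mem S U⟩
  s S U V := ⟨_, P.s_mem S U V⟩
  pair S U := ⟨_, P.pair_mem S U⟩
  fst S U := ⟨_, P.fst_mem S U⟩
  snd S U := ⟨_, P.snd_mem S U⟩
  inl S U := ⟨_, P.inl_mem S U⟩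
  inr S U := ⟨_, P.inr_mem S U⟩
  case S U V := ⟨_, P.case_mem S U V⟩
  zero := ⟨P.num 0, 0, rfl⟩
  succ := ⟨_, P.succ_mem⟩
  recN S := ⟨_, P.rec_mem S⟩
  k_eq a b := by
    obtain ⟨f, hf, h⟩ := P.exists_k.choose_spec a.1
    refine Subtype.ext (app_eq ?_)
    rw [app_eq (v := f) hf]
    exact h _
  s_eq a b c := by
    obtain ⟨f, hf, h⟩ := P.exists_s.choose_spec a.1
    obtain ⟨g, hg, h'⟩ := h b.1
    refine Subtype.ext (app_eq ?_)
    rw [app_eq (v := g) (by rw [app_eq (v := f) hf]; exact hg)]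
    exact h' c.1 _ (app_mem a c) _ (app_mem b c) _ (app_mem _ _)
  fst_eq a b := by
    obtain ⟨f, hf, h⟩ := P.exists_pair.choose_spec a.1
    refine Subtype.ext (app_eq ?_)
    rw [app_eq (v := P.pair a.1 b.1) (by rw [app_eq (v := f) hf]; exact h _)]
    exact P.exists_fst.choose_spec _ _
  snd_eq a b := by
    obtain ⟨f, hf, h⟩ := P.exists_pair.choose_spec a.1
    refine Subtype.ext (app_eq ?_)
    rw [app_eq (v := P.pair a.1 b.1) (by rw [app_eq (v := f) hf]; exact h _)]
    exact P.exists_snd.choose_spec _ _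
  case_inl a b x := by
    obtain ⟨f, hf, h⟩ := P.exists_case.choose_spec a.1
    obtain ⟨g, hg, h'⟩ := h b.1
    refine Subtype.ext (app_eq ?_)
    rw [app_eq (v := g) (by rw [app_eq (v := f) hf]; exact hg),
      app_eq (v := P.inl x.1) (P.exists_inl.choose_spec _)]
    exact (h' x.1).1 _ (app_mem a x)
  case_inr a b x := by
    obtain ⟨f, hf, h⟩ := P.exists_case.choose_spec a.1
    obtain ⟨g, hg, h'⟩ := h b.1
    refine Subtype.ext (app_eq ?_)
    rw [app_eq (v := g) (by rw [app_eq (v := f) hf]; exact hg),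
      app_eq (v := P.inr x.1) (P.exists_inr.choose_spec _)]
    exact (h' x.1).2 _ (app_mem b x)
  rec_zero {S} a b := by
    obtain ⟨f, hf, h⟩ := P.exists_rec.choose_spec a.1
    obtain ⟨g, hg, h'⟩ := h b.1
    obtain ⟨v, hv0, hv⟩ := P.exists_iter (S := S) a b
    refine Subtype.ext (app_eq ?_)
    rw [app_eq (v := g) (by rw [app_eq (v := f) hf]; exact hg)]
    have := h' (fun n => v n) (by rw [hv0]) (fun n => ⟨_, app_mem b ⟨P.num n, n, rfl⟩, by
      rw [hv]; exact app_mem _ _⟩) 0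
    rwa [hv0] at this
  rec_succ {S} a b := by
    rintro ⟨_, n, rfl⟩
    obtain ⟨f, hf, h⟩ := P.exists_rec.choose_spec a.1
    obtain ⟨g, hg, h'⟩ := h b.1
    obtain ⟨v, hv0, hv⟩ := P.exists_iter (S := S) a b
    have key := h' (fun n => v n) (by rw [hv0]) (fun n => ⟨_, app_mem b ⟨P.num n, n, rfl⟩, by
      rw [hv]; exact app_mem _ _⟩)
    have e : (app (app (⟨_, P.rec_mem S⟩ : P.arr S _) a) b).1 = g :=
      app_eq (by rw [app_eq (v := f) hf]; exact hg)
    have e2 : app (app (app (⟨_, P.rec_mem S⟩ : P.arr S _) a) b) ⟨P.num n, n, rfl⟩ = v n :=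
      Subtype.ext (app_eq (by rw [e]; exact key n))
    refine Subtype.ext (app_eq ?_)
    rw [e, app_eq (v := P.num (n + 1)) (P.exists_succ.choose_spec n), e2, ← hv]
    exact key (n + 1)

theorem numeral_eq (n : ℕ) : (P.toTCA.numeral n : P.toTCA.El P.toTCA.nat).1 = P.num n := by
  induction n with
  | zero => rfl
  | succ n ih =>
    change (app _ _).1 = _
    refine app_eq ?_
    erw [ih]
    exact P.exists_succ.choose_spec n

theorem consistent (h : P.num 0 ≠ P.num 1) : P.toTCA.Consistent := fun e =>
  h ((P.numeral_eq 0).symm.trans ((congrArg Subtype.val e).trans (P.numeral_eq 1)))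

end PCA

/-! #### The first algebra -/

namespace K1

open Nat.Partrec (Code)

/-- Kleene application: the `e`-th partial recursive function at `a`. -/
def ap (e a : ℕ) : Part ℕ := (Denumerable.ofNat Code e).eval a

theorem rep3 {F : (ℕ × ℕ) × ℕ →. ℕ} (hF : Partrec F) :
    ∃ e, ∀ a, ∃ f ∈ ap e a, ∀ b, ∃ g ∈ ap f b, ∀ c, ap g c = F ((a, b), c) := by
  have h0 : Partrec (fun m : ℕ => F ((m.unpair.1.unpair.1, m.unpair.1.unpair.2), m.unpair.2)) := by
    refine hF.comp ((Computable.pair ?_ ?_).pair ?_)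
    · exact Computable.fst.comp (Computable.unpair.comp (Computable.fst.comp Computable.unpair))
    · exact Computable.snd.comp (Computable.unpair.comp (Computable.fst.comp Computable.unpair))
    · exact Computable.snd.comp Computable.unpair
  obtain ⟨c0, hc0⟩ := Code.exists_code.1 (Partrec.nat_iff.1 h0)
  have h1 : Computable (fun m : ℕ => Encodable.encode (Code.curry c0 m)) :=
    (Primrec.encode.comp (Code.primrec₂_curry.comp (Primrec.const c0) Primrec.id)).to_comp
  obtain ⟨c1, hc1⟩ := Code.exists_code.1 (Partrec.nat_iff.1 h1.partrec)
  have h2 : Computable (fun m : ℕ => Encodable.encode (Code.curry c1 m)) :=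
    (Primrec.encode.comp (Code.primrec₂_curry.comp (Primrec.const c1) Primrec.id)).to_comp
  obtain ⟨c2, hc2⟩ := Code.exists_code.1 (Partrec.nat_iff.1 h2.partrec)
  refine ⟨Encodable.encode c2, fun a => ⟨Encodable.encode (Code.curry c1 a), ?_, fun b =>
    ⟨Encodable.encode (Code.curry c0 (Nat.pair a b)), ?_, fun c => ?_⟩⟩⟩
  · simp [ap, hc2]
  · simp [ap, hc1, Code.eval_curry]
  · simp [ap, hc0, Code.eval_curry]

theorem rep2 {F : ℕ × ℕ →. ℕ} (hF : Partrec F) :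
    ∃ e, ∀ a, ∃ f ∈ ap e a, ∀ b, ap f b = F (a, b) := by
  obtain ⟨e, he⟩ := rep3 (hF.comp ((Computable.snd.comp Computable.fst).pair Computable.snd))
  obtain ⟨f, -, hf⟩ := he 0
  exact ⟨f, hf⟩

theorem rep1 {F : ℕ → ℕ} (hF : Computable F) : ∃ e, ∀ a, F a ∈ ap e a := by
  obtain ⟨e, he⟩ := rep2 (hF.comp Computable.snd).partrec
  obtain ⟨f, -, hf⟩ := he 0
  exact ⟨f, fun a => by rw [hf]; exact Part.mem_some _⟩

theorem partrec_ap : Partrec₂ ap :=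
  Code.eval_part.comp ((Computable.ofNat Code).comp Computable.fst) Computable.snd

/-- Kleene's first algebra. -/
def pca : PCA where
  A := ℕ
  ap := ap
  star := 0
  pair := Nat.pair
  inl := Nat.pair 0
  inr := Nat.pair 1
  num n := n
  exists_k := by
    obtain ⟨e, he⟩ := rep2 (Computable.fst (α := ℕ) (β := ℕ)).partrec
    refine ⟨e, fun a => (he a).imp fun f hf => ⟨hf.1, fun b => ?_⟩⟩
    rw [hf.2]; exact Part.mem_some _
  exists_s := by
    obtain ⟨e, he⟩ := rep3 (F := fun x => (ap x.1.1 x.2).bind fun u => (ap x.1.2 x.2).bind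
      fun v => ap u v) (by
      refine Partrec.bind (partrec_ap.comp (Computable.fst.comp Computable.fst) Computable.snd) ?_
      refine Partrec.bind (partrec_ap.comp (Computable.snd.comp (Computable.fst.comp
        Computable.fst)) (Computable.snd.comp Computable.fst)) ?_
      exact partrec_ap.comp (Computable.snd.comp Computable.fst) Computable.snd)
    refine ⟨e, fun a => (he a).imp fun f hf => ⟨hf.1, fun b => (hf.2 b).imp fun g hg =>
      ⟨hg.1, fun c x hx y hy v hv => ?_⟩⟩⟩
    rw [hg.2]
    exact Part.mem_bind hx (Part.mem_bind hy hv)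
  exists_pair := by
    obtain ⟨e, he⟩ := rep2 (F := fun x => Part.some (Nat.pair x.1 x.2))
      (Primrec₂.natPair.comp Primrec.fst Primrec.snd).to_comp.partrec
    refine ⟨e, fun a => (he a).imp fun f hf => ⟨hf.1, fun b => ?_⟩⟩
    rw [hf.2]; exact Part.mem_some _
  exists_fst := (rep1 (Computable.fst.comp Computable.unpair)).imp fun e he a b => by
    simpa using he (Nat.pair a b)
  exists_snd := (rep1 (Computable.snd.comp Computable.unpair)).imp fun e he a b => by
    simpa using he (Nat.pair a b)
  exists_inl := rep1 (Primrec₂.natPair.comp (Primrec.const 0) Primrec.id).to_comp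
  exists_inr := rep1 (Primrec₂.natPair.comp (Primrec.const 1) Primrec.id).to_comp
  exists_case := by
    obtain ⟨e, he⟩ := rep3 (F := fun x => ap (bif x.2.unpair.1 == 0 then x.1.1 else x.1.2)
      x.2.unpair.2) (by
      refine partrec_ap.comp (Computable.cond ?_ (Computable.fst.comp Computable.fst)
        (Computable.snd.comp Computable.fst)) (Computable.snd.comp (Computable.unpair.comp
        Computable.snd))
      exact (Primrec.beq.comp (Primrec.fst.comp (Primrec.unpair.comp Primrec.snd))
        (Primrec.const 0)).to_comp)
    refine ⟨e, fun a => (he a).imp fun f hf => ⟨hf.1, fun b => (hf.2 b).imp fun g hg =>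
      ⟨hg.1, fun x => ⟨fun v hv => ?_, fun v hv => ?_⟩⟩⟩⟩
    · rw [hg.2]; simpa using hv
    · rw [hg.2]; simpa using hv
  exists_succ := rep1 Computable.succ
  exists_rec := by
    obtain ⟨e, he⟩ := rep3 (F := fun x => Nat.rec (Part.some x.1.1) (fun n v => v.bind fun v =>
      (ap x.1.2 n).bind fun w => ap w v) x.2) (by
      refine Partrec.nat_rec (h := fun (x : (ℕ × ℕ) × ℕ) (y : ℕ × ℕ) =>
        (ap x.1.2 y.1).bind fun w => ap w y.2) Computable.snd
        (Computable.fst.comp Computable.fst).partrec ?_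
      refine Partrec.bind (partrec_ap.comp (Computable.snd.comp (Computable.fst.comp
        Computable.fst)) (Computable.fst.comp Computable.snd)) ?_
      exact partrec_ap.comp Computable.snd (Computable.snd.comp (Computable.snd.comp
        Computable.fst)))
    refine ⟨e, fun a => (he a).imp fun f hf => ⟨hf.1, fun b => (hf.2 b).imp fun g hg =>
      ⟨hg.1, fun v hv0 hv n => ?_⟩⟩⟩
    rw [hg.2]
    induction n with
    | zero => rw [hv0]; exact Part.mem_some _
    | succ n ih =>
      obtain ⟨w, hw, h⟩ := hv n
      exact Part.mem_bind ih (Part.mem_bind hw h)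

end K1

/-- Kleene's first algebra as a tca. -/
noncomputable def K1 : TCA := K1.pca.toTCA

theorem K1_consistent : K1.Consistent := K1.pca.consistent (by decide : (0 : ℕ) ≠ 1)

/-! #### The recursive submodel of the second algebra -/

namespace K2

/-- The total recursive functions. -/
abbrev Rec : Type := {f : ℕ → ℕ // Computable f}

/-- The initial segment of length `k`. -/
def seg (f : ℕ → ℕ) (k : ℕ) : List ℕ := (List.range k).map f

@[simp] theorem seg_length (f : ℕ → ℕ) (k : ℕ) : (seg f k).length = k := by simp [seg]

theorem seg_take (f : ℕ → ℕ) {j k : ℕ} (h : j ≤ k) : (seg f k).take j = seg f j := by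
  simp [seg, ← List.map_take, List.take_range, h]

theorem seg_getElem? (f : ℕ → ℕ) {j k : ℕ} (h : j < k) : (seg f k)[j]? = some (f j) := by
  simp [seg, h]

theorem seg_succ (f : ℕ → ℕ) (k : ℕ) : seg f (k + 1) = seg f k ++ [f k] := by
  simp [seg, List.range_succ]

theorem computable_seg {f : ℕ → ℕ} (hf : Computable f) : Computable (seg f) := by
  have : Computable (fun k : ℕ => (Nat.rec [] (fun n l => l ++ [f n]) k : List ℕ)) :=
    Computable.nat_rec Computable.id (Computable.const [])
      (Computable.list_append.comp (Computable.snd.comp Computable.snd)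
        (Computable.list_cons.comp (hf.comp (Computable.fst.comp Computable.snd))
          (Computable.const []))).to₂
  refine this.of_eq fun k => ?_
  induction k with
  | zero => rfl
  | succ k ih => rw [seg_succ, ← ih]

/-- The value of `f` at the code of `⟨n, g 0, …, g (k - 1)⟩`. -/
def hit (f g : ℕ → ℕ) (n k : ℕ) : ℕ := f (Encodable.encode (n :: seg g k))

theorem computable_hit {f g : ℕ → ℕ} (hf : Computable f) (hg : Computable g) :
    Computable₂ (hit f g) :=
  hf.comp (Computable.encode.comp (Computable.list_cons.comp Computable.fst
    ((computable_seg hg).comp Computable.snd)))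

/-- The result of applying `f` to `g`: the value at `n` is `hit f g n k - 1` for the least `k` for
which `hit f g n k` is positive. -/
def result (f g : ℕ → ℕ) (h : ∀ n, ∃ k, hit f g n k ≠ 0) (n : ℕ) : ℕ :=
  hit f g n (Nat.find (h n)) - 1

theorem computable_result {f g : ℕ → ℕ} (hf : Computable f) (hg : Computable g)
    (h : ∀ n, ∃ k, hit f g n k ≠ 0) : Computable (result f g h) := by
  have h0 : Computable₂ (fun n k => !(hit f g n k == 0)) :=
    (Primrec.not.comp (Primrec.beq.comp Primrec.id (Primrec.const 0))).to_comp.comp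
      (computable_hit hf hg)
  have h1 : Partrec (fun n => Nat.rfind ((fun k => !(hit f g n k == 0) : ℕ → Bool) : ℕ →. Bool)) :=
    Partrec.rfind h0.partrec₂
  have h2 : Computable (fun n => Nat.find (h n)) := by
    refine h1.of_eq_tot fun n => ?_
    rw [Nat.mem_rfind]
    refine ⟨?_, fun {m} hm => ?_⟩
    · simpa using Nat.find_spec (h n)
    · simpa using Nat.find_min (h n) hm
  exact Computable.pred.comp ((computable_hit hf hg).comp Computable.id h2)

/-- The application of the second algebra, restricted to recursive functions. -/
def ap (f g : Rec) : Part Rec :=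
  ⟨∀ n, ∃ k, hit f.1 g.1 n k ≠ 0, fun h => ⟨result f.1 g.1 h, computable_result f.2 g.2 h⟩⟩

theorem mem_ap {f g v : Rec} : v ∈ ap f g ↔
    ∀ n, ∃ k, hit f.1 g.1 n k = v.1 n + 1 ∧ ∀ i < k, hit f.1 g.1 n i = 0 := by
  constructor
  · rintro ⟨h, rfl⟩ n
    refine ⟨Nat.find (h n), ?_, fun i hi => by simpa using Nat.find_min (h n) hi⟩
    have := Nat.find_spec (h n)
    change _ = hit f.1 g.1 n (Nat.find (h n)) - 1 + 1
    omega
  · intro h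
    have h' : ∀ n, ∃ k, hit f.1 g.1 n k ≠ 0 := fun n => (h n).imp fun k hk => by omega
    refine ⟨h', Subtype.ext (funext fun n => ?_)⟩
    change hit f.1 g.1 n (Nat.find (h' n)) - 1 = v.1 n
    obtain ⟨k, hk, hk'⟩ := h n
    rw [(Nat.find_eq_iff (h' n)).2 ⟨by rw [hk]; exact Nat.succ_ne_zero _, fun i hi => by simpa using hk' i hi⟩,
      hk]
    rfl

theorem exists_mem_ap {f g : Rec} {v : ℕ → ℕ}
    (h : ∀ n, ∃ k, hit f.1 g.1 n k = v n + 1 ∧ ∀ i < k, hit f.1 g.1 n i = 0) :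
    ∃ w ∈ ap f g, w.1 = v := by
  have h' : ∀ n, ∃ k, hit f.1 g.1 n k ≠ 0 := fun n => (h n).imp fun k hk => by omega
  refine ⟨⟨result f.1 g.1 h', computable_result f.2 g.2 h'⟩, ⟨h', rfl⟩, funext fun n => ?_⟩
  obtain ⟨k, hk, hk'⟩ := h n
  change hit f.1 g.1 n (Nat.find (h' n)) - 1 = v n
  rw [(Nat.find_eq_iff (h' n)).2 ⟨by rw [hk]; exact Nat.succ_ne_zero _, fun i hi => by simpa using hk' i hi⟩,
      hk]
  rfl

/-! Representing effectively continuous operations. -/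

abbrev Arg : Type := ((List ℕ × List ℕ) × List ℕ) × ℕ

def dec (m : ℕ) : ℕ × List ℕ :=
  ((Denumerable.ofNat (List ℕ) m).headI, (Denumerable.ofNat (List ℕ) m).tail)

@[simp] theorem dec_encode (n : ℕ) (l : List ℕ) : dec (Encodable.encode (n :: l)) = (n, l) := by
  simp only [dec, Denumerable.ofNat_encode, List.headI, List.tail]

theorem primrec_dec : Primrec dec :=
  (Primrec.list_headI.comp (Primrec.ofNat _)).pair (Primrec.list_tail.comp (Primrec.ofNat _))

/-- The operation with prefix evaluator `G` is represented. -/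
theorem rep3 {G : Arg → Option ℕ} (hG : Primrec G) :
    ∃ e : Rec, ∀ a, ∃ f ∈ ap e a, ∀ b, ∃ g ∈ ap f b, ∀ c v : Rec,
      (∀ n j w, G (((seg a.1 j, seg b.1 j), seg c.1 j), n) = some w → w = v.1 n) →
      (∀ n, ∃ j, G (((seg a.1 j, seg b.1 j), seg c.1 j), n) ≠ none) → v ∈ ap g c := by
  let G' : Arg → ℕ := fun x => Option.casesOn (G x) 0 Nat.succ
  have hG' : Primrec G' := Primrec.option_casesOn hG (Primrec.const 0)
    (Primrec.succ.comp Primrec.snd)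
  let e : ℕ → ℕ := fun r =>
    if (dec (dec r).1).2.length < (dec (dec (dec r).1).1).2.length then 1
    else if (dec r).2.length < (dec (dec (dec r).1).1).2.length then 0
    else G' ((((dec r).2.take (dec (dec (dec r).1).1).2.length,
      (dec (dec r).1).2.take (dec (dec (dec r).1).1).2.length), (dec (dec (dec r).1).1).2),
      (dec (dec (dec r).1).1).1) + 2
  have he : Primrec e := by
    have d1 : Primrec fun r => dec r := primrec_dec
    have d2 : Primrec fun r => dec (dec r).1 := primrec_dec.comp (Primrec.fst.comp d1)
    have d3 : Primrec fun r => dec (dec (dec r).1).1 := primrec_dec.comp (Primrec.fst.comp d2)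
    have l1 := Primrec.snd.comp d1
    have l2 := Primrec.snd.comp d2
    have l3 := Primrec.snd.comp d3
    have j := Primrec.list_length.comp l3
    refine Primrec.ite (Primrec.nat_lt.comp (Primrec.list_length.comp l2) j) (Primrec.const 1)
      (Primrec.ite (Primrec.nat_lt.comp (Primrec.list_length.comp l1) j) (Primrec.const 0) ?_)
    exact Primrec.nat_add.comp (hG'.comp ((((Primrec.list_take.comp j l1).pair
      (Primrec.list_take.comp j l2)).pair l3).pair (Primrec.fst.comp d3))) (Primrec.const 2)
  refine ⟨⟨e, he.to_comp⟩, fun a => ?_⟩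
  obtain ⟨f, hf, ef⟩ := exists_mem_ap (f := ⟨e, he.to_comp⟩) (g := a) (v := fun q =>
    if (dec q).2.length < (dec (dec q).1).2.length then 0
    else G' (((seg a.1 (dec (dec q).1).2.length, (dec q).2.take (dec (dec q).1).2.length),
      (dec (dec q).1).2), (dec (dec q).1).1) + 1) (fun q => by
    by_cases h : (dec q).2.length < (dec (dec q).1).2.length
    · exact ⟨0, by simp [-Encodable.encode_list_cons, hit, e, h], fun i hi => by omega⟩
    · refine ⟨(dec (dec q).1).2.length, ?_, fun i hi => by simp [-Encodable.encode_list_cons, hit, e, h, hi]⟩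
      simp [-Encodable.encode_list_cons, hit, e, h, seg_take])
  refine ⟨f, hf, fun b => ?_⟩
  obtain ⟨g, hg, eg⟩ := exists_mem_ap (f := f) (g := b) (v := fun p =>
    G' (((seg a.1 (dec p).2.length, seg b.1 (dec p).2.length), (dec p).2), (dec p).1)) (fun p => by
    refine ⟨(dec p).2.length, ?_, fun i hi => by simp [-Encodable.encode_list_cons, hit, ef, hi]⟩
    simp [-Encodable.encode_list_cons, hit, ef, seg_take])
  refine ⟨g, hg, fun c v hs ht => mem_ap.2 fun n => ?_⟩
  classical
  refine ⟨Nat.find (ht n), ?_, fun i hi => ?_⟩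
  · have h := Nat.find_spec (ht n)
    obtain ⟨w, hw⟩ := Option.ne_none_iff_exists'.1 h
    simp only [hit, eg, dec_encode, seg_length, G', hw]
    rw [hs _ _ _ hw]
  · have h := Nat.find_min (ht n) hi
    simp only [not_not] at h
    simp only [hit, eg, dec_encode, seg_length, G', h]

/-- A prefix evaluator of application. -/
def apf (a b : List ℕ) (n : ℕ) : Option ℕ :=
  (((List.range (b.length + 1)).map fun k => a[Encodable.encode (n :: b.take k)]?).foldr
    (fun x r => if x = some 0 then r else x) none).bind Nat.ppred

theorem primrec_apf : Primrec fun x : (List ℕ × List ℕ) × ℕ => apf x.1.1 x.1.2 x.2 := by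
  have h1 : Primrec fun x : (List ℕ × List ℕ) × ℕ => (List.range (x.1.2.length + 1)).map
      fun k => x.1.1[Encodable.encode (x.2 :: x.1.2.take k)]? := by
    refine Primrec.list_map (Primrec.list_range.comp (Primrec.succ.comp (Primrec.list_length.comp
      (Primrec.snd.comp Primrec.fst)))) ?_
    refine Primrec.list_getElem?.comp (Primrec.fst.comp (Primrec.fst.comp Primrec.fst)) ?_
    exact Primrec.encode.comp (Primrec.list_cons.comp (Primrec.snd.comp Primrec.fst)
      (Primrec.list_take.comp Primrec.snd (Primrec.snd.comp (Primrec.fst.comp Primrec.fst))))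
  have h2 : Primrec Nat.ppred := (Primrec.nat_casesOn Primrec.id (Primrec.const none)
    (Primrec.option_some.comp Primrec.snd).to₂).of_eq fun n => by cases n <;> rfl
  refine Primrec.option_bind (Primrec.list_foldr (h := fun _ p => if p.1 = some 0 then p.2 else p.1)
    h1 (Primrec.const none) ?_) (h2.comp Primrec.snd)
  exact (Primrec.ite (Primrec.eq.comp (Primrec.fst.comp Primrec.snd) (Primrec.const (some 0)))
    (Primrec.snd.comp Primrec.snd) (Primrec.fst.comp Primrec.snd))

theorem apf_aux (φ : ℕ → Option ℕ) (m v : ℕ) :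
    (((List.range m).map φ).foldr (fun x r => if x = some 0 then r else x) none).bind Nat.ppred =
      some v ↔ ∃ k < m, φ k = some (v + 1) ∧ ∀ i < k, φ i = some 0 := by
  induction m generalizing φ with
  | zero => simp
  | succ m ih =>
    rw [List.range_succ_eq_map, List.map_cons, List.map_map, List.foldr_cons]
    by_cases h : φ 0 = some 0
    · rw [if_pos h, ih (φ ∘ Nat.succ)]
      constructor
      · rintro ⟨k, hk, h1, h2⟩
        refine ⟨k + 1, by omega, h1, fun i hi => ?_⟩
        cases i with
        | zero => exact h
        | succ i => exact h2 i (by omega)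
      · rintro ⟨k, hk, h1, h2⟩
        cases k with
        | zero => simp [h] at h1
        | succ k => exact ⟨k, by omega, h1, fun i hi => h2 (i + 1) (by omega)⟩
    · rw [if_neg h]
      constructor
      · intro h'
        refine ⟨0, by omega, ?_, fun i hi => by omega⟩
        cases hφ : φ 0 with
        | none => simp [hφ] at h'
        | some x =>
          cases x with
          | zero => exact (h hφ).elim
          | succ x => simp [hφ] at h'; rw [h']
      · rintro ⟨k, hk, h1, h2⟩
        cases k with
        | zero => simp [h1]
        | succ k => exact (h (h2 0 (by omega))).elim

theorem apf_sound {f g v : Rec} (h : v ∈ ap f g) {p q n w : ℕ}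
    (hw : apf (seg f.1 p) (seg g.1 q) n = some w) : w = v.1 n := by
  obtain ⟨k, hk, h1, h2⟩ := (apf_aux _ _ _).1 hw
  rw [seg_length] at hk
  obtain ⟨k', h1', h2'⟩ := mem_ap.1 h n
  have aux : ∀ i ≤ q, ∀ y, (seg f.1 p)[Encodable.encode (n :: (seg g.1 q).take i)]? = some y →
      hit f.1 g.1 n i = y := fun i hi y hy => by
    rw [seg_take _ hi] at hy
    obtain ⟨hlt, -⟩ := List.getElem?_eq_some_iff.1 hy
    rw [seg_length] at hlt
    rw [seg_getElem? _ hlt] at hy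
    exact Option.some.inj hy
  have e1 := aux k (by omega) _ h1
  rcases lt_trichotomy k k' with hlt | rfl | hlt
  · have := h2' k hlt
    omega
  · omega
  · have := aux k' (by omega) _ (h2 k' hlt)
    omega

theorem apf_complete {f g v : Rec} (h : v ∈ ap f g) (n : ℕ) :
    ∃ J, ∀ p ≥ J, ∀ q ≥ J, apf (seg f.1 p) (seg g.1 q) n = some (v.1 n) := by
  obtain ⟨k, h1, h2⟩ := mem_ap.1 h n
  obtain ⟨B, hB⟩ : ∃ B, ∀ i ≤ k, Encodable.encode (n :: seg g.1 i) < B := by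
    refine ⟨((Finset.range (k + 1)).sup fun i => Encodable.encode (n :: seg g.1 i)) + 1,
      fun i hi => Nat.lt_succ_of_le ?_⟩
    exact Finset.le_sup (f := fun i => Encodable.encode (n :: seg g.1 i))
      (Finset.mem_range.2 (by omega))
  refine ⟨max B k, fun p hp q hq => ?_⟩
  have hp' : B ≤ p := (le_max_left _ _).trans hp
  have hq' : k ≤ q := (le_max_right _ _).trans hq
  refine (apf_aux _ _ _).2 ⟨k, by rw [seg_length]; omega, ?_, fun i hi => ?_⟩
  · rw [seg_take _ hq', seg_getElem? _ ((hB k le_rfl).trans_le hp')]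
    exact congrArg some h1
  · rw [seg_take _ (by omega), seg_getElem? _ ((hB i hi.le).trans_le hp')]
    exact congrArg some (h2 i hi)

/-- A prefix of the result of application, computed from prefixes. -/
def apl (a b : List ℕ) : List ℕ :=
  (((List.range a.length).map (apf a b)).takeWhile Option.isSome).filterMap id

theorem primrec_apl : Primrec₂ apl := by
  refine Primrec.listFilterMap ((Primrec.list_takeWhile Primrec.option_isSome).comp
    (Primrec.list_map (Primrec.list_range.comp (Primrec.list_length.comp Primrec.fst)) ?_))
    Primrec.snd.to₂
  exact primrec_apf.comp ((Primrec.fst.comp Primrec.fst |>.pair (Primrec.snd.comp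
    Primrec.fst)).pair Primrec.snd)

/-- The lists `L j` are longer and longer prefixes of `f`. -/
def Approx (L : ℕ → List ℕ) (f : ℕ → ℕ) : Prop :=
  (∀ j, ∃ p, L j = seg f p) ∧ ∀ m, ∃ J, ∀ j ≥ J, m ≤ (L j).length

theorem approx_seg (f : ℕ → ℕ) : Approx (seg f) f :=
  ⟨fun j => ⟨j, rfl⟩, fun m => ⟨m, fun j hj => by rwa [seg_length]⟩⟩

theorem Approx.eq_seg {L : ℕ → List ℕ} {f : ℕ → ℕ} (h : Approx L f) (j : ℕ) :
    L j = seg f (L j).length := by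
  obtain ⟨p, hp⟩ := h.1 j
  rw [hp, seg_length]

theorem Approx.get_sound {L : ℕ → List ℕ} {f : ℕ → ℕ} (h : Approx L f) {n j w : ℕ}
    (hw : (L j)[n]? = some w) : w = f n := by
  obtain ⟨p, hp⟩ := h.1 j
  obtain ⟨hlt, -⟩ := List.getElem?_eq_some_iff.1 hw
  rw [hp] at hw hlt
  rw [seg_length] at hlt
  rw [seg_getElem? _ hlt] at hw
  exact (Option.some.inj hw).symm

theorem Approx.get_complete {L : ℕ → List ℕ} {f : ℕ → ℕ} (h : Approx L f) (n : ℕ) :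
    ∃ j, (L j)[n]? ≠ none := by
  obtain ⟨J, hJ⟩ := h.2 (n + 1)
  have := hJ J le_rfl
  exact ⟨J, by simpa using this⟩

theorem Approx.apf_sound {L M : ℕ → List ℕ} {f g v : Rec} (hL : Approx L f.1) (hM : Approx M g.1)
    (h : v ∈ ap f g) {j n w : ℕ} (hw : apf (L j) (M j) n = some w) : w = v.1 n := by
  rw [hL.eq_seg, hM.eq_seg] at hw
  exact K2.apf_sound h hw

theorem Approx.apf_complete {L M : ℕ → List ℕ} {f g v : Rec} (hL : Approx L f.1)
    (hM : Approx M g.1) (h : v ∈ ap f g) (n : ℕ) :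
    ∃ J, ∀ j ≥ J, apf (L j) (M j) n = some (v.1 n) := by
  obtain ⟨J, hJ⟩ := K2.apf_complete h n
  obtain ⟨J1, h1⟩ := hL.2 J
  obtain ⟨J2, h2⟩ := hM.2 J
  refine ⟨max J1 J2, fun j hj => ?_⟩
  rw [hL.eq_seg, hM.eq_seg]
  exact hJ _ (h1 j ((le_max_left _ _).trans hj)) _ (h2 j ((le_max_right _ _).trans hj))

theorem apl_aux (φ : ℕ → Option ℕ) (v : ℕ → ℕ) (hφ : ∀ n w, φ n = some w → w = v n) (m : ℕ) :
    ∃ p, (((List.range m).map φ).takeWhile Option.isSome).filterMap id = seg v p ∧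
      ∀ q ≤ m, (∀ i < q, φ i ≠ none) → q ≤ p := by
  induction m generalizing φ v with
  | zero => exact ⟨0, rfl, fun q hq _ => hq⟩
  | succ m ih =>
    rw [List.range_succ_eq_map, List.map_cons, List.map_map]
    cases h : φ 0 with
    | none =>
      refine ⟨0, by simp [seg], fun q _ hq => ?_⟩
      by_contra hne
      exact hq 0 (by omega) h
    | some w =>
      obtain ⟨p, hp, hp'⟩ := ih (φ ∘ Nat.succ) (v ∘ Nat.succ) fun n w hw => hφ _ _ hw
      refine ⟨p + 1, ?_, fun q hq hq' => ?_⟩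
      · rw [List.takeWhile_cons_of_pos rfl, List.filterMap_cons]
        change w :: _ = _
        rw [hp, hφ 0 w h]
        simp [seg, List.range_succ_eq_map]
      · cases q with
        | zero => omega
        | succ q => exact Nat.succ_le_succ (hp' q (by omega) fun i hi => hq' (i + 1) (by omega))

theorem Approx.apl {L M : ℕ → List ℕ} {f g v : Rec} (hL : Approx L f.1) (hM : Approx M g.1)
    (h : v ∈ ap f g) : Approx (fun j => apl (L j) (M j)) v.1 := by
  have key := fun j => apl_aux (apf (L j) (M j)) v.1 (fun n w hw => hL.apf_sound hM h hw)
    (L j).length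
  refine ⟨fun j => (key j).imp fun p hp => hp.1, fun m => ?_⟩
  have : ∃ J, ∀ j ≥ J, ∀ i < m, K2.apf (L j) (M j) i ≠ none := by
    induction m with
    | zero => exact ⟨0, fun j _ i hi => by omega⟩
    | succ m ih =>
      obtain ⟨J1, h1⟩ := ih
      obtain ⟨J2, h2⟩ := hL.apf_complete hM h m
      refine ⟨max J1 J2, fun j hj i hi => ?_⟩
      rcases Nat.lt_succ_iff_lt_or_eq.1 hi with hi | rfl
      · exact h1 j ((le_max_left _ _).trans hj) i hi
      · rw [h2 j ((le_max_right _ _).trans hj)]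
        simp
  obtain ⟨J1, h1⟩ := this
  obtain ⟨J2, h2⟩ := hL.2 m
  refine ⟨max J1 J2, fun j hj => ?_⟩
  obtain ⟨p, hp, hp'⟩ := key j
  change m ≤ (K2.apl (L j) (M j)).length
  unfold K2.apl
  rw [hp, seg_length]
  exact hp' m (h2 j ((le_max_right _ _).trans hj)) (h1 j ((le_max_left _ _).trans hj))

theorem rep2 {G : Arg → Option ℕ} (hG : Primrec G) : ∃ e : Rec, ∀ a, ∃ f ∈ ap e a, ∀ b v : Rec,
    (∀ l n j w, G (((l, seg a.1 j), seg b.1 j), n) = some w → w = v.1 n) →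
    (∀ n, ∃ j, ∀ l, G (((l, seg a.1 j), seg b.1 j), n) ≠ none) → v ∈ ap f b := by
  obtain ⟨e, he⟩ := rep3 hG
  obtain ⟨f, -, hf⟩ := he ⟨fun _ => 0, Computable.const 0⟩
  refine ⟨f, fun a => (hf a).imp fun g hg => ⟨hg.1, fun b v h1 h2 => hg.2 b v
    (fun n j w => h1 _ n j w) fun n => (h2 n).imp fun j hj => hj _⟩⟩

/-- Operations acting pointwise are represented. -/
theorem rep_pointwise {F : ℕ → ℕ} (hF : Primrec F) : ∃ e : Rec, ∀ a v : Rec,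
    (∀ n, v.1 n = F (a.1 n)) → v ∈ ap e a := by
  obtain ⟨e, he⟩ := rep2 (G := fun x => (x.1.2[x.2]?).map F) (Primrec.option_map
    (Primrec.list_getElem?.comp (Primrec.snd.comp Primrec.fst) Primrec.snd) (hF.comp Primrec.snd))
  obtain ⟨f, -, hf⟩ := he ⟨fun _ => 0, Computable.const 0⟩
  refine ⟨f, fun a v hv => hf a v (fun l n j w hw => ?_) fun n => ⟨n + 1, fun l => ?_⟩⟩
  · obtain ⟨y, hy, rfl⟩ := Option.map_eq_some_iff.1 hw
    rw [hv, (approx_seg a.1).get_sound hy]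
  · simp

theorem seg_map (f F : ℕ → ℕ) (k : ℕ) : (seg f k).map F = seg (F ∘ f) k := by simp [seg]

theorem exists_k : ∃ k : Rec, ∀ a, ∃ f ∈ ap k a, ∀ b, a ∈ ap f b := by
  obtain ⟨e, he⟩ := rep2 (G := fun x : Arg => x.1.1.2[x.2]?) (Primrec.list_getElem?.comp
    (Primrec.snd.comp (Primrec.fst.comp Primrec.fst)) Primrec.snd)
  refine ⟨e, fun a => (he a).imp fun f hf => ⟨hf.1, fun b => hf.2 b a (fun l n j w hw =>
    (approx_seg a.1).get_sound hw) fun n => ⟨n + 1, fun l => ?_⟩⟩⟩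
  simp

theorem exists_s : ∃ s : Rec, ∀ a, ∃ f ∈ ap s a, ∀ b, ∃ g ∈ ap f b, ∀ c,
    ∀ x ∈ ap a c, ∀ y ∈ ap b c, ∀ v ∈ ap x y, v ∈ ap g c := by
  have h1 : Primrec fun x : Arg => x.1.1.1 := Primrec.fst.comp (Primrec.fst.comp Primrec.fst)
  have h2 : Primrec fun x : Arg => x.1.1.2 := Primrec.snd.comp (Primrec.fst.comp Primrec.fst)
  have h3 : Primrec fun x : Arg => x.1.2 := Primrec.snd.comp Primrec.fst
  obtain ⟨e, he⟩ := rep3 (G := fun x : Arg => apf (apl x.1.1.1 x.1.2) (apl x.1.1.2 x.1.2) x.2)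
    (primrec_apf.comp (((primrec_apl.comp h1 h3).pair (primrec_apl.comp h2 h3)).pair Primrec.snd))
  refine ⟨e, fun a => (he a).imp fun f hf => ⟨hf.1, fun b => (hf.2 b).imp fun g hg =>
    ⟨hg.1, fun c x hx y hy v hv => ?_⟩⟩⟩
  have hL := (approx_seg a.1).apl (approx_seg c.1) hx
  have hM := (approx_seg b.1).apl (approx_seg c.1) hy
  refine hg.2 c v (fun n j w hw => hL.apf_sound hM hv hw) fun n => ?_
  obtain ⟨J, hJ⟩ := hL.apf_complete hM hv n
  refine ⟨J, ?_⟩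
  have := hJ J le_rfl
  simp only at this ⊢
  rw [this]
  simp

/-- Pointwise pairing. -/
def pair (a b : Rec) : Rec :=
  ⟨fun n => Nat.pair (a.1 n) (b.1 n), Primrec₂.natPair.to_comp.comp a.2 b.2⟩

/-- Pointwise tagging. -/
def tag (i : ℕ) (a : Rec) : Rec :=
  ⟨fun n => Nat.pair i (a.1 n), Primrec₂.natPair.to_comp.comp (Computable.const i) a.2⟩

theorem exists_pair : ∃ p : Rec, ∀ a, ∃ f ∈ ap p a, ∀ b, pair a b ∈ ap f b := by
  have h1 : Primrec fun x : Arg => x.1.1.2[x.2]? := Primrec.list_getElem?.comp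
    (Primrec.snd.comp (Primrec.fst.comp Primrec.fst)) Primrec.snd
  have h2 : Primrec fun x : Arg => x.1.2[x.2]? := Primrec.list_getElem?.comp
    (Primrec.snd.comp Primrec.fst) Primrec.snd
  have h3 : Primrec₂ fun (x : Arg) (u : ℕ) => (x.1.2[x.2]?).map fun v => Nat.pair u v :=
    Primrec.option_map (h2.comp Primrec.fst)
      (Primrec₂.natPair.comp (Primrec.snd.comp Primrec.fst) Primrec.snd)
  obtain ⟨e, he⟩ := rep2 (G := fun x : Arg => (x.1.1.2[x.2]?).bind fun u : ℕ => (x.1.2[x.2]?).map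
    fun v => Nat.pair u v) (Primrec.option_bind h1 h3)
  refine ⟨e, fun a => (he a).imp fun f hf => ⟨hf.1, fun b => hf.2 b _ (fun l n j w hw => ?_)
    fun n => ⟨n + 1, fun l => ?_⟩⟩⟩
  · obtain ⟨u, hu, hw⟩ := Option.bind_eq_some_iff.1 hw
    obtain ⟨y, hy, rfl⟩ := Option.map_eq_some_iff.1 hw
    rw [(approx_seg a.1).get_sound hu, (approx_seg b.1).get_sound hy]
    rfl
  · simp

theorem seg_tag (i : ℕ) (x : Rec) (j : ℕ) :
    ((seg (tag i x).1 j).map fun y => y.unpair.2) = seg x.1 j := by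
  rw [seg_map]; congr 1; funext n; simp [tag]

/-- The prefix evaluator of case distinction. -/
def caseG (x : Arg) : Option ℕ := (x.1.2[0]?).bind fun u =>
  apf (if u.unpair.1 = 0 then x.1.1.1 else x.1.1.2) (x.1.2.map fun y => y.unpair.2) x.2

theorem primrec_caseG : Primrec caseG := by
  have h1 : Primrec fun x : Arg => x.1.1.1 := Primrec.fst.comp (Primrec.fst.comp Primrec.fst)
  have h2 : Primrec fun x : Arg => x.1.1.2 := Primrec.snd.comp (Primrec.fst.comp Primrec.fst)
  have h3 : Primrec fun x : Arg => x.1.2 := Primrec.snd.comp Primrec.fst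
  have h4 : Primrec fun x : Arg => x.1.2.map fun y : ℕ => y.unpair.2 :=
    Primrec.list_map h3 (Primrec.snd.comp (Primrec.unpair.comp Primrec.snd)).to₂
  have h5 : Primrec fun p : Arg × ℕ => if p.2.unpair.1 = 0 then p.1.1.1.1 else p.1.1.1.2 :=
    Primrec.ite (Primrec.eq.comp (Primrec.fst.comp (Primrec.unpair.comp Primrec.snd))
      (Primrec.const 0)) (h1.comp Primrec.fst) (h2.comp Primrec.fst)
  have h6 : Primrec₂ fun (x : Arg) (u : ℕ) =>
      apf (if u.unpair.1 = 0 then x.1.1.1 else x.1.1.2) (x.1.2.map fun y => y.unpair.2) x.2 :=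
    primrec_apf.comp ((h5.pair (h4.comp Primrec.fst)).pair (Primrec.snd.comp Primrec.fst))
  exact Primrec.option_bind (Primrec.list_getElem?.comp h3 (Primrec.const 0)) h6

theorem caseG_tag (l : List ℕ × List ℕ) (i : ℕ) (x : Rec) (j n : ℕ) :
    caseG ((l, seg (tag i x).1 (j + 1)), n) =
      apf (if i = 0 then l.1 else l.2) (seg x.1 (j + 1)) n := by
  simp only [caseG, seg_getElem? _ (Nat.succ_pos j), Option.bind_some, seg_tag]
  simp [tag]

theorem exists_case : ∃ e : Rec, ∀ a, ∃ f ∈ ap e a, ∀ b, ∃ g ∈ ap f b, ∀ x,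
    (∀ v ∈ ap a x, v ∈ ap g (tag 0 x)) ∧ ∀ v ∈ ap b x, v ∈ ap g (tag 1 x) := by
  obtain ⟨e, he⟩ := rep3 primrec_caseG
  refine ⟨e, fun a => (he a).imp fun f hf => ⟨hf.1, fun b => (hf.2 b).imp fun g hg =>
    ⟨hg.1, fun x => ⟨fun v hv => hg.2 _ v ?_ ?_, fun v hv => hg.2 _ v ?_ ?_⟩⟩⟩⟩
  · intro n j w hw
    cases j with
    | zero => simp [caseG, seg] at hw
    | succ j =>
      rw [caseG_tag] at hw
      exact apf_sound hv hw
  · intro n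
    obtain ⟨J, hJ⟩ := apf_complete hv n
    refine ⟨J + 1, ?_⟩
    rw [caseG_tag, if_pos rfl, hJ _ (Nat.le_succ J) _ (Nat.le_succ J)]
    simp
  · intro n j w hw
    cases j with
    | zero => simp [caseG, seg] at hw
    | succ j =>
      rw [caseG_tag] at hw
      exact apf_sound hv hw
  · intro n
    obtain ⟨J, hJ⟩ := apf_complete hv n
    refine ⟨J + 1, ?_⟩
    rw [caseG_tag, if_neg one_ne_zero, hJ _ (Nat.le_succ J) _ (Nat.le_succ J)]
    simp

/-- Iteration on prefixes. -/
def iter (a b : List ℕ) (N : ℕ) : List ℕ :=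
  Nat.rec a (fun i L => apl (apl b (b.map fun _ => i)) L) N

theorem primrec_iter : Primrec fun x : (List ℕ × List ℕ) × ℕ => iter x.1.1 x.1.2 x.2 := by
  have hb : Primrec fun p : ((List ℕ × List ℕ) × ℕ) × ℕ × List ℕ => p.1.1.2 :=
    Primrec.snd.comp (Primrec.fst.comp Primrec.fst)
  have hm : Primrec fun p : ((List ℕ × List ℕ) × ℕ) × ℕ × List ℕ => p.1.1.2.map fun _ => p.2.1 :=
    Primrec.list_map hb ((Primrec.fst.comp Primrec.snd).comp Primrec.fst).to₂
  have h : Primrec₂ fun (x : (List ℕ × List ℕ) × ℕ) (y : ℕ × List ℕ) =>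
      apl (apl x.1.2 (x.1.2.map fun _ => y.1)) y.2 :=
    primrec_apl.comp (primrec_apl.comp hb hm) (Primrec.snd.comp Primrec.snd)
  exact Primrec.nat_rec' Primrec.snd (Primrec.fst.comp Primrec.fst) h

/-- The prefix evaluator of primitive recursion. -/
def recG (x : Arg) : Option ℕ := (x.1.2[0]?).bind fun N => (iter x.1.1.1 x.1.1.2 N)[x.2]?

theorem primrec_recG : Primrec recG := by
  have h1 : Primrec fun x : Arg => x.1.1 := Primrec.fst.comp Primrec.fst
  have h3 : Primrec fun x : Arg => x.1.2 := Primrec.snd.comp Primrec.fst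
  have h6 : Primrec₂ fun (x : Arg) (N : ℕ) => (iter x.1.1.1 x.1.1.2 N)[x.2]? :=
    Primrec.list_getElem?.comp (primrec_iter.comp ((h1.comp Primrec.fst).pair Primrec.snd))
      (Primrec.snd.comp Primrec.fst)
  exact Primrec.option_bind (Primrec.list_getElem?.comp h3 (Primrec.const 0)) h6

/-- The constant function. -/
def num (n : ℕ) : Rec := ⟨fun _ => n, Computable.const n⟩

theorem recG_num (l : List ℕ × List ℕ) (N j n : ℕ) :
    recG ((l, seg (num N).1 (j + 1)), n) = (iter l.1 l.2 N)[n]? := by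
  simp only [recG, seg_getElem? _ (Nat.succ_pos j), Option.bind_some, num]

theorem exists_rec : ∃ r : Rec, ∀ a, ∃ f ∈ ap r a, ∀ b, ∃ g ∈ ap f b, ∀ v : ℕ → Rec, v 0 = a →
    (∀ n, ∃ w ∈ ap b (num n), v (n + 1) ∈ ap w (v n)) → ∀ n, v n ∈ ap g (num n) := by
  obtain ⟨e, he⟩ := rep3 primrec_recG
  refine ⟨e, fun a => (he a).imp fun f hf => ⟨hf.1, fun b => (hf.2 b).imp fun g hg =>
    ⟨hg.1, fun v hv0 hv N => ?_⟩⟩⟩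
  have key : Approx (fun j => iter (seg a.1 j) (seg b.1 j) N) (v N).1 := by
    induction N with
    | zero => rw [hv0]; exact approx_seg a.1
    | succ N ih =>
      obtain ⟨w, hw, hv'⟩ := hv N
      have h1 : Approx (fun j => (seg b.1 j).map fun _ => N) (num N).1 := by
        simp only [seg_map]
        exact approx_seg fun _ => N
      exact ((approx_seg b.1).apl h1 hw).apl ih hv'
  refine hg.2 _ _ (fun n j w hw => ?_) fun n => ?_
  · cases j with
    | zero => simp [recG, seg] at hw
    | succ j =>
      rw [recG_num] at hw
      exact key.get_sound hw
  · obtain ⟨J, hJ⟩ := key.2 (n + 1)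
    refine ⟨J + 1, ?_⟩
    have h := hJ (J + 1) (Nat.le_succ J)
    rw [recG_num]
    intro hn
    have := List.getElem?_eq_none_iff.1 hn
    simp only at h this
    omega

/-- The recursive submodel of the second algebra, as a partial combinatory algebra. -/
def pca : PCA where
  A := Rec
  ap := ap
  star := num 0
  pair := pair
  inl := tag 0
  inr := tag 1
  num := num
  exists_k := exists_k
  exists_s := exists_s
  exists_pair := exists_pair
  exists_fst := (rep_pointwise (Primrec.fst.comp Primrec.unpair)).imp fun e he a b =>
    he _ _ fun n => by simp [pair]
  exists_snd := (rep_pointwise (Primrec.snd.comp Primrec.unpair)).imp fun e he a b =>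
    he _ _ fun n => by simp [pair]
  exists_inl := (rep_pointwise (Primrec₂.natPair.comp (Primrec.const 0) Primrec.id)).imp
    fun e he a => he _ _ fun n => rfl
  exists_inr := (rep_pointwise (Primrec₂.natPair.comp (Primrec.const 1) Primrec.id)).imp
    fun e he a => he _ _ fun n => rfl
  exists_case := exists_case
  exists_succ := (rep_pointwise Primrec.succ).imp fun e he n => he _ _ fun _ => rfl
  exists_rec := exists_rec

end K2

/-- The recursive submodel of Kleene's second algebra as a tca. -/
noncomputable def K2rec : TCA := K2.pca.toTCA

theorem K2rec_consistent : K2rec.Consistent := K2.pca.consistent fun h =>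
  zero_ne_one (congrFun (congrArg Subtype.val h) 0)

/-! ### Assemblies -/

/-- An assembly over a tca. -/
structure Assembly (T : TCA) where
  carrier : Type
  ty : T.Ty
  real : carrier → Set (T.El ty)
  nonempty : ∀ x, (real x).Nonempty

namespace Assembly

variable {T : TCA}

/-- `e` tracks `f`. -/
def Tracks {X Y : Assembly T} (e : T.El (T.arr X.ty Y.ty)) (f : X.carrier → Y.carrier) : Prop :=
  ∀ x, ∀ a ∈ X.real x, T.app e a ∈ Y.real (f x)

/-- Morphisms of assemblies: the tracked functions. -/
def Hom (X Y : Assembly T) : Type :=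
  {f : X.carrier → Y.carrier // ∃ e : T.El (T.arr X.ty Y.ty), Tracks e f}

instance (X Y : Assembly T) : CoeFun (Hom X Y) fun _ => X.carrier → Y.carrier := ⟨Subtype.val⟩

/-- A function is a morphism when a represented function maps realizers to realizers. -/
def Hom.ofRepr {X Y : Assembly T} (f : X.carrier → Y.carrier)
    (h : ∃ F : T.El X.ty → T.El Y.ty, Repr F ∧ ∀ x, ∀ a ∈ X.real x, F a ∈ Y.real (f x)) :
    Hom X Y :=
  ⟨f, by
    obtain ⟨F, ⟨e, he⟩, hF⟩ := h
    exact ⟨e, fun x a ha => by rw [he]; exact hF x a ha⟩⟩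

theorem Hom.exists_repr {X Y : Assembly T} (f : Hom X Y) :
    ∃ F : T.El X.ty → T.El Y.ty, Repr F ∧ ∀ x, ∀ a ∈ X.real x, F a ∈ Y.real (f x) := by
  obtain ⟨e, he⟩ := f.2
  exact ⟨fun a => T.app e a, Repr.elt e, he⟩

def Hom.comp {X Y Z : Assembly T} (g : Hom Y Z) (f : Hom X Y) : Hom X Z :=
  .ofRepr (fun x => g (f x)) (by
    obtain ⟨F, hF, hF'⟩ := f.exists_repr
    obtain ⟨G, hG, hG'⟩ := g.exists_repr
    exact ⟨_, hG.comp hF, fun x a ha => hG' _ _ (hF' x a ha)⟩)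

/-- The terminal assembly. -/
@[reducible] def one (T : TCA) : Assembly T where
  carrier := Unit
  ty := T.top
  real _ := {T.tt}
  nonempty _ := ⟨_, rfl⟩

/-- The binary product. -/
@[reducible] def prod (X Y : Assembly T) : Assembly T where
  carrier := X.carrier × Y.carrier
  ty := T.prod X.ty Y.ty
  real x := {k | p1 k ∈ X.real x.1 ∧ p2 k ∈ Y.real x.2}
  nonempty x := by
    obtain ⟨a, ha⟩ := X.nonempty x.1
    obtain ⟨b, hb⟩ := Y.nonempty x.2
    exact ⟨pr a b, by simpa using ha, by simpa using hb⟩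

/-- The exponential: the morphisms, realized by their trackers. -/
@[reducible] def exp (X Y : Assembly T) : Assembly T where
  carrier := Hom X Y
  ty := T.arr X.ty Y.ty
  real f := {e | Tracks e f.1}
  nonempty f := f.2

/-- The natural numbers object. -/
@[reducible] def nno (T : TCA) : Assembly T where
  carrier := ℕ
  ty := T.nat
  real n := {T.numeral n}
  nonempty _ := ⟨_, rfl⟩

variable {X Y Z W : Assembly T}

def toOne (X : Assembly T) : Hom X (one T) :=
  .ofRepr (fun _ => ()) ⟨_, Repr.const T.tt, fun _ _ _ => rfl⟩

def fst (X Y : Assembly T) : Hom (prod X Y) X :=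
  .ofRepr Prod.fst ⟨_, Repr.id.p1, fun _ _ h => h.1⟩

def snd (X Y : Assembly T) : Hom (prod X Y) Y :=
  .ofRepr Prod.snd ⟨_, Repr.id.p2, fun _ _ h => h.2⟩

def lift (f : Hom Z X) (g : Hom Z Y) : Hom Z (prod X Y) :=
  .ofRepr (fun z => (f z, g z)) (by
    obtain ⟨F, hF, hF'⟩ := f.exists_repr
    obtain ⟨G, hG, hG'⟩ := g.exists_repr
    exact ⟨_, hF.pr hG, fun z a ha => ⟨by simpa using hF' z a ha, by simpa using hG' z a ha⟩⟩)

def eval (f : Hom Z (exp X Y)) (g : Hom Z X) : Hom Z Y :=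
  .ofRepr (fun z => (f z).1 (g z)) (by
    obtain ⟨F, hF, hF'⟩ := f.exists_repr
    obtain ⟨G, hG, hG'⟩ := g.exists_repr
    exact ⟨_, Repr.app hF hG, fun z a ha => hF' z a ha _ _ (hG' z a ha)⟩)

def curry (f : Hom (prod Z X) Y) : Hom Z (exp X Y) :=
  .ofRepr (fun z => .ofRepr (fun x => f (z, x)) (by
    obtain ⟨F, hF, hF'⟩ := f.exists_repr
    obtain ⟨c, hc⟩ := Z.nonempty z
    exact ⟨_, hF.comp ((Repr.const c).pr Repr.id), fun x a ha =>
      hF' (z, x) _ ⟨by simpa using hc, by simpa using ha⟩⟩)) (by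
    obtain ⟨F, hF, hF'⟩ := f.exists_repr
    obtain ⟨G, hG, hG'⟩ := hF.curry
    refine ⟨G, hG, fun z c hc x a ha => ?_⟩
    rw [hG']
    exact hF' (z, x) _ ⟨by simpa using hc, by simpa using ha⟩)

def zero (X : Assembly T) : Hom X (nno T) :=
  .ofRepr (fun _ => (0 : ℕ)) ⟨_, Repr.const T.zero, fun _ _ _ => rfl⟩

def succ (T : TCA) : Hom (nno T) (nno T) :=
  .ofRepr Nat.succ ⟨_, Repr.elt T.succ, fun n a ha => by
    rw [show a = T.numeral n from ha]
    exact rfl⟩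

/-- Primitive recursion. -/
def recFun (x : X.carrier) (f : Hom (nno T) (exp X X)) : ℕ → X.carrier
  | 0 => x
  | n + 1 => (f.1 n).1 (recFun x f n)

theorem recFun_real {x : X.carrier} {f : Hom (nno T) (exp X X)} {a : T.El X.ty}
    {b : T.El (exp (nno T) (exp X X)).ty} (ha : a ∈ X.real x) (hb : Tracks b f.1) (n : ℕ) :
    T.app (T.app (T.app (T.recN X.ty) a) b) (T.numeral n) ∈ X.real (recFun x f n) := by
  induction n with
  | zero =>
    rw [show T.numeral 0 = T.zero from rfl, T.rec_zero]
    exact ha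
  | succ n ih =>
    rw [show T.numeral (n + 1) = T.app T.succ (T.numeral n) from rfl, T.rec_succ]
    exact hb n _ rfl _ _ ih

def natRec (X : Assembly T) : Hom (prod (prod X (exp (nno T) (exp X X))) (nno T)) X :=
  .ofRepr (fun p => recFun p.1.1 p.1.2 p.2) (by
    refine ⟨_, ((Repr.capp (T.recN X.ty) Repr.id.p1.p1).app Repr.id.p1.p2).app Repr.id.p2, ?_⟩
    rintro ⟨⟨x, f⟩, n⟩ a ⟨⟨ha1, ha2⟩, ha3⟩
    have h : p2 a = T.numeral n := ha3
    simp only [h]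
    exact recFun_real ha1 ha2 n)

/-- Modest assemblies. -/
def Modest (X : Assembly T) : Prop := ∀ x y, ∀ a ∈ X.real x, a ∈ X.real y → x = y

/-- Strongly modest assemblies. -/
def StronglyModest (X : Assembly T) : Prop :=
  X.Modest ∧ ∀ x, ∀ a ∈ X.real x, ∀ b ∈ X.real x, a = b

/-- Exhaustive assemblies. -/
def Exhaustive (X : Assembly T) : Prop := ∀ a, ∃ x, a ∈ X.real x

/-- Basic assemblies. -/
def Basic (X : Assembly T) : Prop := X.Exhaustive ∧ X.StronglyModest

end Assembly

/-! ### Predicates -/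

open Assembly (Hom)

/-- A predicate on an assembly. -/
structure Pred {T : TCA} (X : Assembly T) where
  ty : T.Ty
  real : X.carrier → Set (T.El ty)
  proj : ∃ f : T.El (T.arr ty X.ty), ∀ x, ∀ b ∈ real x, T.app f b ∈ X.real x

namespace Pred

variable {T : TCA} {X Y : Assembly T}

/-- The preorder of predicates. -/
def le (p q : Pred X) : Prop :=
  ∃ f : T.El (T.arr p.ty q.ty), ∀ x, ∀ b ∈ p.real x, T.app f b ∈ q.real x

theorem proj_of_repr {ty : T.Ty} {real : X.carrier → Set (T.El ty)} {F : T.El ty → T.El X.ty}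
    (hF : Repr F) (h : ∀ x, ∀ b ∈ real x, F b ∈ X.real x) :
    ∃ f : T.El (T.arr ty X.ty), ∀ x, ∀ b ∈ real x, T.app f b ∈ X.real x := by
  obtain ⟨e, he⟩ := hF
  exact ⟨e, fun x b hb => by rw [he]; exact h x b hb⟩

theorem exists_proj (p : Pred X) : ∃ F : T.El p.ty → T.El X.ty, Repr F ∧
    ∀ x, ∀ b ∈ p.real x, F b ∈ X.real x := by
  obtain ⟨e, he⟩ := p.proj
  exact ⟨fun a => T.app e a, Repr.elt e, he⟩

def top (X : Assembly T) : Pred X where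
  ty := X.ty
  real := X.real
  proj := proj_of_repr Repr.id fun _ _ h => h

/-- A predicate is valid when it is a top element. -/
def Valid (p : Pred X) : Prop := (top X).le p

def bot (X : Assembly T) : Pred X where
  ty := T.bot
  real _ := ∅
  proj := ⟨T.exf _, fun _ _ h => h.elim⟩

def and (p q : Pred X) : Pred X where
  ty := T.prod p.ty q.ty
  real x := Set.image2 pr (p.real x) (q.real x)
  proj := by
    obtain ⟨F, hF, h⟩ := p.exists_proj
    refine proj_of_repr (hF.comp Repr.id.p1) ?_
    rintro x _ ⟨a, ha, b, -, rfl⟩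
    simpa using h x a ha

def or (p q : Pred X) : Pred X where
  ty := T.sum p.ty q.ty
  real x := il q.ty '' p.real x ∪ ir p.ty '' q.real x
  proj := by
    obtain ⟨F, hF, h⟩ := p.exists_proj
    obtain ⟨G, hG, h'⟩ := q.exists_proj
    obtain ⟨H, hH, e1, e2⟩ := Repr.case (S := T.sum p.ty q.ty) Repr.id (hF.comp Repr.id.p2)
      (hG.comp Repr.id.p2)
    refine proj_of_repr hH ?_
    rintro x _ (⟨a, ha, rfl⟩ | ⟨a, ha, rfl⟩)
    · rw [e1 _ a rfl, TCA.p2_pr]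
      exact h x a ha
    · rw [e2 _ a rfl, TCA.p2_pr]
      exact h' x a ha

def imp (p q : Pred X) : Pred X where
  ty := T.prod X.ty (T.arr p.ty q.ty)
  real x := {k | p1 k ∈ X.real x ∧ ∀ n ∈ p.real x, T.app (p2 k) n ∈ q.real x}
  proj := proj_of_repr Repr.id.p1 fun _ _ h => h.1

def neg (p : Pred X) : Pred X := p.imp (bot X)

/-- Reindexing along a morphism. -/
def pull (f : Hom Y X) (p : Pred X) : Pred Y where
  ty := T.prod p.ty Y.ty
  real y := Set.image2 pr (p.real (f y)) (Y.real y)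
  proj := by
    refine proj_of_repr Repr.id.p2 ?_
    rintro y _ ⟨a, -, b, hb, rfl⟩
    simpa using hb

/-- The left adjoint of reindexing. -/
def existsAlong (f : Hom Y X) (p : Pred Y) : Pred X where
  ty := p.ty
  real x := {k | ∃ y, f y = x ∧ k ∈ p.real y}
  proj := by
    obtain ⟨F, hF, h⟩ := p.exists_proj
    obtain ⟨G, hG, h'⟩ := f.exists_repr
    refine proj_of_repr (hG.comp hF) ?_
    rintro _ k ⟨y, rfl, hk⟩
    exact h' _ _ (h y k hk)

/-- The right adjoint of reindexing. -/
def forallAlong (f : Hom Y X) (p : Pred Y) : Pred X where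
  ty := T.prod X.ty (T.arr Y.ty p.ty)
  real x := {k | p1 k ∈ X.real x ∧ ∀ y, f y = x → ∀ n ∈ Y.real y, T.app (p2 k) n ∈ p.real y}
  proj := proj_of_repr Repr.id.p1 fun _ _ h => h.1

/-- The equalizer of two morphisms. -/
def eq (f g : Hom X Y) : Pred X where
  ty := X.ty
  real x := {a | a ∈ X.real x ∧ f x = g x}
  proj := proj_of_repr Repr.id fun _ _ h => h.1

end Pred

/-! ### Extensional Heyting arithmetic in all finite types -/

/-- Finite types. -/
inductive FTy : Type
  | unit : FTy
  | nat : FTy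
  | prod : FTy → FTy → FTy
  | arr : FTy → FTy → FTy

/-- The pure types `0 = N` and `n + 1 = (n → N)`. -/
def FTy.pure : ℕ → FTy
  | 0 => FTy.nat
  | n + 1 => FTy.arr (FTy.pure n) FTy.nat

/-- Contexts. -/
abbrev Ctx : Type := List FTy

/-- Typed de Bruijn variables. -/
inductive Var : Ctx → FTy → Type
  | vz {Γ : Ctx} {σ : FTy} : Var (σ :: Γ) σ
  | vs {Γ : Ctx} {σ τ : FTy} : Var Γ σ → Var (τ :: Γ) σ

/-- Terms. -/
inductive Tm (Γ : Ctx) : FTy → Type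
  | var {σ : FTy} : Var Γ σ → Tm Γ σ
  | app {σ τ : FTy} : Tm Γ (FTy.arr σ τ) → Tm Γ σ → Tm Γ τ
  | k (σ τ : FTy) : Tm Γ (FTy.arr σ (FTy.arr τ σ))
  | s (σ τ ρ : FTy) : Tm Γ (FTy.arr (FTy.arr σ (FTy.arr τ ρ))
      (FTy.arr (FTy.arr σ τ) (FTy.arr σ ρ)))
  | tt : Tm Γ FTy.unit
  | pair (σ τ : FTy) : Tm Γ (FTy.arr σ (FTy.arr τ (FTy.prod σ τ)))
  | fst (σ τ : FTy) : Tm Γ (FTy.arr (FTy.prod σ τ) σ)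
  | snd (σ τ : FTy) : Tm Γ (FTy.arr (FTy.prod σ τ) τ)
  | zero : Tm Γ FTy.nat
  | succ : Tm Γ (FTy.arr FTy.nat FTy.nat)
  | recN (σ : FTy) : Tm Γ (FTy.arr σ (FTy.arr (FTy.arr FTy.nat (FTy.arr σ σ))
      (FTy.arr FTy.nat σ)))

/-- Formulas. -/
inductive Fm : Ctx → Type
  | eq {Γ : Ctx} {σ : FTy} : Tm Γ σ → Tm Γ σ → Fm Γ
  | bot {Γ : Ctx} : Fm Γ
  | and {Γ : Ctx} : Fm Γ → Fm Γ → Fm Γ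
  | or {Γ : Ctx} : Fm Γ → Fm Γ → Fm Γ
  | imp {Γ : Ctx} : Fm Γ → Fm Γ → Fm Γ
  | all {Γ : Ctx} (σ : FTy) : Fm (σ :: Γ) → Fm Γ
  | ex {Γ : Ctx} (σ : FTy) : Fm (σ :: Γ) → Fm Γ

/-- Substitutions. -/
abbrev Subst (Γ Δ : Ctx) : Type := ∀ σ, Var Γ σ → Tm Δ σ

def Tm.subst {Γ Δ : Ctx} (s : Subst Γ Δ) : ∀ {σ : FTy}, Tm Γ σ → Tm Δ σ
  | _, .var v => s _ v
  | _, .app t u => .app (t.subst s) (u.subst s)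
  | _, .k σ τ => .k σ τ
  | _, .s σ τ ρ => .s σ τ ρ
  | _, .tt => .tt
  | _, .pair σ τ => .pair σ τ
  | _, .fst σ τ => .fst σ τ
  | _, .snd σ τ => .snd σ τ
  | _, .zero => .zero
  | _, .succ => .succ
  | _, .recN σ => .recN σ

namespace Subst

variable {Γ Δ : Ctx}

/-- Weakening by one variable. -/
def wk (Γ : Ctx) (τ : FTy) : Subst Γ (τ :: Γ) := fun _ v => .var (.vs v)

/-- Extension of a substitution by a term for the last variable. -/
def cons (s : Subst Γ Δ) {τ : FTy} (t : Tm Δ τ) : Subst (τ :: Γ) Δ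
  | _, .vz => t
  | _, .vs v => s _ v

/-- A substitution under a binder. -/
def lift (s : Subst Γ Δ) (τ : FTy) : Subst (τ :: Γ) (τ :: Δ) :=
  cons (fun σ v => (s σ v).subst (wk Δ τ)) (.var .vz)

end Subst

def Fm.subst : ∀ {Γ Δ : Ctx}, Subst Γ Δ → Fm Γ → Fm Δ
  | _, _, s, .eq t u => .eq (t.subst s) (u.subst s)
  | _, _, _, .bot => .bot
  | _, _, s, .and φ ψ => .and (φ.subst s) (ψ.subst s)
  | _, _, s, .or φ ψ => .or (φ.subst s) (ψ.subst s)
  | _, _, s, .imp φ ψ => .imp (φ.subst s) (ψ.subst s)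
  | _, _, s, .all σ φ => .all σ (φ.subst (s.lift σ))
  | _, _, s, .ex σ φ => .ex σ (φ.subst (s.lift σ))

namespace Fm

variable {Γ : Ctx}

/-- Weakening by one variable. -/
def wk (τ : FTy) (φ : Fm Γ) : Fm (τ :: Γ) := φ.subst (Subst.wk Γ τ)

/-- Instantiation of the last variable. -/
def inst {τ : FTy} (φ : Fm (τ :: Γ)) (t : Tm Γ τ) : Fm Γ :=
  φ.subst (Subst.cons (fun _ v => .var v) t)

def neg (φ : Fm Γ) : Fm Γ := .imp φ .bot

end Fm

namespace Tm

variable {Γ : Ctx}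

def app2 {σ τ ρ : FTy} (f : Tm Γ (FTy.arr σ (FTy.arr τ ρ))) (t : Tm Γ σ) (u : Tm Γ τ) : Tm Γ ρ :=
  .app (.app f t) u

def app3 {σ τ ρ υ : FTy} (f : Tm Γ (FTy.arr σ (FTy.arr τ (FTy.arr ρ υ)))) (t : Tm Γ σ) (u : Tm Γ τ)
    (v : Tm Γ ρ) : Tm Γ υ := .app (.app (.app f t) u) v

/-- The most recently bound variables. -/
def v0 {σ : FTy} : Tm (σ :: Γ) σ := .var .vz
def v1 {σ τ : FTy} : Tm (τ :: σ :: Γ) σ := .var (.vs .vz)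
def v2 {σ τ ρ : FTy} : Tm (ρ :: τ :: σ :: Γ) σ := .var (.vs (.vs .vz))
def v3 {σ τ ρ υ : FTy} : Tm (υ :: ρ :: τ :: σ :: Γ) σ := .var (.vs (.vs (.vs .vz)))

end Tm

/-- A theory: a collection of formulas in context, to be added to the arithmetic as axioms. -/
abbrev Theory : Type := ∀ Γ : Ctx, Set (Fm Γ)

open Tm in
/-- Provability in extensional Heyting arithmetic in all finite types, extended by the axioms `Ax`,
from a list of hypotheses. -/
inductive Prov (Ax : Theory) : ∀ {Γ : Ctx}, List (Fm Γ) → Fm Γ → Prop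
  -- the added axioms
  | ax {Γ : Ctx} {L : List (Fm Γ)} {φ : Fm Γ} : φ ∈ Ax Γ → Prov Ax L φ
  -- intuitionistic logic with equality
  | hyp {Γ : Ctx} {L : List (Fm Γ)} {φ : Fm Γ} : φ ∈ L → Prov Ax L φ
  | botE {Γ : Ctx} {L : List (Fm Γ)} {φ : Fm Γ} : Prov Ax L .bot → Prov Ax L φ
  | andI {Γ : Ctx} {L : List (Fm Γ)} {φ ψ : Fm Γ} : Prov Ax L φ → Prov Ax L ψ →
      Prov Ax L (.and φ ψ)
  | andE1 {Γ : Ctx} {L : List (Fm Γ)} {φ ψ : Fm Γ} : Prov Ax L (.and φ ψ) → Prov Ax L φ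
  | andE2 {Γ : Ctx} {L : List (Fm Γ)} {φ ψ : Fm Γ} : Prov Ax L (.and φ ψ) → Prov Ax L ψ
  | orI1 {Γ : Ctx} {L : List (Fm Γ)} {φ ψ : Fm Γ} : Prov Ax L φ → Prov Ax L (.or φ ψ)
  | orI2 {Γ : Ctx} {L : List (Fm Γ)} {φ ψ : Fm Γ} : Prov Ax L ψ → Prov Ax L (.or φ ψ)
  | orE {Γ : Ctx} {L : List (Fm Γ)} {φ ψ χ : Fm Γ} : Prov Ax L (.or φ ψ) →
      Prov Ax (φ :: L) χ → Prov Ax (ψ :: L) χ → Prov Ax L χ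
  | impI {Γ : Ctx} {L : List (Fm Γ)} {φ ψ : Fm Γ} : Prov Ax (φ :: L) ψ → Prov Ax L (.imp φ ψ)
  | impE {Γ : Ctx} {L : List (Fm Γ)} {φ ψ : Fm Γ} : Prov Ax L (.imp φ ψ) → Prov Ax L φ →
      Prov Ax L ψ
  | allI {Γ : Ctx} {L : List (Fm Γ)} {σ : FTy} {φ : Fm (σ :: Γ)} : Prov Ax (L.map (Fm.wk σ)) φ →
      Prov Ax L (.all σ φ)
  | allE {Γ : Ctx} {L : List (Fm Γ)} {σ : FTy} {φ : Fm (σ :: Γ)} (t : Tm Γ σ) :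
      Prov Ax L (.all σ φ) → Prov Ax L (φ.inst t)
  | exI {Γ : Ctx} {L : List (Fm Γ)} {σ : FTy} {φ : Fm (σ :: Γ)} (t : Tm Γ σ) :
      Prov Ax L (φ.inst t) → Prov Ax L (.ex σ φ)
  | exE {Γ : Ctx} {L : List (Fm Γ)} {σ : FTy} {φ : Fm (σ :: Γ)} {ψ : Fm Γ} :
      Prov Ax L (.ex σ φ) → Prov Ax (φ :: L.map (Fm.wk σ)) (ψ.wk σ) → Prov Ax L ψ
  | eqI {Γ : Ctx} {L : List (Fm Γ)} {σ : FTy} (t : Tm Γ σ) : Prov Ax L (.eq t t)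
  | eqE {Γ : Ctx} {L : List (Fm Γ)} {σ : FTy} {t u : Tm Γ σ} (φ : Fm (σ :: Γ)) :
      Prov Ax L (.eq t u) → Prov Ax L (φ.inst t) → Prov Ax L (φ.inst u)
  -- the combinators
  | k_eq {Γ : Ctx} {L : List (Fm Γ)} {σ τ : FTy} (t : Tm Γ σ) (u : Tm Γ τ) :
      Prov Ax L (.eq (app2 (.k σ τ) t u) t)
  | s_eq {Γ : Ctx} {L : List (Fm Γ)} {σ τ ρ : FTy} (t : Tm Γ (FTy.arr σ (FTy.arr τ ρ)))
      (u : Tm Γ (FTy.arr σ τ)) (v : Tm Γ σ) :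
      Prov Ax L (.eq (app3 (.s σ τ ρ) t u v) (.app (.app t v) (.app u v)))
  | fst_eq {Γ : Ctx} {L : List (Fm Γ)} {σ τ : FTy} (t : Tm Γ σ) (u : Tm Γ τ) :
      Prov Ax L (.eq (.app (.fst σ τ) (app2 (.pair σ τ) t u)) t)
  | snd_eq {Γ : Ctx} {L : List (Fm Γ)} {σ τ : FTy} (t : Tm Γ σ) (u : Tm Γ τ) :
      Prov Ax L (.eq (.app (.snd σ τ) (app2 (.pair σ τ) t u)) u)
  | pair_eq {Γ : Ctx} {L : List (Fm Γ)} {σ τ : FTy} (t : Tm Γ (FTy.prod σ τ)) :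
      Prov Ax L (.eq (app2 (.pair σ τ) (.app (.fst σ τ) t) (.app (.snd σ τ) t)) t)
  | unit_eq {Γ : Ctx} {L : List (Fm Γ)} (t : Tm Γ FTy.unit) : Prov Ax L (.eq t .tt)
  | rec_zero {Γ : Ctx} {L : List (Fm Γ)} {σ : FTy} (t : Tm Γ σ)
      (u : Tm Γ (FTy.arr FTy.nat (FTy.arr σ σ))) :
      Prov Ax L (.eq (app3 (.recN σ) t u .zero) t)
  | rec_succ {Γ : Ctx} {L : List (Fm Γ)} {σ : FTy} (t : Tm Γ σ)
      (u : Tm Γ (FTy.arr FTy.nat (FTy.arr σ σ))) (n : Tm Γ FTy.nat) :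
      Prov Ax L (.eq (app3 (.recN σ) t u (.app .succ n)) (app2 u n (app3 (.recN σ) t u n)))
  -- extensionality
  | ext {Γ : Ctx} {L : List (Fm Γ)} {σ τ : FTy} (t u : Tm Γ (FTy.arr σ τ)) :
      Prov Ax L (.imp (.all σ (.eq (.app (t.subst (Subst.wk Γ σ)) v0)
        (.app (u.subst (Subst.wk Γ σ)) v0))) (.eq t u))
  -- arithmetic
  | succ_ne_zero {Γ : Ctx} {L : List (Fm Γ)} (t : Tm Γ FTy.nat) :
      Prov Ax L (Fm.neg (.eq (.app .succ t) .zero))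
  | succ_inj {Γ : Ctx} {L : List (Fm Γ)} (t u : Tm Γ FTy.nat) :
      Prov Ax L (.imp (.eq (.app .succ t) (.app .succ u)) (.eq t u))
  | induction {Γ : Ctx} {L : List (Fm Γ)} (φ : Fm (FTy.nat :: Γ)) :
      Prov Ax L (.imp (φ.inst .zero) (.imp
        (.all FTy.nat (.imp φ (φ.subst (Subst.cons (Subst.wk Γ FTy.nat) (.app .succ v0)))))
        (.all FTy.nat φ)))

open Tm in
/-- Converse extensionality:
`∃ X ∀ Φ ∀ f ∀ g (Φ f ≠ Φ g → f (X Φ f g) ≠ g (X Φ f g))`, where `f` and `g` are of type `n + 1`. -/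
def CE (n : ℕ) {Γ : Ctx} : Fm Γ :=
  .ex (FTy.arr (FTy.pure (n + 2)) (FTy.arr (FTy.pure (n + 1)) (FTy.arr (FTy.pure (n + 1))
      (FTy.pure n))))
    (.all (FTy.pure (n + 2)) (.all (FTy.pure (n + 1)) (.all (FTy.pure (n + 1))
      (.imp
        (Fm.neg (.eq (σ := FTy.nat) (.app (σ := FTy.pure (n + 1)) v2 v1)
          (.app (σ := FTy.pure (n + 1)) v2 v0)))
        (Fm.neg (.eq (σ := FTy.nat) (.app (σ := FTy.pure n) v1 (app3 v3 v2 v1 v0))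
          (.app (σ := FTy.pure n) v0 (app3 v3 v2 v1 v0))))))))

open Tm in
/-- Markov's principle for objects of type `n`: `∀ f (¬ ¬ ∃ x (f x = 0) → ∃ x (f x = 0))`. -/
def MP (n : ℕ) {Γ : Ctx} : Fm Γ :=
  .all (FTy.pure (n + 1)) (.imp
    (Fm.neg (Fm.neg (.ex (FTy.pure n) (.eq (σ := FTy.nat) (.app (σ := FTy.pure n) v1 v0) .zero))))
    (.ex (FTy.pure n) (.eq (σ := FTy.nat) (.app (σ := FTy.pure n) v1 v0) .zero)))

/-- The substitution of `f x` for `y`, from the context `Γ, x, y` to the context `Γ, f, x`. -/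
def acSubst (Γ : Ctx) (σ τ : FTy) : Subst (τ :: σ :: Γ) (σ :: FTy.arr σ τ :: Γ) :=
  Subst.cons (Subst.cons (fun _ v => .var (.vs (.vs v))) Tm.v0) (.app Tm.v1 Tm.v0)

/-- The axiom of choice: `∀ x ∃ y φ x y → ∃ f ∀ x φ x (f x)`. -/
def ACFm {Γ : Ctx} (σ τ : FTy) (φ : Fm (τ :: σ :: Γ)) : Fm Γ :=
  .imp (.all σ (.ex τ φ)) (.ex (FTy.arr σ τ) (.all σ (φ.subst (acSubst Γ σ τ))))

/-- The axioms of choice in all finite types, together with converse extensionality. -/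
def ACCE (n : ℕ) : Theory := fun Γ => {χ | χ = CE n ∨ ∃ σ τ φ, χ = ACFm (Γ := Γ) σ τ φ}

/-! ### The interpretation in assemblies -/

namespace Assembly

/-- The interpretation of finite types. -/
def ofTy (T : TCA) : FTy → Assembly T
  | .unit => one T
  | .nat => nno T
  | .prod σ τ => prod (ofTy T σ) (ofTy T τ)
  | .arr σ τ => exp (ofTy T σ) (ofTy T τ)

/-- The interpretation of contexts. -/
def ofCtx (T : TCA) : Ctx → Assembly T
  | [] => one T
  | σ :: Γ => prod (ofCtx T Γ) (ofTy T σ)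

variable (T : TCA)

/-- The interpretation of variables. -/
def ofVar : ∀ {Γ : Ctx} {σ : FTy}, Var Γ σ → Hom (ofCtx T Γ) (ofTy T σ)
  | _ :: _, _, .vz => snd _ _
  | _ :: _, _, .vs v => (ofVar v).comp (fst _ _)

variable {T}

/-- The combinators, as global elements. -/
def kHom (Z X Y : Assembly T) : Hom Z (exp X (exp Y X)) :=
  curry (curry ((snd Z X).comp (fst _ Y)))

def sHom (Z X Y W : Assembly T) : Hom Z (exp (exp X (exp Y W)) (exp (exp X Y) (exp X W))) :=
  curry (curry (curry (eval
    (eval (((snd Z _).comp (fst _ _)).comp (fst _ _)) (snd _ _))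
    (eval ((snd (prod Z _) _).comp (fst _ _)) (snd _ _)))))

def pairHom (Z X Y : Assembly T) : Hom Z (exp X (exp Y (prod X Y))) :=
  curry (curry (lift ((snd Z X).comp (fst _ Y)) (snd _ _)))

def fstHom (Z X Y : Assembly T) : Hom Z (exp (prod X Y) X) := curry ((fst X Y).comp (snd _ _))

def sndHom (Z X Y : Assembly T) : Hom Z (exp (prod X Y) Y) := curry ((snd X Y).comp (snd _ _))

def succHom (Z : Assembly T) : Hom Z (exp (nno T) (nno T)) := curry ((succ T).comp (snd _ _))

def recHom (Z X : Assembly T) :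
    Hom Z (exp X (exp (exp (nno T) (exp X X)) (exp (nno T) X))) :=
  curry (curry (curry ((natRec X).comp
    (lift (lift (((snd Z X).comp (fst _ _)).comp (fst _ _)) ((snd (prod Z X) _).comp (fst _ _)))
      (snd _ _)))))

variable (T)

/-- The interpretation of terms. -/
def ofTm {Γ : Ctx} : ∀ {σ : FTy}, Tm Γ σ → Hom (ofCtx T Γ) (ofTy T σ)
  | _, .var v => ofVar T v
  | _, .app t u => eval (ofTm t) (ofTm u)
  | _, .k σ τ => kHom _ (ofTy T σ) (ofTy T τ)
  | _, .s σ τ ρ => sHom _ (ofTy T σ) (ofTy T τ) (ofTy T ρ)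
  | _, .tt => toOne _
  | _, .pair σ τ => pairHom _ (ofTy T σ) (ofTy T τ)
  | _, .fst σ τ => fstHom _ (ofTy T σ) (ofTy T τ)
  | _, .snd σ τ => sndHom _ (ofTy T σ) (ofTy T τ)
  | _, .zero => zero _
  | _, .succ => succHom _
  | _, .recN σ => recHom _ (ofTy T σ)

/-- The interpretation of formulas. -/
def ofFm : ∀ {Γ : Ctx}, Fm Γ → Pred (ofCtx T Γ)
  | _, .eq t u => Pred.eq (ofTm T t) (ofTm T u)
  | _, .bot => Pred.bot _
  | _, .and φ ψ => (ofFm φ).and (ofFm ψ)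
  | _, .or φ ψ => (ofFm φ).or (ofFm ψ)
  | _, .imp φ ψ => (ofFm φ).imp (ofFm ψ)
  | Γ, .all σ φ => Pred.forallAlong (fst (ofCtx T Γ) (ofTy T σ)) (ofFm φ)
  | Γ, .ex σ φ => Pred.existsAlong (fst (ofCtx T Γ) (ofTy T σ)) (ofFm φ)

/-- The sentence `φ` holds in the assemblies over `T`. -/
def Models (φ : Fm []) : Prop := (ofFm T φ).Valid

/-- Independence of premise for `Y`, in any context and for arbitrary predicates. -/
def IPFor (Y : Assembly T) : Prop :=
  ∀ (X : Assembly T) (p : Pred X) (q : Pred (prod X Y)),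
    ((p.neg.imp (q.existsAlong (fst X Y))).imp
      (((p.neg.pull (fst X Y)).imp q).existsAlong (fst X Y))).Valid

/-- Independence of premise for all modest and exhaustive assemblies and for all finite types. -/
def IP : Prop :=
  (∀ Y : Assembly T, Y.Modest → Y.Exhaustive → IPFor T Y) ∧ ∀ σ, IPFor T (ofTy T σ)

/-- The axiom of choice from `X` to `Y`, in any context and for arbitrary predicates. -/
def ACFor (X Y : Assembly T) : Prop :=
  ∀ (Z : Assembly T) (p : Pred (prod (prod Z X) Y)),
    (((p.existsAlong (fst _ Y)).forallAlong (fst Z X)).imp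
      (((p.pull (lift (lift ((fst Z (exp X Y)).comp (fst _ X)) (snd _ X))
        (eval ((snd Z (exp X Y)).comp (fst _ X)) (snd _ X)))).forallAlong
          (fst (prod Z (exp X Y)) X)).existsAlong (fst Z (exp X Y)))).Valid

/-- The axiom of choice for all basic assemblies and for all finite types. -/
def AC : Prop :=
  (∀ X Y : Assembly T, X.Basic → Y.Basic → ACFor T X Y) ∧ ∀ σ τ, ACFor T (ofTy T σ) (ofTy T τ)

end Assembly

/-- The tca whose assemblies are the apartness assemblies over the first algebra. -/
noncomputable abbrev ApK1 : TCA := ApTypes K1 K1_consistent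

/-- The tca whose assemblies are the apartness assemblies over the recursive submodel of the second
algebra. -/
noncomputable abbrev ApK2rec : TCA := ApTypes K2rec K2rec_consistent

end ConvExt

/-!
Assemblies over a tca are governed by realizers, and the tca of apartness types is *extensional*
(`TCA.Extensional`): elements of a function type are equal as soon as they have equal values, every
number is a numeral, and even the type `⊥` is inhabited, since apartness types are. These three
features account for the positive principles.

* As `⊥` is inhabited, a realizer of `¬φ → ∃ y, ψ y` can be run whether or not `¬φ` holds. Its
  outcome determines a point of `Y` as `Y` is exhaustive, and this is the choice demanded by `IP`
  (`Assembly.ipFor`).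
* By extensionality all finite types are interpreted by basic assemblies (`Assembly.ofTy_basic`).
  Points of a basic assembly have a single realizer, so a realizer of `∀ x, ∃ y, φ x y` selects a
  function, which gives `AC` (`Assembly.acFor`).
* For converse extensionality, let a morphism `Φ` separate `f` and `g`. The negative part of `Φ`
  computes some `a` with `f a ≠ g a`, but it depends on realizers and is not a morphism. It is used
  only to bound a search: if `q` enumerates sufficiently many arguments, `a` yields an index `i`
  with `f (q i) ≠ g (q i)`, and the *least* such index is extensional (`ApType.isMor_search`,
  `ApType.exists_ce`). At type `N` all arguments are enumerated. At type `N → N`, over the recursive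
  part of Kleene's second algebra, functionals are continuous, and it suffices to enumerate the
  functions that vanish almost everywhere (`K2rec.ce_one_valid`).

A realizer of Markov's principle is a total operation on *all* functions, which finds a zero of any
function having one (`ApType.exists_nat_search_of_mp`); the principle one level up provides such an
operation, too. Over Kleene's first algebra it would decide the halting problem: one tests the
number found (`K1.not_models_mp`). Over the second algebra it is continuous, so its value at the
constant function `1` is settled by an initial segment, which can be continued by a function all of
whose zeros are larger than this value (`K2rec.not_models_mp`).

The unprovability statement follows by soundness of the interpretation of `E-HA^ω` in assemblies
(`Assembly.models_of_prov`), which rests on the hyperdoctrine structure of predicates.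
-/

namespace ConvExt

open TCA (p1 p2 pr il ir Repr)
open Assembly (Hom)

/-! ### The hyperdoctrine of predicates -/

namespace Pred

variable {T : TCA} {X Y Z : Assembly T}

theorem le_of_repr {p q : Pred X} {F : T.El p.ty → T.El q.ty} (hF : Repr F)
    (h : ∀ x, ∀ b ∈ p.real x, F b ∈ q.real x) : p.le q := by
  obtain ⟨e, he⟩ := hF
  exact ⟨e, fun x b hb => by rw [he]; exact h x b hb⟩

theorem le.exists_repr {p q : Pred X} (h : p.le q) : ∃ F : T.El p.ty → T.El q.ty, Repr F ∧
    ∀ x, ∀ b ∈ p.real x, F b ∈ q.real x := by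
  obtain ⟨e, he⟩ := h
  exact ⟨fun a => T.app e a, Repr.elt e, he⟩

theorem le.refl (p : Pred X) : p.le p := le_of_repr Repr.id fun _ _ h => h

theorem le.trans {p q r : Pred X} (h : p.le q) (h' : q.le r) : p.le r := by
  obtain ⟨F, hF, h⟩ := h.exists_repr
  obtain ⟨G, hG, h'⟩ := h'.exists_repr
  exact le_of_repr (hG.comp hF) fun x b hb => h' _ _ (h x b hb)

theorem le_top (p : Pred X) : p.le (top X) := p.proj

theorem Valid.le {p : Pred X} (h : p.Valid) (q : Pred X) : q.le p := (le_top q).trans h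

theorem bot_le (p : Pred X) : (bot X).le p := ⟨T.exf _, fun _ _ h => h.elim⟩

theorem and_le_left (p q : Pred X) : (p.and q).le p := le_of_repr Repr.id.p1 (by
  rintro x _ ⟨a, ha, b, -, rfl⟩
  simpa using ha)

theorem and_le_right (p q : Pred X) : (p.and q).le q := le_of_repr Repr.id.p2 (by
  rintro x _ ⟨a, -, b, hb, rfl⟩
  simpa using hb)

theorem le_and {p q r : Pred X} (h : r.le p) (h' : r.le q) : r.le (p.and q) := by
  obtain ⟨F, hF, h⟩ := h.exists_repr
  obtain ⟨G, hG, h'⟩ := h'.exists_repr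
  exact le_of_repr (hF.pr hG) fun x b hb => ⟨_, h x b hb, _, h' x b hb, rfl⟩

theorem and_mono {p q p' q' : Pred X} (h : p.le p') (h' : q.le q') : (p.and q).le (p'.and q') :=
  le_and ((and_le_left _ _).trans h) ((and_le_right _ _).trans h')

theorem le_or_left (p q : Pred X) : p.le (p.or q) :=
  le_of_repr Repr.id.il fun _ b hb => Or.inl ⟨b, hb, rfl⟩

theorem le_or_right (p q : Pred X) : q.le (p.or q) :=
  le_of_repr Repr.id.ir fun _ b hb => Or.inr ⟨b, hb, rfl⟩

theorem or_le {p q r : Pred X} (h : p.le r) (h' : q.le r) : (p.or q).le r := by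
  obtain ⟨F, hF, h⟩ := h.exists_repr
  obtain ⟨G, hG, h'⟩ := h'.exists_repr
  obtain ⟨H, hH, e1, e2⟩ := Repr.case (S := T.sum p.ty q.ty) Repr.id (hF.comp Repr.id.p2)
    (hG.comp Repr.id.p2)
  refine le_of_repr hH ?_
  rintro x _ (⟨a, ha, rfl⟩ | ⟨a, ha, rfl⟩)
  · rw [e1 _ a rfl, TCA.p2_pr]
    exact h x a ha
  · rw [e2 _ a rfl, TCA.p2_pr]
    exact h' x a ha

theorem or_mono {p q p' q' : Pred X} (h : p.le p') (h' : q.le q') : (p.or q).le (p'.or q') :=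
  or_le (h.trans (le_or_left _ _)) (h'.trans (le_or_right _ _))

theorem le_imp_iff {p q r : Pred X} : r.le (p.imp q) ↔ (p.and r).le q := by
  constructor
  · intro h
    obtain ⟨F, hF, h⟩ := h.exists_repr
    refine le_of_repr ((hF.comp Repr.id.p2).p2.app Repr.id.p1) ?_
    rintro x _ ⟨a, ha, b, hb, rfl⟩
    simpa using (h x b hb).2 a ha
  · intro h
    obtain ⟨F, hF, h⟩ := h.exists_repr
    obtain ⟨P, hP, h'⟩ := r.exists_proj
    obtain ⟨G, hG, e⟩ := (hF.comp (Repr.id.p2.pr Repr.id.p1)).curry (S := r.ty) (U := p.ty)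
    refine le_of_repr (hP.pr hG) fun x b hb => ⟨by simpa using h' x b hb, fun a ha => ?_⟩
    rw [TCA.p2_pr, e, TCA.p1_pr, TCA.p2_pr]
    exact h x _ ⟨a, ha, b, hb, rfl⟩

theorem imp_and_le (p q : Pred X) : (p.and (p.imp q)).le q := le_imp_iff.1 (le.refl _)

theorem imp_mono {p q p' q' : Pred X} (h : p'.le p) (h' : q.le q') : (p.imp q).le (p'.imp q') :=
  le_imp_iff.2 ((and_mono h (le.refl _)).trans ((imp_and_le _ _).trans h'))

/-! Reindexing and quantification along a morphism. -/

theorem pull_mono (f : Hom Y X) {p q : Pred X} (h : p.le q) : (pull f p).le (pull f q) := by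
  obtain ⟨F, hF, h⟩ := h.exists_repr
  refine le_of_repr ((hF.comp Repr.id.p1).pr Repr.id.p2) ?_
  rintro y _ ⟨a, ha, b, hb, rfl⟩
  exact ⟨_, by simpa using h _ a ha, _, by simpa using hb, rfl⟩

theorem pull_congr {f g : Hom Y X} (h : ∀ y, f y = g y) (p : Pred X) : (pull f p).le (pull g p) :=
  le_of_repr Repr.id (by
    rintro y _ ⟨a, ha, b, hb, rfl⟩
    exact ⟨a, h y ▸ ha, b, hb, rfl⟩)

/-- An inequality out of a reindexed predicate, in terms of realizers. -/
theorem pull_le_of_repr {f : Hom Y X} {p : Pred X} {q : Pred Y}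
    {F : T.El (T.prod p.ty Y.ty) → T.El q.ty} (hF : Repr F)
    (h : ∀ y, ∀ a ∈ p.real (f y), ∀ b ∈ Y.real y, F (pr a b) ∈ q.real y) : (pull f p).le q :=
  le_of_repr hF (by
    rintro y _ ⟨a, ha, b, hb, rfl⟩
    exact h y a ha b hb)

/-- An inequality into a reindexed predicate, in terms of realizers. -/
theorem le_pull_of_repr {f : Hom Y X} {p : Pred X} {q : Pred Y} {F : T.El q.ty → T.El p.ty}
    (hF : Repr F) (h : ∀ y, ∀ a ∈ q.real y, F a ∈ p.real (f y)) : q.le (pull f p) := by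
  obtain ⟨P, hP, h'⟩ := q.exists_proj
  exact le_of_repr (hF.pr hP) fun y a ha => ⟨_, h y a ha, _, h' y a ha, rfl⟩

theorem pull_comp_le (f : Hom Y X) (g : Hom Z Y) (p : Pred X) :
    (pull (f.comp g) p).le (pull g (pull f p)) := by
  obtain ⟨G, hG, h⟩ := g.exists_repr
  refine pull_le_of_repr ((Repr.id.p1.pr (hG.comp Repr.id.p2)).pr Repr.id.p2)
    fun z a ha b hb => ?_
  simp only [TCA.p1_pr, TCA.p2_pr]
  exact ⟨_, ⟨a, ha, _, h z b hb, rfl⟩, b, hb, rfl⟩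

theorem le_pull_comp (f : Hom Y X) (g : Hom Z Y) (p : Pred X) :
    (pull g (pull f p)).le (pull (f.comp g) p) :=
  pull_le_of_repr (Repr.id.p1.p1.pr Repr.id.p2) (by
    rintro z _ ⟨a, ha, b, -, rfl⟩ c hc
    erw [TCA.p1_pr, TCA.p1_pr, TCA.p2_pr]
    exact ⟨a, ha, c, hc, rfl⟩)

theorem existsAlong_le_iff {f : Hom Y X} {p : Pred Y} {q : Pred X} :
    (existsAlong f p).le q ↔ p.le (pull f q) := by
  constructor
  · intro h
    obtain ⟨F, hF, h⟩ := h.exists_repr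
    exact le_pull_of_repr hF fun y a ha => h _ _ ⟨y, rfl, ha⟩
  · intro h
    obtain ⟨F, hF, h⟩ := h.exists_repr
    refine le_of_repr hF.p1 ?_
    rintro _ a ⟨y, rfl, ha⟩
    obtain ⟨b, hb, c, -, e⟩ := h y a ha
    rw [← e, TCA.p1_pr]
    exact hb

theorem le_forallAlong_iff {f : Hom Y X} {p : Pred Y} {q : Pred X} :
    q.le (forallAlong f p) ↔ (pull f q).le p := by
  constructor
  · intro h
    obtain ⟨F, hF, h⟩ := h.exists_repr
    refine pull_le_of_repr ((hF.comp Repr.id.p1).p2.app Repr.id.p2) fun y a ha b hb => ?_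
    simpa using (h _ a ha).2 y rfl b hb
  · intro h
    obtain ⟨F, hF, h⟩ := h.exists_repr
    obtain ⟨P, hP, h'⟩ := q.exists_proj
    obtain ⟨G, hG, e⟩ := hF.curry
    refine le_of_repr (hP.pr hG) fun x a ha => ⟨by simpa using h' x a ha, ?_⟩
    rintro y rfl n hn
    rw [TCA.p2_pr, e]
    exact h y _ ⟨a, ha, n, hn, rfl⟩

theorem existsAlong_mono (f : Hom Y X) {p q : Pred Y} (h : p.le q) :
    (existsAlong f p).le (existsAlong f q) :=
  existsAlong_le_iff.2 (h.trans (existsAlong_le_iff.1 (le.refl _)))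

theorem pull_forallAlong_le (f : Hom Y X) (p : Pred Y) : (pull f (forallAlong f p)).le p :=
  le_forallAlong_iff.1 (le.refl _)

theorem le_pull_existsAlong (f : Hom Y X) (p : Pred Y) : p.le (pull f (existsAlong f p)) :=
  existsAlong_le_iff.1 (le.refl _)

theorem forallAlong_mono (f : Hom Y X) {p q : Pred Y} (h : p.le q) :
    (forallAlong f p).le (forallAlong f q) :=
  le_forallAlong_iff.2 ((pull_forallAlong_le f p).trans h)

/-! Reindexing commutes with the logical operations. -/

theorem pull_bot_le (f : Hom Y X) : (pull f (bot X)).le (bot Y) :=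
  pull_le_of_repr Repr.id.p1 fun _ _ h => h.elim

theorem pull_and_le (f : Hom Y X) (p q : Pred X) :
    (pull f (p.and q)).le ((pull f p).and (pull f q)) :=
  le_and (pull_mono f (and_le_left _ _)) (pull_mono f (and_le_right _ _))

theorem le_pull_and (f : Hom Y X) (p q : Pred X) :
    ((pull f p).and (pull f q)).le (pull f (p.and q)) :=
  le_pull_of_repr (Repr.id.p1.p1.pr Repr.id.p2.p1) (by
    rintro y _ ⟨_, ⟨a, ha, b, hb, rfl⟩, _, ⟨a', ha', b', hb', rfl⟩, rfl⟩
    erw [TCA.p1_pr, TCA.p1_pr, TCA.p2_pr, TCA.p1_pr]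
    exact ⟨a, ha, a', ha', rfl⟩)

theorem le_pull_or (f : Hom Y X) (p q : Pred X) :
    ((pull f p).or (pull f q)).le (pull f (p.or q)) :=
  or_le (pull_mono f (le_or_left _ _)) (pull_mono f (le_or_right _ _))

theorem pull_or_le (f : Hom Y X) (p q : Pred X) :
    (pull f (p.or q)).le ((pull f p).or (pull f q)) := by
  obtain ⟨H, hH, e1, e2⟩ := Repr.case (S := T.prod (T.sum p.ty q.ty) Y.ty) Repr.id.p1
    ((Repr.id.p2.pr Repr.id.p1.p2).il (V := T.prod q.ty Y.ty))
    ((Repr.id.p2.pr Repr.id.p1.p2).ir (V := T.prod p.ty Y.ty))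
  refine pull_le_of_repr hH ?_
  rintro y _ (⟨a, ha, rfl⟩ | ⟨a, ha, rfl⟩) b hb
  · erw [e1 _ a (TCA.p1_pr _ _), TCA.p2_pr, TCA.p1_pr, TCA.p2_pr]
    exact Or.inl ⟨_, ⟨a, ha, b, hb, rfl⟩, rfl⟩
  · erw [e2 _ a (TCA.p1_pr _ _), TCA.p2_pr, TCA.p1_pr, TCA.p2_pr]
    exact Or.inr ⟨_, ⟨a, ha, b, hb, rfl⟩, rfl⟩

theorem pull_imp_le (f : Hom Y X) (p q : Pred X) :
    (pull f (p.imp q)).le ((pull f p).imp (pull f q)) :=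
  le_imp_iff.2 ((le_pull_and f _ _).trans (pull_mono f (imp_and_le p q)))

theorem le_pull_imp (f : Hom Y X) (p q : Pred X) :
    ((pull f p).imp (pull f q)).le (pull f (p.imp q)) := by
  obtain ⟨F, hF, h⟩ := f.exists_repr
  -- evidence for the reindexed premise also needs a realizer of the point
  obtain ⟨G, hG, e⟩ := (Repr.id.p1.p2.app (Repr.id.p2.pr Repr.id.p1.p1)).p1.curry
    (S := T.prod Y.ty (T.arr (T.prod p.ty Y.ty) (T.prod q.ty Y.ty))) (U := p.ty)
  refine le_pull_of_repr ((hF.comp Repr.id.p1).pr hG) fun y k hk => ?_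
  refine ⟨by simpa using h y _ hk.1, fun n hn => ?_⟩
  rw [TCA.p2_pr]
  erw [e, TCA.p1_pr, TCA.p2_pr]
  obtain ⟨b, hb, c, -, e'⟩ := hk.2 (pr n (p1 k)) ⟨n, hn, _, hk.1, rfl⟩
  erw [← e', TCA.p1_pr]
  exact hb

theorem pull_eq_le {W : Assembly T} (f : Hom Y X) (g h : Hom X W) :
    (pull f (eq g h)).le (eq (g.comp f) (h.comp f)) :=
  pull_le_of_repr Repr.id.p2 (by
    rintro y a ha b hb
    erw [TCA.p2_pr]
    exact ⟨hb, ha.2⟩)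

theorem le_pull_eq {W : Assembly T} (f : Hom Y X) (g h : Hom X W) :
    (eq (g.comp f) (h.comp f)).le (pull f (eq g h)) := by
  obtain ⟨F, hF, hF'⟩ := f.exists_repr
  exact le_pull_of_repr hF fun y a ha => ⟨hF' y a ha.1, ha.2⟩

/-- The Beck–Chevalley condition for existential quantification over a factor. -/
theorem pull_existsAlong_le (f : Hom Y X) (p : Pred (Assembly.prod X Z)) :
    (pull f (existsAlong (Assembly.fst X Z) p)).le (existsAlong (Assembly.fst Y Z)
      (pull (Assembly.lift (f.comp (Assembly.fst Y Z)) (Assembly.snd Y Z)) p)) := by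
  obtain ⟨P, hP, h⟩ := p.exists_proj
  refine pull_le_of_repr (Repr.id.p1.pr (Repr.id.p2.pr (hP.comp Repr.id.p1).p2)) ?_
  rintro y a ⟨⟨x, z⟩, e, ha⟩ b hb
  obtain rfl : x = f y := e
  simp only [TCA.p1_pr, TCA.p2_pr]
  exact ⟨(y, z), rfl, a, ha, _, ⟨by simpa using hb, by
    erw [TCA.p2_pr, TCA.p1_pr]; exact (h _ a ha).2⟩, rfl⟩

theorem le_pull_existsAlong_fst (f : Hom Y X) (p : Pred (Assembly.prod X Z)) :
    (existsAlong (Assembly.fst Y Z)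
      (pull (Assembly.lift (f.comp (Assembly.fst Y Z)) (Assembly.snd Y Z)) p)).le
      (pull f (existsAlong (Assembly.fst X Z) p)) :=
  le_pull_of_repr Repr.id.p1 (by
    rintro _ _ ⟨⟨y, z⟩, rfl, a, ha, b, hb, rfl⟩
    erw [TCA.p1_pr]
    exact ⟨(f y, z), rfl, ha⟩)

/-- The Beck–Chevalley condition for universal quantification over a factor. -/
theorem le_pull_forallAlong (f : Hom Y X) (p : Pred (Assembly.prod X Z)) :
    (forallAlong (Assembly.fst Y Z)
      (pull (Assembly.lift (f.comp (Assembly.fst Y Z)) (Assembly.snd Y Z)) p)).le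
      (pull f (forallAlong (Assembly.fst X Z) p)) := by
  obtain ⟨F, hF, h⟩ := f.exists_repr
  obtain ⟨G, hG, e⟩ := (Repr.id.p1.p2.app (Repr.id.p1.p1.pr Repr.id.p2.p2)).p1.curry
    (S := T.prod Y.ty (T.arr (T.prod Y.ty Z.ty) (T.prod p.ty (T.prod Y.ty Z.ty))))
    (U := T.prod X.ty Z.ty)
  refine le_pull_of_repr ((hF.comp Repr.id.p1).pr hG) fun y k hk => ?_
  refine ⟨by simpa using h y _ hk.1, ?_⟩
  rintro ⟨x, z⟩ ex n hn
  obtain rfl : x = f y := ex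
  rw [TCA.p2_pr]
  erw [e, TCA.p1_pr, TCA.p2_pr]
  obtain ⟨b, hb, c, -, e'⟩ := hk.2 (y, z) rfl (pr (p1 k) (p2 n))
    ⟨by simpa using hk.1, by simpa using hn.2⟩
  erw [← e', TCA.p1_pr]
  exact hb

theorem pull_forallAlong_fst_le (f : Hom Y X) (p : Pred (Assembly.prod X Z)) :
    (pull f (forallAlong (Assembly.fst X Z) p)).le (forallAlong (Assembly.fst Y Z)
      (pull (Assembly.lift (f.comp (Assembly.fst Y Z)) (Assembly.snd Y Z)) p)) := by
  refine le_forallAlong_iff.2 ((le_pull_comp _ _ _).trans ?_)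
  refine le.trans ?_ (pull_mono _ (pull_forallAlong_le (Assembly.fst X Z) p))
  exact (pull_congr (g := (Assembly.fst X Z).comp _) (fun _ => rfl) _).trans (pull_comp_le _ _ _)

end Pred

/-! ### Substitution in the interpretation -/

namespace Assembly

variable (T : TCA)

/-- The interpretation of substitutions. -/
def ofSubst {Δ : Ctx} : ∀ {Γ : Ctx}, Subst Γ Δ → Hom (ofCtx T Δ) (ofCtx T Γ)
  | [], _ => toOne _
  | _ :: _, s => lift (ofSubst fun σ v => s σ (.vs v)) (ofTm T (s _ .vz))

variable {T}

theorem ofVar_ofSubst {Γ Δ : Ctx} (s : Subst Γ Δ) {σ : FTy} (v : Var Γ σ)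
    (z : (ofCtx T Δ).carrier) : ofVar T v (ofSubst T s z) = ofTm T (s σ v) z := by
  induction v with
  | vz => rfl
  | vs v ih => exact ih fun σ v => s σ (.vs v)

/-- A point of a context is determined by its coordinates. -/
theorem ofCtx_ext {Γ : Ctx} {z z' : (ofCtx T Γ).carrier}
    (h : ∀ σ (v : Var Γ σ), ofVar T v z = ofVar T v z') : z = z' := by
  induction Γ with
  | nil => rfl
  | cons σ Γ ih => exact Prod.ext (ih fun τ v => h τ (.vs v)) (h σ .vz)

theorem ofTm_subst {Γ Δ : Ctx} (s : Subst Γ Δ) {σ : FTy} (t : Tm Γ σ) (z : (ofCtx T Δ).carrier) :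
    ofTm T (t.subst s) z = ofTm T t (ofSubst T s z) := by
  induction t with
  | var v => exact (ofVar_ofSubst s v z).symm
  | app t u iht ihu =>
    change (ofTm T (t.subst s) z).1 (ofTm T (u.subst s) z) = _
    rw [iht, ihu]
    rfl
  | _ => rfl

theorem ofSubst_wk (Γ : Ctx) (τ : FTy) (z : (ofCtx T (τ :: Γ)).carrier) :
    ofSubst T (Subst.wk Γ τ) z = z.1 :=
  ofCtx_ext fun _ v => ofVar_ofSubst _ v z

theorem ofSubst_var (Γ : Ctx) (z : (ofCtx T Γ).carrier) :
    ofSubst T (fun _ v => Tm.var v) z = z :=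
  ofCtx_ext fun _ v => ofVar_ofSubst _ v z

theorem ofSubst_lift {Γ Δ : Ctx} (s : Subst Γ Δ) (τ : FTy) (z : (ofCtx T (τ :: Δ)).carrier) :
    ofSubst T (s.lift τ) z = (ofSubst T s z.1, z.2) := by
  refine ofCtx_ext fun σ v => (ofVar_ofSubst _ v z).trans ?_
  cases v with
  | vz => rfl
  | vs v =>
    refine (ofTm_subst (Subst.wk Δ τ) (s σ v) z).trans ?_
    rw [ofSubst_wk]
    exact (ofVar_ofSubst s v z.1).symm

open ConvExt.Pred in
/-- Substitution is interpreted by reindexing. -/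
theorem ofFm_subst {Γ : Ctx} (φ : Fm Γ) : ∀ {Δ : Ctx} (s : Subst Γ Δ),
    (ofFm T (φ.subst s)).le (pull (ofSubst T s) (ofFm T φ)) ∧
      (pull (ofSubst T s) (ofFm T φ)).le (ofFm T (φ.subst s)) := by
  induction φ with
  | eq t u =>
    intro Δ s
    constructor
    · refine le.trans ?_ (le_pull_eq (ofSubst T s) (ofTm T t) (ofTm T u))
      refine le_of_repr Repr.id fun x a ha => ⟨ha.1, ?_⟩
      exact (ofTm_subst s t x).symm.trans (ha.2.trans (ofTm_subst s u x))
    · refine le.trans (pull_eq_le _ _ _) (le_of_repr Repr.id fun x a ha => ⟨ha.1, ?_⟩)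
      exact (ofTm_subst s t x).trans (ha.2.trans (ofTm_subst s u x).symm)
  | bot => exact fun s => ⟨bot_le _, pull_bot_le _⟩
  | and φ ψ ih ih' =>
    exact fun s => ⟨(and_mono (ih s).1 (ih' s).1).trans (le_pull_and _ _ _),
      (pull_and_le _ _ _).trans (and_mono (ih s).2 (ih' s).2)⟩
  | or φ ψ ih ih' =>
    exact fun s => ⟨(or_mono (ih s).1 (ih' s).1).trans (le_pull_or _ _ _),
      (pull_or_le _ _ _).trans (or_mono (ih s).2 (ih' s).2)⟩
  | imp φ ψ ih ih' =>
    exact fun s => ⟨(imp_mono (ih s).2 (ih' s).1).trans (le_pull_imp _ _ _),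
      (pull_imp_le _ _ _).trans (imp_mono (ih s).1 (ih' s).2)⟩
  | all σ φ ih =>
    exact fun s => ⟨(forallAlong_mono _ ((ih (s.lift σ)).1.trans
        (pull_congr (ofSubst_lift s σ) _))).trans (le_pull_forallAlong _ _),
      (pull_forallAlong_fst_le _ _).trans (forallAlong_mono _
        ((pull_congr (fun z => (ofSubst_lift s σ z).symm) _).trans (ih (s.lift σ)).2))⟩
  | ex σ φ ih =>
    exact fun s => ⟨(existsAlong_mono _ ((ih (s.lift σ)).1.trans
        (pull_congr (ofSubst_lift s σ) _))).trans (le_pull_existsAlong_fst _ _),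
      (pull_existsAlong_le _ _).trans (existsAlong_mono _
        ((pull_congr (fun z => (ofSubst_lift s σ z).symm) _).trans (ih (s.lift σ)).2))⟩

/-- The section of the projection given by a term. -/
def instHom {Γ : Ctx} {σ : FTy} (t : Tm Γ σ) : Hom (ofCtx T Γ) (ofCtx T (σ :: Γ)) :=
  ofSubst T (Subst.cons (fun _ v => .var v) t)

theorem instHom_apply {Γ : Ctx} {σ : FTy} (t : Tm Γ σ) (z : (ofCtx T Γ).carrier) :
    instHom t z = (z, ofTm T t z) :=
  Prod.ext (ofSubst_var Γ z) rfl

end Assembly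

/-! ### Soundness of the interpretation -/

namespace Assembly

open ConvExt.Pred

variable {T : TCA}

variable (T) in
/-- The conjunction of the interpretations of a list of hypotheses. -/
def ofHyps {Γ : Ctx} : List (Fm Γ) → Pred (ofCtx T Γ)
  | [] => Pred.top _
  | φ :: L => (ofFm T φ).and (ofHyps L)

theorem ofHyps_le {Γ : Ctx} {L : List (Fm Γ)} {φ : Fm Γ} (h : φ ∈ L) :
    (ofHyps T L).le (ofFm T φ) := by
  induction L with
  | nil => exact (List.not_mem_nil h).elim
  | cons ψ L ih =>
    rcases List.mem_cons.1 h with rfl | h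
    · exact and_le_left _ _
    · exact (and_le_right _ _).trans (ih h)

theorem ofFm_wk (σ : FTy) {Γ : Ctx} (φ : Fm Γ) :
    (ofFm T (φ.wk σ)).le (pull (fst _ (ofTy T σ)) (ofFm T φ)) ∧
      (pull (fst _ (ofTy T σ)) (ofFm T φ)).le (ofFm T (φ.wk σ)) :=
  ⟨(ofFm_subst φ _).1.trans (pull_congr (ofSubst_wk Γ σ) _),
    (pull_congr (fun z => (ofSubst_wk Γ σ z).symm) _).trans (ofFm_subst φ _).2⟩

theorem pull_ofHyps_le (σ : FTy) {Γ : Ctx} (L : List (Fm Γ)) :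
    (pull (fst _ (ofTy T σ)) (ofHyps T L)).le (ofHyps T (L.map (Fm.wk σ))) := by
  induction L with
  | nil => exact Pred.le_top _
  | cons φ L ih => exact (pull_and_le _ _ _).trans (and_mono (ofFm_wk σ φ).2 ih)

theorem ofFm_inst {Γ : Ctx} {σ : FTy} (φ : Fm (σ :: Γ)) (t : Tm Γ σ) :
    (ofFm T (φ.inst t)).le (pull (instHom t) (ofFm T φ)) ∧
      (pull (instHom t) (ofFm T φ)).le (ofFm T (φ.inst t)) :=
  ofFm_subst φ _

/-- Reindexing along the projection and then along a section of it changes nothing. -/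
theorem le_pull_instHom_pull_fst {Γ : Ctx} {σ : FTy} (t : Tm Γ σ) (p : Pred (ofCtx T Γ)) :
    p.le (pull (instHom t) (pull (fst _ (ofTy T σ)) p)) := by
  obtain ⟨P, hP, h⟩ := p.exists_proj
  obtain ⟨I, hI, h'⟩ := (instHom (T := T) t).exists_repr
  refine le_pull_of_repr (Repr.id.pr (hI.comp hP)) fun z a ha => ?_
  refine ⟨a, ?_, _, h' z _ (h z a ha), rfl⟩
  rw [instHom_apply]
  exact ha

theorem pull_instHom_pull_fst_le {Γ : Ctx} {σ : FTy} (t : Tm Γ σ) (p : Pred (ofCtx T Γ)) :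
    (pull (instHom t) (pull (fst _ (ofTy T σ)) p)).le p :=
  pull_le_of_repr Repr.id.p1.p1 (by
    rintro z _ ⟨a, ha, b, -, rfl⟩ c hc
    erw [TCA.p1_pr, TCA.p1_pr]
    rw [instHom_apply] at ha
    exact ha)

/-- Equations between equal morphisms are valid. -/
theorem eq_valid {X Y : Assembly T} {f g : Hom X Y} (h : ∀ x, f x = g x) : (Pred.eq f g).Valid :=
  le_of_repr Repr.id fun x _ ha => ⟨ha, h x⟩

/-- The Leibniz rule. -/
theorem eq_and_pull_le {Γ : Ctx} {σ : FTy} (t u : Tm Γ σ) (p : Pred (ofCtx T (σ :: Γ))) :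
    ((Pred.eq (ofTm T t) (ofTm T u)).and (pull (instHom t) p)).le (pull (instHom u) p) :=
  le_of_repr Repr.id.p2 (by
    rintro z _ ⟨a, ha, _, ⟨b, hb, c, hc, rfl⟩, rfl⟩
    erw [TCA.p2_pr]
    refine ⟨b, ?_, c, hc, rfl⟩
    rw [instHom_apply] at hb ⊢
    rwa [← ha.2])

/-- Extensionality holds since morphisms are functions. -/
theorem ext_valid {Γ : Ctx} {σ τ : FTy} (t u : Tm Γ (FTy.arr σ τ)) :
    (ofFm T (Fm.imp (.all σ (.eq (.app (t.subst (Subst.wk Γ σ)) Tm.v0)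
      (.app (u.subst (Subst.wk Γ σ)) Tm.v0))) (.eq t u))).Valid := by
  refine le_imp_iff.2 ((and_le_left _ _).trans (le_of_repr Repr.id.p1 fun z k hk => ⟨hk.1, ?_⟩))
  refine Subtype.ext (funext fun y => ?_)
  obtain ⟨a, ha⟩ := (ofTy T σ).nonempty y
  have h := (hk.2 (z, y) rfl (pr (p1 k) a) ⟨by simpa using hk.1, by simpa using ha⟩).2
  change (ofTm T (t.subst (Subst.wk Γ σ)) (z, y)).1 y =
    (ofTm T (u.subst (Subst.wk Γ σ)) (z, y)).1 y at h
  have key (w : Tm Γ (FTy.arr σ τ)) : ofTm T (w.subst (Subst.wk Γ σ)) (z, y) = ofTm T w z :=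
    (ofTm_subst _ w _).trans (congrArg _ (ofSubst_wk Γ σ (z, y)))
  exact (congrArg (fun f => f.1 y) (key t)).symm.trans (h.trans (congrArg (fun f => f.1 y) (key u)))

theorem succ_ne_zero_valid (c : T.El T.bot) {Γ : Ctx} (t : Tm Γ FTy.nat) :
    (ofFm T (Fm.neg (.eq (.app .succ t) .zero))).Valid := by
  refine le_imp_iff.2 ((and_le_left _ _).trans ?_)
  exact le_of_repr (Repr.const c) fun x a ha => (Nat.succ_ne_zero _ ha.2).elim

theorem succ_inj_valid {Γ : Ctx} (t u : Tm Γ FTy.nat) :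
    (ofFm T (Fm.imp (.eq (.app .succ t) (.app .succ u)) (.eq t u))).Valid :=
  le_imp_iff.2 ((and_le_left _ _).trans
    (le_of_repr Repr.id fun _ _ ha => ⟨ha.1, Nat.succ_injective ha.2⟩))

/-- Induction is realized by recursion. -/
theorem induction_valid {Γ : Ctx} (φ : Fm (FTy.nat :: Γ)) :
    (ofFm T (Fm.imp (φ.inst .zero) (Fm.imp
        (.all FTy.nat (.imp φ (φ.subst (Subst.cons (Subst.wk Γ FTy.nat) (.app .succ Tm.v0)))))
        (.all FTy.nat φ)))).Valid := by
  obtain ⟨F, hF, h⟩ := (ofFm_inst (T := T) φ .zero).1.exists_repr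
  obtain ⟨G, hG, h'⟩ := (ofFm_subst (T := T) φ
    (Subst.cons (Subst.wk Γ FTy.nat) (.app .succ Tm.v0))).1.exists_repr
  refine le_imp_iff.2 (le_imp_iff.2 (le_forallAlong_iff.2 ?_))
  let A := (ofFm T φ).ty
  let C := (ofCtx T Γ).ty
  let I := T.prod C T.nat
  -- the type of evidence for the induction step, and that of the whole state
  let B := T.prod C (T.arr I (T.prod I (T.arr A
    (ofFm T (φ.subst (Subst.cons (Subst.wk Γ FTy.nat) (.app .succ Tm.v0)))).ty)))
  let S := T.prod (T.prod B (T.prod (ofFm T (φ.inst .zero)).ty C)) I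
  obtain ⟨H, hH, e⟩ := Repr.natRec (S := S) (U := A) (hF.comp Repr.id.p1.p2.p1).p1
    (hG.comp ((Repr.id.p1.p1.p1.p1.p2.app (Repr.id.p1.p1.p1.p1.p1.pr Repr.id.p1.p2)).p2.app
      Repr.id.p2)).p1 Repr.id.p2.p2
  simp only [TCA.p1_pr, TCA.p2_pr] at e
  refine pull_le_of_repr hH ?_
  rintro ⟨z, n⟩ _ ⟨b, hb, _, ⟨a, ha, c, hc, rfl⟩, rfl⟩ m hm
  have hm2 : p2 (m : T.El I) = T.numeral n := hm.2
  erw [e _ n (by erw [TCA.p2_pr]; exact hm2), TCA.p1_pr, TCA.p2_pr, TCA.p1_pr, TCA.p1_pr]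
  replace ha : a ∈ (ofFm T (φ.inst .zero)).real z := ha
  replace hb : b ∈ (ofFm T (.all FTy.nat _)).real z := hb
  clear hm hm2 hc
  induction n with
  | zero =>
    obtain ⟨w, hw, v, -, ew⟩ := h z a ha
    rw [instHom_apply] at hw
    erw [← ew, TCA.p1_pr]
    exact hw
  | succ n ih =>
    have h1 := (hb.2 (z, n) rfl (pr (p1 b) (T.numeral n)) ⟨by
      erw [TCA.p1_pr]; exact hb.1, TCA.p2_pr _ _⟩).2 _ ih
    obtain ⟨w, hw, v, -, ew⟩ := h' _ _ h1
    have hz : ofSubst T (Subst.cons (Subst.wk Γ FTy.nat) (.app .succ Tm.v0)) (z, n) =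
      (z, n + 1) := Prod.ext (ofSubst_wk Γ FTy.nat (z, n)) rfl
    have h2 : p1 (pr w v) ∈ (ofFm T φ).real (z, n + 1) := by
      rw [TCA.p1_pr]
      exact hz ▸ hw
    rw [ew] at h2
    exact h2

/-- Every theorem of the arithmetic holds in the assemblies, if the added axioms do. -/
theorem sound (c : T.El T.bot) {Ax : Theory}
    (hAx : ∀ (Γ : Ctx) (φ : Fm Γ), φ ∈ Ax Γ → (ofFm T φ).Valid) {Γ : Ctx} {L : List (Fm Γ)}
    {φ : Fm Γ} (h : Prov Ax L φ) : (ofHyps T L).le (ofFm T φ) := by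
  induction h with
  | ax h => exact (hAx _ _ h).le _
  | hyp h => exact ofHyps_le h
  | botE _ ih => exact ih.trans (bot_le _)
  | andI _ _ ih ih' => exact le_and ih ih'
  | andE1 _ ih => exact ih.trans (and_le_left _ _)
  | andE2 _ ih => exact ih.trans (and_le_right _ _)
  | orI1 _ ih => exact ih.trans (le_or_left _ _)
  | orI2 _ ih => exact ih.trans (le_or_right _ _)
  | orE _ _ _ ih ih1 ih2 =>
    have := or_le (le_imp_iff.2 (le_and (and_le_right _ _) (and_le_left _ _)) |>.trans
      (imp_mono (Pred.le.refl _) ih1)) (le_imp_iff.2 (le_and (and_le_right _ _) (and_le_left _ _))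
        |>.trans (imp_mono (Pred.le.refl _) ih2))
    exact (le_and (Pred.le.refl _) (ih.trans this)).trans (imp_and_le _ _)
  | impI _ ih => exact le_imp_iff.2 ih
  | impE _ _ ih ih' => exact (le_and ih' ih).trans (imp_and_le _ _)
  | allI _ ih => exact le_forallAlong_iff.2 ((pull_ofHyps_le _ _).trans ih)
  | @allE Γ L σ φ t _ ih =>
    refine ih.trans (Pred.le.trans ?_ (ofFm_inst φ t).2)
    exact (le_pull_instHom_pull_fst t _).trans (pull_mono _ (pull_forallAlong_le _ _))
  | @exI Γ L σ φ t _ ih =>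
    refine ih.trans ((ofFm_inst φ t).1.trans ?_)
    exact (pull_mono _ (le_pull_existsAlong _ _)).trans (pull_instHom_pull_fst_le t _)
  | @exE Γ L σ φ ψ _ _ ih ih' =>
    have h : (existsAlong (fst _ (ofTy T σ)) (ofFm T φ)).le ((ofHyps T L).imp (ofFm T ψ)) := by
      refine existsAlong_le_iff.2 (Pred.le.trans (le_imp_iff.2 ?_) (le_pull_imp _ _ _))
      refine (le_and (and_le_right _ _) ((and_le_left _ _).trans (pull_ofHyps_le σ L))).trans ?_
      exact ih'.trans (ofFm_wk σ ψ).1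
    exact (le_and (Pred.le.refl _) (ih.trans h)).trans (imp_and_le _ _)
  | @eqE Γ L σ t u φ _ _ ih ih' =>
    exact (le_and ih (ih'.trans (ofFm_inst φ t).1)).trans ((eq_and_pull_le t u _).trans
      (ofFm_inst φ u).2)
  | ext t u => exact (ext_valid t u).le _
  | succ_ne_zero t => exact (succ_ne_zero_valid c t).le _
  | succ_inj t u => exact (succ_inj_valid t u).le _
  | induction φ => exact (induction_valid φ).le _
  | _ => exact (eq_valid fun _ => rfl).le _

theorem models_of_prov (c : T.El T.bot) {Ax : Theory}
    (hAx : ∀ (Γ : Ctx) (φ : Fm Γ), φ ∈ Ax Γ → (ofFm T φ).Valid) {φ : Fm []}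
    (h : Prov Ax [] φ) : Models T φ :=
  sound c hAx h

end Assembly

/-! ### Extensional typed combinatory algebras -/

/-- A tca whose elements of the finite types behave set-theoretically: application is extensional,
pairing is surjective, the unit type is a singleton and the number type consists of the (distinct)
numerals; moreover, the type `bot` is inhabited. -/
structure TCA.Extensional (T : TCA) : Prop where
  consistent : T.Consistent
  bot : Nonempty (T.El T.bot)
  top : ∀ x : T.El T.top, x = T.tt
  nat : ∀ x : T.El T.nat, ∃ n, x = T.numeral n
  prod : ∀ {A B} (x y : T.El (T.prod A B)), p1 x = p1 y → p2 x = p2 y → x = y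
  arr : ∀ {A B} (x y : T.El (T.arr A B)), (∀ a, T.app x a = T.app y a) → x = y

namespace Assembly

open ConvExt.Pred

variable {T : TCA}

theorem prod_basic (hT : T.Extensional) {X Y : Assembly T} (hX : X.Basic) (hY : Y.Basic) :
    (prod X Y).Basic := by
  refine ⟨fun a => ?_, fun x y a ha hb => ?_, fun x a ha b hb => ?_⟩
  · obtain ⟨x, hx⟩ := hX.1 (p1 a)
    obtain ⟨y, hy⟩ := hY.1 (p2 a)
    exact ⟨(x, y), hx, hy⟩
  · exact Prod.ext (hX.2.1 _ _ _ ha.1 hb.1) (hY.2.1 _ _ _ ha.2 hb.2)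
  · exact hT.prod _ _ (hX.2.2 _ _ ha.1 _ hb.1) (hY.2.2 _ _ ha.2 _ hb.2)

theorem exp_basic (hT : T.Extensional) {X Y : Assembly T} (hX : X.Basic) (hY : Y.Basic) :
    (exp X Y).Basic := by
  refine ⟨fun e => ?_, fun f g e hf hg => ?_, fun f e he e' he' => ?_⟩
  · have h : ∀ x, ∃ y, ∀ a ∈ X.real x, T.app e a ∈ Y.real y := fun x => by
      obtain ⟨a, ha⟩ := X.nonempty x
      obtain ⟨y, hy⟩ := hY.1 (T.app e a)
      exact ⟨y, fun b hb => hX.2.2 x a ha b hb ▸ hy⟩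
    choose f hf using h
    exact ⟨⟨f, e, hf⟩, hf⟩
  · refine Subtype.ext (funext fun x => ?_)
    obtain ⟨a, ha⟩ := X.nonempty x
    exact hY.2.1 _ _ _ (hf x a ha) (hg x a ha)
  · refine hT.arr _ _ fun a => ?_
    obtain ⟨x, hx⟩ := hX.1 a
    exact hY.2.2 _ _ (he x a hx) _ (he' x a hx)

theorem nno_basic (hT : T.Extensional) : (nno T).Basic := by
  refine ⟨fun a => hT.nat a, fun m n a ha hb => ?_, fun x a ha b hb => ?_⟩
  · exact hT.consistent.numeral_inj (ha.symm.trans hb)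
  · exact ha.trans hb.symm

/-- Over an extensional tca the finite types are interpreted by basic assemblies. -/
theorem ofTy_basic (hT : T.Extensional) (σ : FTy) : (ofTy T σ).Basic := by
  induction σ with
  | unit =>
    exact ⟨fun a => ⟨(), hT.top a⟩, fun _ _ _ _ _ => rfl, fun _ a ha b hb => ha.trans hb.symm⟩
  | nat => exact nno_basic hT
  | prod σ τ ih ih' => exact prod_basic hT ih ih'
  | arr σ τ ih ih' => exact exp_basic hT ih ih'

/-- Since `bot` is inhabited, the hypothesis of the premise can be applied whether or not the
negated formula holds; since `Y` is exhaustive, the outcome always determines an element of `Y`. -/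
theorem ipFor (c : T.El T.bot) {Y : Assembly T} (hY : Y.Modest) (hY' : Y.Exhaustive) :
    IPFor T Y := by
  intro X p q
  obtain ⟨Q, hQ, h⟩ := q.exists_proj
  obtain ⟨d, -⟩ := Repr.const (S := p.ty) c
  let K := T.prod X.ty (T.arr (T.prod X.ty (T.arr p.ty T.bot)) q.ty)
  -- the outcome of the hypothesis
  let V : T.El K → T.El q.ty := fun k => T.app (p2 k) (pr (p1 k) d)
  have hV : Repr V := Repr.id.p2.app (Repr.id.p1.pr (Repr.const d))
  obtain ⟨G, hG, e⟩ := (hV.comp Repr.id.p1).curry (S := K)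
    (U := T.prod (T.prod X.ty (T.arr p.ty T.bot)) (T.prod X.ty Y.ty))
  refine le_imp_iff.2 ((and_le_left _ _).trans
    (le_of_repr ((Repr.id.p1.pr (hQ.comp hV).p2).pr hG) fun x k hk => ?_))
  obtain ⟨y, hy⟩ := hY' (p2 (Q (V k)))
  refine ⟨(x, y), rfl, ⟨by erw [TCA.p1_pr, TCA.p1_pr]; exact hk.1,
    by erw [TCA.p1_pr, TCA.p2_pr]; exact hy⟩, ?_⟩
  rintro _ ⟨n, hn, m, -, rfl⟩
  erw [TCA.p2_pr, e, TCA.p1_pr]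
  have hp : pr (p1 k) d ∈ p.neg.real x :=
    ⟨by erw [TCA.p1_pr]; exact hk.1, fun b hb => (hn.2 b hb).elim⟩
  obtain ⟨⟨x', y'⟩, ex, hq⟩ := hk.2 _ hp
  obtain rfl : x' = x := ex
  rwa [hY y y' _ hy (h _ _ hq).2]

theorem ip (hT : T.Extensional) : IP T := by
  obtain ⟨c⟩ := hT.bot
  exact ⟨fun _ h h' => ipFor c h h', fun σ => ipFor c (ofTy_basic hT σ).2.1 (ofTy_basic hT σ).1⟩

/-- Points of `X` have a single realizer, so a realizer of the premise selects a function. -/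
theorem acFor {X Y : Assembly T} (hX : X.StronglyModest) : ACFor T X Y := by
  intro Z p
  obtain ⟨P, hP, h⟩ := p.exists_proj
  let K := T.prod Z.ty (T.arr (T.prod Z.ty X.ty) p.ty)
  -- the outcome of the premise at a realizer of a point of `X`
  let V : T.El (T.prod K X.ty) → T.El p.ty := fun k => T.app (p2 (p1 k)) (pr (p1 (p1 k)) (p2 k))
  have hV : Repr V := Repr.id.p1.p2.app (Repr.id.p1.p1.pr Repr.id.p2)
  obtain ⟨F, hF, eF⟩ := (hP.comp hV).p2.curry
  obtain ⟨G, hG, eG⟩ := ((hV.comp (Repr.id.p1.pr Repr.id.p2.p2)).pr Repr.id.p2).curry (S := K)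
    (U := T.prod (T.prod Z.ty (T.arr X.ty Y.ty)) X.ty)
  refine le_imp_iff.2 ((and_le_left _ _).trans
    (le_of_repr ((Repr.id.p1.pr hF).pr hG) fun z k hk => ?_))
  have hk2 : ∀ x, ∃ y, ∀ n ∈ X.real x, V (pr k n) ∈ p.real ((z, x), y) := fun x => by
    obtain ⟨n, hn⟩ := X.nonempty x
    obtain ⟨⟨⟨z', x'⟩, y⟩, ex, hy⟩ := hk.2 (z, x) rfl (pr (p1 k) n)
      ⟨by erw [TCA.p1_pr]; exact hk.1, by erw [TCA.p2_pr]; exact hn⟩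
    obtain ⟨rfl, rfl⟩ := Prod.mk.inj ex
    refine ⟨y, fun m hm => ?_⟩
    rw [hX.2 _ _ hm _ hn]
    have eV : ∀ k' : T.El K, V (pr k' n) = T.app (p2 k') (pr (p1 k') n) := fun k' => by
      simp only [V, TCA.p1_pr, TCA.p2_pr]
    exact eV k ▸ hy
  choose f hf using hk2
  have hF' : Tracks (F k) f := fun x n hn => by
    erw [eF]
    exact (h _ _ (hf x n hn)).2
  refine ⟨(z, ⟨f, F k, hF'⟩), rfl, ⟨by erw [TCA.p1_pr, TCA.p1_pr]; exact hk.1,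
    by erw [TCA.p1_pr, TCA.p2_pr]; exact hF'⟩, ?_⟩
  rintro ⟨w, x⟩ rfl n hn
  erw [TCA.p2_pr, eG, TCA.p1_pr, TCA.p2_pr]
  exact ⟨_, hf x _ hn.2, n, hn, rfl⟩

theorem ac (hT : T.Extensional) : AC T :=
  ⟨fun _ _ h _ => acFor h.2, fun σ _ => acFor (ofTy_basic hT σ).2⟩

theorem acFm_valid (hT : T.Extensional) {Γ : Ctx} (σ τ : FTy) (φ : Fm (τ :: σ :: Γ)) :
    (ofFm T (ACFm σ τ φ)).Valid := by
  refine ((ac hT).2 σ τ (ofCtx T Γ) (ofFm T φ)).trans (imp_mono (Pred.le.refl _)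
    (existsAlong_mono _ (forallAlong_mono _ ?_)))
  refine (pull_congr (fun z => ?_) _).trans (ofFm_subst φ (acSubst Γ σ τ)).2
  refine Prod.ext (Prod.ext ?_ rfl) rfl
  refine (ofCtx_ext fun ρ v => ?_).symm
  exact ofVar_ofSubst (Δ := σ :: FTy.arr σ τ :: Γ) (fun _ v => Tm.var (.vs (.vs v))) v z

end Assembly

/-! ### Converse extensionality and Markov's principle in terms of realizers -/

namespace Pred

variable {T : TCA} {X Y : Assembly T}

/-- A predicate holds uniformly at the points of `A`. -/
def ValidOn (p : Pred X) (A : Set X.carrier) : Prop :=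
  ∃ F : T.El X.ty → T.El p.ty, Repr F ∧ ∀ x ∈ A, ∀ a ∈ X.real x, F a ∈ p.real x

theorem ValidOn.valid {p : Pred X} (h : p.ValidOn Set.univ) : p.Valid := by
  obtain ⟨F, hF, h⟩ := h
  exact le_of_repr hF fun x a ha => h x trivial a ha

theorem validOn_existsAlong {f : Hom Y X} {p : Pred Y} {A : Set X.carrier} (s : Hom X Y)
    (hs : ∀ x, f (s x) = x) (h : p.ValidOn {y | ∃ x ∈ A, s x = y}) :
    (existsAlong f p).ValidOn A := by
  obtain ⟨F, hF, h⟩ := h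
  obtain ⟨S, hS, h'⟩ := s.exists_repr
  exact ⟨_, hF.comp hS, fun x hx a ha => ⟨s x, hs x, h _ ⟨x, hx, rfl⟩ _ (h' x a ha)⟩⟩

theorem validOn_forallAlong {f : Hom Y X} {p : Pred Y} {A : Set X.carrier}
    (h : p.ValidOn {y | f y ∈ A}) : (forallAlong f p).ValidOn A := by
  obtain ⟨F, ⟨e, he⟩, h⟩ := h
  refine ⟨_, Repr.id.pr (Repr.const e), fun x hx a ha => ⟨by erw [TCA.p1_pr]; exact ha, ?_⟩⟩
  rintro y rfl n hn
  erw [TCA.p2_pr, he]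
  exact h y hx n hn

theorem validOn_imp {p q : Pred X} {A : Set X.carrier}
    (h : q.ValidOn {x | x ∈ A ∧ (p.real x).Nonempty}) : (p.imp q).ValidOn A := by
  obtain ⟨F, hF, h⟩ := h
  obtain ⟨P, hP, h'⟩ := p.exists_proj
  obtain ⟨g, hg⟩ := hF.comp hP
  refine ⟨_, Repr.id.pr (Repr.const g), fun x hx a ha => ⟨by erw [TCA.p1_pr]; exact ha, ?_⟩⟩
  intro n hn
  erw [TCA.p2_pr, hg]
  exact h x ⟨hx, n, hn⟩ _ (h' x n hn)

theorem validOn_neg (c : T.El T.bot) {p : Pred X} {A : Set X.carrier}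
    (h : ∀ x ∈ A, ¬ (p.real x).Nonempty) : p.neg.ValidOn A :=
  validOn_imp ⟨_, Repr.const c, fun x hx => (h x hx.1 hx.2).elim⟩

theorem not_nonempty_of_neg {p : Pred X} {x : X.carrier} (h : (p.neg.real x).Nonempty) :
    ¬ (p.real x).Nonempty := by
  rintro ⟨a, ha⟩
  obtain ⟨n, hn⟩ := h
  exact hn.2 a ha

/-- A single realizer serves for all negations that hold. -/
theorem mem_neg (c : T.El T.bot) {p : Pred X} : ∃ d : T.El (T.arr p.ty T.bot),
    ∀ x, ¬ (p.real x).Nonempty → ∀ a ∈ X.real x, pr a d ∈ p.neg.real x := by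
  obtain ⟨d, -⟩ := Repr.const (S := p.ty) c
  exact ⟨d, fun x h a ha => ⟨by erw [TCA.p1_pr]; exact ha, fun n hn => (h ⟨n, hn⟩).elim⟩⟩

theorem eq_real_nonempty {f g : Hom X Y} {x : X.carrier} :
    ((Pred.eq f g).real x).Nonempty ↔ f x = g x :=
  ⟨fun ⟨_, h⟩ => h.2, fun h => (X.nonempty x).imp fun _ ha => ⟨ha, h⟩⟩

end Pred

namespace Assembly

open ConvExt.Pred

variable {T : TCA}

/-- Converse extensionality holds, in any context, as soon as some morphism has the required
property. -/
theorem ce_valid (c : T.El T.bot) {n : ℕ} (x : (ofTy T (FTy.arr (FTy.pure (n + 2))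
      (FTy.arr (FTy.pure (n + 1)) (FTy.arr (FTy.pure (n + 1)) (FTy.pure n))))).carrier)
    (hx : ∀ (Φ : Hom (ofTy T (FTy.pure (n + 1))) (nno T)) (f g : Hom (ofTy T (FTy.pure n)) (nno T)),
      Φ f ≠ Φ g → f (((x.1 Φ).1 f).1 g) ≠ g (((x.1 Φ).1 f).1 g)) {Γ : Ctx} :
    (ofFm T (CE n : Fm Γ)).Valid := by
  obtain ⟨e, he⟩ := (ofTy T (FTy.arr (FTy.pure (n + 2))
      (FTy.arr (FTy.pure (n + 1)) (FTy.arr (FTy.pure (n + 1)) (FTy.pure n))))).nonempty x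
  refine ValidOn.valid (validOn_existsAlong (.ofRepr (fun z => (z, x)) ⟨_,
    Repr.id.pr (Repr.const e), fun z a ha => ⟨by erw [TCA.p1_pr]; exact ha,
      by erw [TCA.p2_pr]; exact he⟩⟩) (fun _ => rfl) ?_)
  refine validOn_forallAlong (validOn_forallAlong (validOn_forallAlong (validOn_imp
    (validOn_neg c ?_))))
  rintro ⟨⟨⟨⟨z, x'⟩, Φ⟩, f⟩, g⟩ ⟨⟨z', -, h⟩, h'⟩ h''
  obtain ⟨rfl, rfl⟩ := Prod.mk.inj h
  refine hx Φ f g (fun h => not_nonempty_of_neg h' (eq_real_nonempty.2 h)) ?_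
  obtain ⟨_, h''⟩ := h''
  exact h''.2

/-- Converse extensionality, in terms of realizers. -/
theorem ce_valid_of_realizer (hT : T.Extensional) {n : ℕ}
    (e : T.El (ofTy T (FTy.arr (FTy.pure (n + 2))
      (FTy.arr (FTy.pure (n + 1)) (FTy.arr (FTy.pure (n + 1)) (FTy.pure n))))).ty)
    (he : ∀ (Φ : T.El (ofTy T (FTy.pure (n + 2))).ty) (f g : T.El (ofTy T (FTy.pure (n + 1))).ty),
      T.app (U := T.nat) Φ f ≠ T.app (U := T.nat) Φ g →
      T.app (U := T.nat) f (T.app (T.app (T.app e Φ) f) g) ≠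
        T.app (U := T.nat) g (T.app (T.app (T.app e Φ) f) g)) {Γ : Ctx} :
    (ofFm T (CE n : Fm Γ)).Valid := by
  obtain ⟨c⟩ := hT.bot
  obtain ⟨x, hx⟩ := (ofTy_basic hT (FTy.arr (FTy.pure (n + 2))
      (FTy.arr (FTy.pure (n + 1)) (FTy.arr (FTy.pure (n + 1)) (FTy.pure n))))).1 e
  refine ce_valid c x fun Φ f g h h' => ?_
  obtain ⟨φ, hφ⟩ := Φ.2
  obtain ⟨a, ha⟩ := f.2
  obtain ⟨b, hb⟩ := g.2
  have hy := hx Φ φ hφ f a ha g b hb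
  refine he φ a b (fun h2 => h ?_) ?_
  · exact hT.consistent.numeral_inj ((hφ f a ha).symm.trans (h2.trans (hφ g b hb)))
  · exact (ha _ _ hy).trans ((congrArg T.numeral h').trans (hb _ _ hy).symm)

/-- Markov's principle provides a total operation that finds a zero of any function having one. -/
theorem exists_search_of_mp (c : T.El T.bot) {n : ℕ} (h : Models T (MP n)) :
    ∃ M : T.El (T.arr (ofTy T (FTy.pure n)).ty T.nat) → T.El (ofTy T (FTy.pure n)).ty, Repr M ∧
      ∀ (f : Hom (ofTy T (FTy.pure n)) (nno T)) e, Tracks e f.1 → (∃ x, f x = 0) →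
        ∃ x, f x = 0 ∧ M e ∈ (ofTy T (FTy.pure n)).real x := by
  obtain ⟨k, hk⟩ := h
  let A := ofTy T (FTy.pure n)
  let X := prod (one T) (exp A (nno T))
  let q : Pred X := existsAlong (fst X A) (Pred.eq (eval ((snd (one T) _).comp (fst X A)) (snd X A))
    (zero _))
  obtain ⟨d, hd⟩ := mem_neg c (p := q.neg)
  let k' : T.El (T.prod T.top (T.arr X.ty (T.prod X.ty (T.arr q.neg.neg.ty q.ty)))) :=
    T.app k T.tt
  refine ⟨fun e => p2 (S := X.ty) (U := A.ty) (T.app (p2 (T.app (p2 k') (pr T.tt e)))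
    (pr (pr T.tt e) d)), ?_, fun f e he hf => ?_⟩
  · have h1 : Repr (fun e : T.El (T.arr A.ty T.nat) => (pr T.tt e : T.El X.ty)) :=
      (Repr.const T.tt).pr Repr.id
    have h2 := (Repr.capp (p2 k') h1).p2.app (h1.pr (Repr.const d))
    exact Repr.p2 (U := X.ty) (V := A.ty) h2
  · have hX : pr T.tt e ∈ X.real ((), f) :=
      ⟨by erw [TCA.p1_pr]; rfl, by erw [TCA.p2_pr]; exact he⟩
    have hq : (q.real ((), f)).Nonempty := by
      obtain ⟨x, hx⟩ := hf
      obtain ⟨a, ha⟩ := (prod X A).nonempty (((), f), x)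
      exact ⟨a, (((), f), x), rfl, ha, hx⟩
    obtain ⟨⟨⟨z, f'⟩, x⟩, ex, hw, hx⟩ := ((hk () T.tt rfl).2 ((), f) rfl _ hX).2 _
      (hd _ (fun h => not_nonempty_of_neg h hq) _ hX)
    obtain ⟨rfl, rfl⟩ := Prod.mk.inj ex
    exact ⟨x, hx, hw.2⟩

end Assembly

/-! ### Conditionals and bounded search -/

namespace TCA

variable {T : TCA}

/-- The conditional: `G (0, x) = x` and `G (n + 1, x) = 0`. -/
theorem exists_guard : ∃ G : T.El (T.prod T.nat T.nat) → T.El T.nat,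
    Repr G ∧ (∀ x, G (pr (T.numeral 0) x) = x) ∧
      ∀ n x, G (pr (T.numeral (n + 1)) x) = T.numeral 0 := by
  obtain ⟨G, hG, h⟩ := Repr.natRec (S := T.prod T.nat T.nat) Repr.id.p2 (Repr.const (T.numeral 0))
    Repr.id.p1
  exact ⟨G, hG, fun x => by rw [h _ 0 (by simp)]; simp, fun n x => by rw [h _ (n + 1) (by simp)]⟩

/-- The conditional with two branches. -/
theorem Repr.cond {S U : T.Ty} {N : T.El S → T.El T.nat} {F G : T.El S → T.El U}
    (hN : Repr N) (hF : Repr F) (hG : Repr G) : ∃ H : T.El S → T.El U, Repr H ∧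
      (∀ x, N x = T.numeral 0 → H x = F x) ∧ ∀ x n, N x = T.numeral (n + 1) → H x = G x := by
  obtain ⟨H, hH, h⟩ := Repr.natRec hF (hG.comp Repr.id.p1.p1) hN
  exact ⟨H, hH, fun x hx => h x 0 hx, fun x n hx => by rw [h x (n + 1) hx]; simp⟩

/-- Search below a represented bound yields the least zero. -/
theorem exists_least {S : T.Ty} {D : T.El (T.prod S T.nat) → T.El T.nat} (hD : Repr D)
    {b : T.El S → T.El T.nat} (hb : Repr b) : ∃ F : T.El S → T.El T.nat, Repr F ∧
      ∀ (a : T.El S) (d : ℕ → ℕ) (m : ℕ), (∀ n, D (pr a (T.numeral n)) = T.numeral (d n)) →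
        b a = T.numeral m → d m = 0 →
        ∃ n, F a = T.numeral n ∧ d n = 0 ∧ ∀ i < n, d i ≠ 0 := by
  -- one step keeps the current candidate if it is a zero, and passes to the next number otherwise
  obtain ⟨H, hH, h0, h1⟩ := Repr.cond (S := T.prod (T.prod S T.nat) T.nat)
    (hD.comp (Repr.id.p1.p1.pr Repr.id.p2)) Repr.id.p2 (Repr.capp T.succ Repr.id.p1.p2)
  obtain ⟨F, hF, h⟩ := Repr.natRec (Repr.const (T.numeral 0)) hH hb
  refine ⟨F, hF, fun a d m hd hm hz => ?_⟩
  have key : ∀ k, ∃ n ≤ k, (Nat.rec (T.numeral 0) (fun i v => H (pr (pr a (T.numeral i)) v)) k :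
      T.El T.nat) = T.numeral n ∧ (d n = 0 ∨ n = k) ∧ ∀ i < n, d i ≠ 0 := by
    intro k
    induction k with
    | zero => exact ⟨0, le_rfl, rfl, Or.inr rfl, fun i hi => by omega⟩
    | succ k ih =>
      obtain ⟨n, hn, e, hn', hi⟩ := ih
      simp only [e]
      by_cases hdn : d n = 0
      · rw [h0 _ (by simp [hd, hdn])]
        exact ⟨n, by omega, by simp, Or.inl hdn, hi⟩
      · obtain rfl : n = k := hn'.resolve_left hdn
        obtain ⟨j, hj⟩ := Nat.exists_eq_succ_of_ne_zero hdn
        rw [h1 _ j (by simp [hd, hj])]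
        refine ⟨n + 1, le_rfl, by simp only [TCA.p1_pr, TCA.p2_pr]; rfl, Or.inr rfl,
          fun i hi' => ?_⟩
        rcases Nat.lt_succ_iff_lt_or_eq.1 hi' with h | rfl
        · exact hi i h
        · exact hdn
  obtain ⟨n, -, e, hn, hi⟩ := key m
  refine ⟨n, by rw [h a m hm, e], ?_, hi⟩
  rcases hn with hn | rfl
  · exact hn
  · exact hz

end TCA

/-! ### The tca of apartness types is extensional -/

namespace ApType

variable {T : TCA}

theorem cls_eq {A : ApType T} {a b : T.El A.pos} {ha : a ∈ A.carrier} {hb : b ∈ A.carrier}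
    (h : ∀ n, ¬ A.apart a b n) : cls a ha = cls b hb :=
  Quotient.sound (s := A.setoid) h

theorem cls_eq_iff {A : ApType T} {a b : T.El A.pos} {ha : a ∈ A.carrier} {hb : b ∈ A.carrier} :
    cls a ha = cls b hb ↔ ∀ n, ¬ A.apart a b n :=
  ⟨fun h => Quotient.exact (s := A.setoid) h, cls_eq⟩

theorem exists_cls {A : ApType T} (x : A.El) : ∃ a ha, x = cls (A := A) a ha :=
  Quotient.inductionOn x fun a => ⟨a.1, a.2, rfl⟩

theorem numeral_eq_cls (hT : T.Consistent) (n : ℕ) :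
    (ApTypes T hT).numeral n = cls (A := nat hT) (T.numeral n) ⟨n, rfl⟩ := by
  induction n with
  | zero => rfl
  | succ n ih =>
    change app (ofMor _ (IsMor.succ hT)) ((ApTypes T hT).numeral n) = _
    rw [ih]
    exact app_ofMor (IsMor.succ hT) _ _

theorem cls_numeral_inj (hT : T.Consistent) {m n : ℕ}
    (h : cls (A := nat hT) (T.numeral m) ⟨m, rfl⟩ = cls (A := nat hT) (T.numeral n) ⟨n, rfl⟩) :
    m = n := by
  by_contra hne
  exact cls_eq_iff.1 h T.zero ⟨⟨m, rfl⟩, ⟨n, rfl⟩, fun e => hne (hT.numeral_inj e)⟩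

/-- Two classes of numbers agree exactly when their representatives do. -/
theorem cls_nat_eq_iff (hT : T.Consistent) {a b : T.El T.nat} {ha : a ∈ (nat hT).carrier}
    {hb : b ∈ (nat hT).carrier} : cls (A := nat hT) a ha = cls (A := nat hT) b hb ↔ a = b := by
  constructor
  · intro h
    by_contra hne
    exact cls_eq_iff.1 h T.zero ⟨ha, hb, hne⟩
  · rintro rfl
    rfl

theorem extensional (hT : T.Consistent) : (ApTypes T hT).Extensional where
  consistent h := by
    have h' := (numeral_eq_cls hT 0).symm.trans (h.trans (numeral_eq_cls hT 1))
    exact absurd (cls_numeral_inj hT h') (by decide)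
  bot := ⟨cls (A := one T) T.tt rfl⟩
  top x := by
    obtain ⟨a, ha, rfl⟩ := exists_cls (A := one T) x
    obtain rfl : a = T.tt := ha
    rfl
  nat x := by
    obtain ⟨_, ⟨n, rfl⟩, rfl⟩ := exists_cls (A := nat hT) x
    exact ⟨n, (numeral_eq_cls hT n).symm⟩
  prod {A B} x y h1 h2 := by
    obtain ⟨a, ha, rfl⟩ := exists_cls (A := prod A B) x
    obtain ⟨b, hb, rfl⟩ := exists_cls (A := prod A B) y
    have h1' := (app_ofMor IsMor.fst a ha).symm.trans (h1.trans (app_ofMor IsMor.fst b hb))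
    have h2' := (app_ofMor IsMor.snd a ha).symm.trans (h2.trans (app_ofMor IsMor.snd b hb))
    refine cls_eq fun n => ?_
    rintro ⟨-, -, ⟨m, -, hm⟩ | ⟨m, -, hm⟩⟩
    · exact cls_eq_iff.1 h1' m hm
    · exact cls_eq_iff.1 h2' m hm
  arr {A B} x y h := by
    obtain ⟨f, hf, rfl⟩ := exists_cls (A := arr A B) x
    obtain ⟨g, hg, rfl⟩ := exists_cls (A := arr A B) y
    exact cls_eq fun n ⟨_, _, hn, hn'⟩ => cls_eq_iff.1 (h (cls (A := A) (p1 n) hn)) _ hn'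

/-! ### Numerical operations and bounded search -/

/-- Any represented operation on the numbers is a morphism, as anything is evidence that distinct
numbers are apart. -/
theorem isMor_of_nat (hT : T.Consistent) {B : ApType T} {F : T.El T.nat → T.El B.pos} (hF : Repr F)
    (h : ∀ n : ℕ, F (T.numeral n) ∈ B.carrier) : IsMor (nat hT) B F := by
  refine ⟨hF, ?_, _, Repr.const T.zero, fun a ha b hb n hn => ⟨ha, hb, ?_⟩⟩
  · rintro _ ⟨n, rfl⟩
    exact h n
  · rintro rfl
    exact B.irrefl _ _ hn

/-- Represented operations on two numbers are morphisms. -/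
theorem isMor_of_nat_nat (hT : T.Consistent) {B : ApType T}
    {F : T.El (T.prod T.nat T.nat) → T.El B.pos} (hF : Repr F)
    (h : ∀ m n : ℕ, ∀ x, p1 x = T.numeral m → p2 x = T.numeral n → F x ∈ B.carrier)
    (h' : ∀ x y, p1 x = p1 y → p2 x = p2 y → F x = F y) :
    IsMor (prod (nat hT) (nat hT)) B F := by
  obtain ⟨E, hE, hE'⟩ := T.exists_natEq
  obtain ⟨H, hH, h0, h1⟩ := Repr.cond
    (S := T.prod (T.prod (T.prod T.nat T.nat) (T.prod T.nat T.nat)) B.neg)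
    (hE.comp (Repr.id.p1.p1.p1.pr Repr.id.p1.p2.p1))
    ((Repr.const T.zero).il (V := T.nat)) ((Repr.const T.zero).ir (V := T.nat))
  refine ⟨hF, ?_, H, hH, ?_⟩
  · rintro x ⟨⟨m, hm⟩, n, hn⟩
    exact h m n x hm.symm hn.symm
  · rintro x ⟨⟨m, hm⟩, n, hn⟩ y ⟨⟨m', hm'⟩, n', hn'⟩ k hk
    refine ⟨⟨⟨m, hm⟩, n, hn⟩, ⟨⟨m', hm'⟩, n', hn'⟩, ?_⟩
    by_cases e : m = m'
    · subst e
      rw [h1 _ 0 (by simp only [TCA.p1_pr, TCA.p2_pr, ← hm, ← hm', hE', if_pos])]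
      refine Or.inr ⟨_, rfl, ⟨n, hn⟩, ⟨n', hn'⟩, fun e => ?_⟩
      rw [h' x y (hm.symm.trans hm') e] at hk
      exact B.irrefl _ _ hk
    · rw [h0 _ (by simp only [TCA.p1_pr, TCA.p2_pr, ← hm, ← hm', hE', if_neg e])]
      exact Or.inl ⟨_, rfl, ⟨m, hm⟩, ⟨m', hm'⟩, fun e' => e (hT.numeral_inj (by rw [hm, hm', e']))⟩

/-- Bounded search for the least zero of an extensional test is extensional, even if the bound is
not: when the least zeros for two arguments differ, the test at one of these zeros tells the
arguments apart. -/
theorem isMor_search (hT : T.Consistent) {A : ApType T}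
    {D : T.El (prod A (nat hT)).pos → T.El T.nat}
    (hD : IsMor (prod A (nat hT)) (nat hT) D) {b : T.El A.pos → T.El T.nat} (hb : Repr b)
    (h : ∀ a ∈ A.carrier, ∃ m, b a = T.numeral m ∧ D (pr a (T.numeral m)) = T.numeral 0) :
    ∃ F, IsMor A (nat hT) F ∧ ∀ a ∈ A.carrier, ∃ n, F a = T.numeral n ∧
      D (pr a (T.numeral n)) = T.numeral 0 := by
  obtain ⟨F, hF, hF'⟩ := TCA.exists_least hD.1 hb
  have hmem : ∀ a ∈ A.carrier, ∀ n, pr a (T.numeral n) ∈ (prod A (nat hT)).carrier :=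
    fun a ha n => ⟨by rwa [TCA.p1_pr], by rw [TCA.p2_pr]; exact ⟨n, rfl⟩⟩
  have key : ∀ a ∈ A.carrier, ∃ n, F a = T.numeral n ∧ D (pr a (T.numeral n)) = T.numeral 0 ∧
      ∀ i < n, D (pr a (T.numeral i)) ≠ T.numeral 0 := by
    intro a ha
    have hd : ∀ n, ∃ k, T.numeral k = D (pr a (T.numeral n)) := fun n => hD.2.1 _ (hmem a ha n)
    choose d hd using hd
    obtain ⟨m, hm, hz⟩ := h a ha
    obtain ⟨n, hn, hz', hi⟩ := hF' a d m (fun n => (hd n).symm) hm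
      (hT.numeral_inj ((hd m).trans hz))
    refine ⟨n, hn, by rw [← hd, hz'], fun i hin e => hi i hin (hT.numeral_inj ((hd i).trans e))⟩
  obtain ⟨hD0, hD1, r, hr, hD2⟩ := hD
  obtain ⟨mA⟩ := A.neg_nonempty
  -- the number at which to compare the tests
  obtain ⟨M, hM, M0, M1⟩ := Repr.cond (S := T.prod (T.prod A.pos A.pos) T.nat)
    (hD0.comp (Repr.id.p1.p2.pr (hF.comp Repr.id.p1.p1)))
    (hF.comp Repr.id.p1.p2) (hF.comp Repr.id.p1.p1)
  obtain ⟨dA, hdA, hdA1, -⟩ := Repr.case (S := T.sum A.neg T.nat) Repr.id Repr.id.p2 (Repr.const mA)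
  have hR := hdA.comp (hr.comp (((Repr.id.p1.p1.pr hM).pr (Repr.id.p1.p2.pr hM)).pr Repr.id.p2))
  refine ⟨F, ⟨hF, fun a ha => ?_, _, hR, fun a ha a' ha' n hn => ?_⟩, fun a ha => ?_⟩
  · obtain ⟨n, e, -⟩ := key a ha
    exact ⟨n, e.symm⟩
  · obtain ⟨k, ek, hk, hi⟩ := key a ha
    obtain ⟨k', ek', hk', hi'⟩ := key a' ha'
    have hne : k ≠ k' := fun e => hn.2.2 (by rw [ek, ek', e])
    -- reduce to a number at which the tests differ
    suffices h : ∃ m, M (pr (pr a a') n) = T.numeral m ∧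
        D (pr a (T.numeral m)) ≠ D (pr a' (T.numeral m)) by
      obtain ⟨m, em, hm⟩ := h
      obtain ⟨-, -, ⟨v, e, hv⟩ | ⟨v, e, -, -, hv⟩⟩ := hD2 _ (hmem a ha m) _ (hmem a' ha' m) n
        ⟨hD1 _ (hmem a ha m), hD1 _ (hmem a' ha' m), hm⟩
      · simp only [em, TCA.p1_pr, TCA.p2_pr, e]
        rw [hdA1 _ _ rfl]
        simpa using hv
      · simp at hv
    obtain ⟨j, hj⟩ := hD1 _ (hmem a' ha' k)
    cases j with
    | zero =>
      have hlt : k' < k := lt_of_le_of_ne (not_lt.1 fun hlt => hi' k hlt hj.symm) hne.symm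
      refine ⟨k', by rw [M0 _ (by simpa [ek] using hj.symm)]; simpa using ek', ?_⟩
      rw [hk']
      exact hi k' hlt
    | succ j =>
      refine ⟨k, by rw [M1 _ j (by simpa [ek] using hj.symm)]; simpa using ek, ?_⟩
      rw [hk, ← hj]
      exact fun e => absurd (hT.numeral_inj e) (by omega)
  · obtain ⟨n, e, hn, -⟩ := key a ha
    exact ⟨n, e, hn⟩

end ApType

/-! ### Converse extensionality over apartness types -/

namespace ApType

variable {T : TCA}

/-- Suppose that `q` enumerates elements of `A`, and that `β` turns an element of `A` at which two
functions differ into an index in the enumeration at which they differ. Then converse extensionality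
is realized at `A`: the functional takes the first element of the enumeration at which `f` and `g`
differ, the negative part of `Φ` and `β` serving only to bound the search. -/
theorem exists_ce (hT : T.Consistent) {A : ApType T} {q : T.El T.nat → T.El A.pos} (hq : Repr q)
    (hq' : ∀ n, q (T.numeral n) ∈ A.carrier)
    {β : T.El (T.prod (T.prod (arr A (nat hT)).pos (arr A (nat hT)).pos) A.pos) → T.El T.nat}
    (hβ : Repr β) (hβ' : ∀ f ∈ (arr A (nat hT)).carrier, ∀ g ∈ (arr A (nat hT)).carrier,
      ∀ a ∈ A.carrier, T.app (p1 f) a ≠ T.app (p1 g) a → ∃ i, β (pr (pr f g) a) = T.numeral i ∧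
        T.app (p1 f) (q (T.numeral i)) ≠ T.app (p1 g) (q (T.numeral i))) :
    ∃ e : (arr (arr (arr A (nat hT)) (nat hT)) (arr (arr A (nat hT)) (arr (arr A (nat hT)) A))).El,
      ∀ (Φ : (arr (arr A (nat hT)) (nat hT)).El) (f g : (arr A (nat hT)).El), app Φ f ≠ app Φ g →
        app f (app (app (app e Φ) f) g) ≠ app g (app (app (app e Φ) f) g) := by
  obtain ⟨E₀, hE₀, hE₀'⟩ := T.exists_natEq
  obtain ⟨G₀, hG₀, hG0, hG1⟩ := TCA.exists_guard (T := T)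
  -- equality of numbers and the conditional, as morphisms
  let E : T.El (T.prod T.nat T.nat) → T.El T.nat := fun x => E₀ (pr (p1 x) (p2 x))
  have hE : IsMor (prod (nat hT) (nat hT)) (nat hT) E := by
    refine isMor_of_nat_nat hT (hE₀.comp (Repr.id.p1.pr Repr.id.p2)) (fun m n x hm hn => ?_)
      fun x y h h' => by simp only [E, h, h']
    exact ⟨if m = n then 1 else 0, by simp only [E, hm, hn, hE₀']⟩
  let G : T.El (T.prod T.nat T.nat) → T.El T.nat := fun x => G₀ (pr (p1 x) (p2 x))
  have hG : IsMor (prod (nat hT) (nat hT)) (nat hT) G := by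
    refine isMor_of_nat_nat hT (hG₀.comp (Repr.id.p1.pr Repr.id.p2)) (fun m n x hm hn => ?_)
      fun x y h h' => by simp only [G, h, h']
    cases m with
    | zero => exact ⟨n, by simp only [G, hm, hn, hG0]⟩
    | succ m => exact ⟨0, by simp only [G, hm, hG1]⟩
  let B := arr A (nat hT)
  let C := arr B (nat hT)
  let Z := prod (prod C B) B
  have hqm : IsMor (nat hT) A q := isMor_of_nat hT hq hq'
  have hx : IsMor Z (nat hT) _ := IsMor.app (B := B) IsMor.id.p1.p1 IsMor.id.p1.p2
  have hy : IsMor Z (nat hT) _ := IsMor.app (B := B) IsMor.id.p1.p1 IsMor.id.p2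
  have hxy : IsMor Z (nat hT) _ := hE.comp (hx.pr hy)
  have hD : IsMor (prod Z (nat hT)) (nat hT) _ := hG.comp ((hxy.comp IsMor.id.p1).pr (hE.comp
    ((IsMor.app (B := A) IsMor.id.p1.p1.p2 (hqm.comp IsMor.id.p2)).pr
      (IsMor.app (B := A) IsMor.id.p1.p2 (hqm.comp IsMor.id.p2)))))
  have hb : Repr (S := Z.pos) _ := hG₀.comp (hxy.1.pr (hβ.comp ((Repr.id.p1.p2.pr Repr.id.p2).pr
    (((Repr.id.p1.p1.p2.app Repr.id.p1.p2).app Repr.id.p2).app (Repr.const T.zero)).p1)))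
  obtain ⟨F, hF, hF'⟩ := isMor_search hT hD hb (by
    intro a ha
    obtain ⟨⟨hΦ, hf⟩, hg⟩ := ha
    obtain ⟨m, hm⟩ := hΦ.1 _ hf
    obtain ⟨n, hn⟩ := hΦ.1 _ hg
    simp only [TCA.p1_pr, TCA.p2_pr, E, G, ← hm, ← hn, hE₀']
    by_cases h : m = n
    · rw [if_pos h]
      exact ⟨0, hG1 0 _, hG1 0 _⟩
    · rw [if_neg h]
      simp only [hG0]
      obtain ⟨-, -, hc, -, -, hne⟩ := hΦ.2 _ hf _ hg T.zero ⟨⟨m, hm⟩, ⟨n, hn⟩, fun e => h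
        (hT.numeral_inj (hm.trans (e.trans hn.symm)))⟩
      obtain ⟨i, hi, hne⟩ := hβ' _ hf _ hg _ hc hne
      refine ⟨i, hi, ?_⟩
      obtain ⟨u, hu⟩ := hf.1 _ (hq' i)
      obtain ⟨v, hv⟩ := hg.1 _ (hq' i)
      rw [← hu, ← hv, hE₀', if_neg fun e => hne (by rw [← hu, ← hv, e])])
  obtain ⟨K, hK, eK⟩ := (hqm.comp hF).curry
  obtain ⟨L, hL, eL⟩ := hK.curry
  refine ⟨ofMor L hL, fun Φ f g h => ?_⟩
  obtain ⟨Φ, hΦ, rfl⟩ := exists_cls (A := C) Φ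
  obtain ⟨f, hf, rfl⟩ := exists_cls (A := B) f
  obtain ⟨g, hg, rfl⟩ := exists_cls (A := B) g
  have hz : pr (pr Φ f) g ∈ Z.carrier := by simpa [Z] using ⟨⟨hΦ, hf⟩, hg⟩
  have e : app (app (app (ofMor L hL) (cls (A := C) Φ hΦ)) (cls (A := B) f hf))
      (cls (A := B) g hg) = cls (A := A) _ ((hqm.comp hF).2.1 _ hz) := by
    refine (congrArg (fun x => app (app x _) _) (app_ofMor hL Φ hΦ)).trans ?_
    change cls _ _ = cls _ _
    congr 1
    simp [eK, eL]
  rw [e]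
  intro h'
  obtain ⟨n, en, hn⟩ := hF' _ hz
  have h1 : T.app (p1 f) (q (T.numeral n)) = T.app (p1 g) (q (T.numeral n)) := by
    have : T.app (p1 f) (q (F (pr (pr Φ f) g))) = T.app (p1 g) (q (F (pr (pr Φ f) g))) :=
      (cls_nat_eq_iff hT).1 h'
    rwa [en] at this
  obtain ⟨i, hi⟩ := hΦ.1 _ hf
  obtain ⟨j, hj⟩ := hΦ.1 _ hg
  have hij : i ≠ j := by
    rintro rfl
    exact h ((cls_nat_eq_iff hT).2 (hi.symm.trans hj))
  obtain ⟨u, hu⟩ := hg.1 _ (hq' n)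
  simp only [TCA.p1_pr, TCA.p2_pr, E, G, ← hi, ← hj, hE₀', if_neg hij, h1, ← hu, if_true, hG0] at hn
  exact absurd (hT.numeral_inj hn) one_ne_zero

/-- Converse extensionality for functions on the numbers holds, whatever the underlying tca. -/
theorem ce_zero_valid (hT : T.Consistent) {Γ : Ctx} :
    (Assembly.ofFm (ApTypes T hT) (CE 0 : Fm Γ)).Valid := by
  obtain ⟨e, he⟩ := exists_ce hT (A := nat hT) Repr.id (fun n => ⟨n, rfl⟩) Repr.id.p2
    (by
      rintro f - g - _ ⟨n, rfl⟩ h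
      exact ⟨n, by simp, h⟩)
  exact Assembly.ce_valid_of_realizer (n := 0) (extensional hT) e he

end ApType

/-! ### Continuity and search in the second algebra -/

namespace K2

theorem computable_of_num_mem_ap {h : Rec} {d : ℕ → ℕ} (hd : ∀ n, num (d n) ∈ ap h (num n)) :
    Computable d := by
  have h1 : Computable₂ fun n k => hit h.1 (num n).1 0 k :=
    h.2.comp (Primrec.encode.comp (Primrec.list_cons.comp (Primrec.const 0)
      (Primrec.list_map (Primrec.list_range.comp Primrec.snd)
        (Primrec.fst.comp Primrec.fst).to₂))).to_comp
  have h2 : Computable₂ fun n k => !(hit h.1 (num n).1 0 k == 0) :=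
    (Primrec.not.comp (Primrec.beq.comp Primrec.id (Primrec.const 0))).to_comp.comp h1
  choose k hk hk' using fun n => mem_ap.1 (hd n) 0
  have h3 : Computable k := by
    refine (Partrec.rfind h2.partrec₂).of_eq_tot fun n => ?_
    rw [Nat.mem_rfind]
    exact ⟨by simp [hk], fun {m} hm => by simp [hk' n m hm]⟩
  refine (Computable.pred.comp (h1.comp Computable.id h3)).of_eq fun n => ?_
  change (hit h.1 (num n).1 0 (k n)).pred = _
  rw [hk]
  rfl

/-- Passing from a realizer of a function on the numerals to the function itself. -/
theorem exists_raw : ∃ e : Rec, ∀ h v : Rec, (∀ n, num (v.1 n) ∈ ap h (num n)) → v ∈ ap e h := by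
  have h3 : Primrec fun x : Arg => x.1.2 := Primrec.snd.comp Primrec.fst
  obtain ⟨e, he⟩ := rep2 (G := fun x => apf x.1.2 (x.1.2.map fun _ => x.2) 0)
    (primrec_apf.comp ((h3.pair (Primrec.list_map h3 (Primrec.snd.comp Primrec.fst).to₂)).pair
      (Primrec.const 0)))
  obtain ⟨f, -, hf⟩ := he (num 0)
  refine ⟨f, fun h v hv => hf h v (fun l n j w hw => ?_) fun n => ?_⟩
  · rw [seg_map] at hw
    exact apf_sound (g := num n) (hv n) hw
  · obtain ⟨J, hJ⟩ := apf_complete (hv n) 0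
    refine ⟨J, fun l => ?_⟩
    have := hJ J le_rfl J le_rfl
    rw [seg_map]
    exact fun e => absurd (this.symm.trans e) (by simp)

/-- Passing from a function to a realizer of it. -/
theorem exists_code : ∃ e : Rec, ∀ u, ∃ f ∈ ap e u, ∀ n, num (u.1 n) ∈ ap f (num n) := by
  have h2 : Primrec fun x : Arg => x.1.1.2 := Primrec.snd.comp (Primrec.fst.comp Primrec.fst)
  have h3 : Primrec fun x : Arg => x.1.2 := Primrec.snd.comp Primrec.fst
  have h4 : Primrec₂ fun (x : Arg) (n : ℕ) => x.1.1.2[n]? :=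
    Primrec.list_getElem?.comp (h2.comp Primrec.fst) Primrec.snd
  obtain ⟨e, he⟩ := rep2 (G := fun x : Arg => (x.1.2[0]?).bind fun n : ℕ => x.1.1.2[n]?)
    (Primrec.option_bind (Primrec.list_getElem?.comp h3 (Primrec.const 0)) h4)
  refine ⟨e, fun u => (he u).imp fun f hf => ⟨hf.1, fun n => hf.2 _ _ (fun l m j w hw => ?_)
    fun m => ⟨n + 1, fun l => ?_⟩⟩⟩
  · obtain ⟨i, hi, hw⟩ := Option.bind_eq_some_iff.1 hw
    obtain rfl : i = n := (approx_seg (num n).1).get_sound hi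
    exact (approx_seg u.1).get_sound hw
  · simp only [seg_getElem? _ (Nat.succ_pos n), Option.bind_some]
    change (seg u.1 (n + 1))[n]? ≠ none
    rw [seg_getElem? _ (Nat.lt_succ_self n)]
    simp

/-- The finite sequence with code `i`, continued by zeros. -/
def pad (i : ℕ) : Rec :=
  ⟨fun n => ((Denumerable.ofNat (List ℕ) i)[n]?).getD 0,
    (Primrec.option_getD.comp (Primrec.list_getElem?.comp (Primrec.const _) Primrec.id)
      (Primrec.const 0)).to_comp⟩

theorem exists_pad : ∃ e : Rec, ∀ i, pad i ∈ ap e (num i) := by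
  have h3 : Primrec fun x : Arg => x.1.2 := Primrec.snd.comp Primrec.fst
  have h4 : Primrec₂ fun (x : Arg) (i : ℕ) => ((Denumerable.ofNat (List ℕ) i)[x.2]?).getD 0 :=
    Primrec.option_getD.comp (Primrec.list_getElem?.comp ((Primrec.ofNat _).comp Primrec.snd)
      (Primrec.snd.comp Primrec.fst)) (Primrec.const 0)
  obtain ⟨e, he⟩ := rep2 (G := fun x : Arg => (x.1.2[0]?).map fun i : ℕ =>
    ((Denumerable.ofNat (List ℕ) i)[x.2]?).getD 0)
    (Primrec.option_map (Primrec.list_getElem?.comp h3 (Primrec.const 0)) h4)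
  obtain ⟨f, -, hf⟩ := he (num 0)
  refine ⟨f, fun i => hf _ _ (fun l m j w hw => ?_) fun m => ⟨1, fun l => by simp⟩⟩
  obtain ⟨i', hi, rfl⟩ := Option.map_eq_some_iff.1 hw
  obtain rfl : i' = i := (approx_seg (num i).1).get_sound hi
  rfl

theorem exists_pad_eq (u : ℕ → ℕ) (J : ℕ) : ∃ i, ∀ n < J, (pad i).1 n = u n := by
  refine ⟨Encodable.encode (seg u J), fun n hn => ?_⟩
  simp only [pad, Denumerable.ofNat_encode, seg_getElem? u hn, Option.getD_some]

theorem idxOf_zero_seg {u : ℕ → ℕ} {m : ℕ} (h : u m = 0) (hm : ∀ i < m, u i ≠ 0) (j : ℕ) :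
    (seg u j).idxOf 0 = min m j := by
  induction j with
  | zero => simp [seg]
  | succ j ih =>
    rw [seg_succ, List.idxOf_append, ih]
    by_cases hj : m < j
    · rw [if_pos (by rw [← List.idxOf_lt_length_iff, ih, seg_length]; omega)]
      omega
    · rw [if_neg (by rw [← List.idxOf_lt_length_iff, ih, seg_length]; omega), seg_length]
      by_cases e : m = j
      · subst e
        simp [h]
      · simp [hm j (by omega)]
        omega

/-- Unbounded search. -/
theorem exists_mu : ∃ e : Rec, ∀ (u : Rec) (m : ℕ), u.1 m = 0 → (∀ i < m, u.1 i ≠ 0) →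
    num m ∈ ap e u := by
  have h3 : Primrec fun x : Arg => x.1.2 := Primrec.snd.comp Primrec.fst
  have h4 : Primrec fun x : Arg => x.1.2.idxOf 0 := Primrec.list_idxOf.comp (Primrec.const 0) h3
  obtain ⟨e, he⟩ := rep2 (G := fun x : Arg => if x.1.2.idxOf 0 < x.1.2.length then
    some (x.1.2.idxOf 0) else none) (Primrec.ite (Primrec.nat_lt.comp h4
      (Primrec.list_length.comp h3)) (Primrec.option_some.comp h4) (Primrec.const none))
  obtain ⟨f, -, hf⟩ := he (num 0)
  refine ⟨f, fun u m h hm => hf _ _ (fun l n j w hw => ?_) fun n => ⟨m + 1, fun l => ?_⟩⟩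
  · simp only [idxOf_zero_seg h hm, seg_length] at hw
    split_ifs at hw with hj
    obtain rfl := Option.some.inj hw
    change min m j = m
    omega
  · simp [idxOf_zero_seg h hm]

/-- A value of the result of an application depends on a finite part of the argument only. -/
theorem exists_modulus {f g v : Rec} (h : v ∈ ap f g) (n : ℕ) : ∃ J, ∀ g' v' : Rec,
    (∀ i < J, g'.1 i = g.1 i) → v' ∈ ap f g' → v'.1 n = v.1 n := by
  obtain ⟨J, hJ⟩ := apf_complete h n
  refine ⟨J, fun g' v' hg hv => ?_⟩
  have e : seg g'.1 J = seg g.1 J :=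
    List.map_congr_left fun i hi => hg i (List.mem_range.1 hi)
  refine (apf_sound hv (p := J) (q := J) ?_).symm
  rw [e]
  exact hJ J le_rfl J le_rfl

end K2

namespace K2rec

/-- The type of all recursive functions, given as such. -/
def fn : K2rec.Ty := (Set.univ : Set K2.Rec)

/-- A recursive function, as an element of `fn`. -/
def mk (u : K2.Rec) : K2rec.El fn := ⟨u, trivial⟩

/-- The values of an element of `fn`. -/
def val (u : K2rec.El fn) : ℕ → ℕ := (Subtype.val u : K2.Rec).1

theorem numeral_val (n : ℕ) : (Subtype.val (K2rec.numeral n) : K2.Rec) = K2.num n :=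
  K2.pca.numeral_eq n

theorem eq_numeral {x : K2rec.El K2rec.nat} {n : ℕ} (h : (Subtype.val x : K2.Rec) = K2.num n) :
    x = K2rec.numeral n :=
  Subtype.ext (h.trans (numeral_val n).symm)

theorem exists_numeral (x : K2rec.El K2rec.nat) : ∃ n, x = K2rec.numeral n := by
  obtain ⟨_, n, rfl⟩ := x
  exact ⟨n, eq_numeral rfl⟩

/-- Application to a numeral, in terms of the algebra. -/
theorem app_numeral_mem {S : K2rec.Ty} (e : K2rec.El (K2rec.arr K2rec.nat S)) (n : ℕ) :
    (Subtype.val (K2rec.app e (K2rec.numeral n)) : K2.Rec) ∈ K2.ap (Subtype.val e) (K2.num n) := by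
  have := PCA.app_mem (P := K2.pca) e (K2rec.numeral n)
  rwa [numeral_val] at this

theorem app_eq {S U : K2rec.Ty} {e : K2rec.El (K2rec.arr S U)} {a : K2rec.El S} {v : K2.Rec}
    (h : v ∈ K2.ap (Subtype.val e) (Subtype.val a)) :
    (Subtype.val (K2rec.app e a) : K2.Rec) = v :=
  PCA.app_eq (P := K2.pca) h

theorem exists_raw : ∃ R : K2rec.El (K2rec.arr K2rec.nat K2rec.nat) → K2rec.El fn, Repr R ∧
    ∀ h n, K2rec.app h (K2rec.numeral n) = K2rec.numeral (val (R h) n) := by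
  obtain ⟨e, he⟩ := K2.exists_raw
  have key : ∀ h : K2rec.El (K2rec.arr K2rec.nat K2rec.nat), ∃ v ∈ K2.ap e (Subtype.val h),
      ∀ n, K2rec.app h (K2rec.numeral n) = K2rec.numeral (v.1 n) := by
    intro h
    choose d hd using fun n => exists_numeral (K2rec.app h (K2rec.numeral n))
    have hmem : ∀ n, K2.num (d n) ∈ K2.ap (Subtype.val h) (K2.num n) := fun n => by
      have := app_numeral_mem h n
      rwa [hd, numeral_val] at this
    exact ⟨⟨d, K2.computable_of_num_mem_ap hmem⟩, he _ _ hmem, hd⟩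
  choose v hv hv' using key
  let E : K2rec.El (K2rec.arr (K2rec.arr K2rec.nat K2rec.nat) fn) :=
    ⟨e, fun h hh => ⟨v ⟨h, hh⟩, hv ⟨h, hh⟩, trivial⟩⟩
  refine ⟨fun h => mk (v h), ⟨E, fun h => Subtype.ext (app_eq (hv h))⟩, hv'⟩

theorem exists_code : ∃ C : K2rec.El fn → K2rec.El (K2rec.arr K2rec.nat K2rec.nat), Repr C ∧
    ∀ u n, K2rec.app (C u) (K2rec.numeral n) = K2rec.numeral (val u n) := by
  obtain ⟨e, he⟩ := K2.exists_code
  choose f hf hf' using he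
  have hmem : ∀ u, f u ∈ K2.pca.arr K2rec.nat K2rec.nat := by
    rintro u _ ⟨n, rfl⟩
    exact ⟨_, hf' u n, ⟨_, rfl⟩⟩
  let E : K2rec.El (K2rec.arr fn (K2rec.arr K2rec.nat K2rec.nat)) :=
    ⟨e, fun u _ => ⟨f u, hf u, hmem u⟩⟩
  refine ⟨fun u => ⟨f u.1, hmem u.1⟩, ⟨E, fun u => Subtype.ext (app_eq (hf u.1))⟩, fun u n => ?_⟩
  refine eq_numeral (app_eq ?_)
  rw [numeral_val]
  exact hf' u.1 n

theorem exists_pad : ∃ P : K2rec.El K2rec.nat → K2rec.El fn, Repr P ∧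
    ∀ i, P (K2rec.numeral i) = mk (K2.pad i) := by
  obtain ⟨e, he⟩ := K2.exists_pad
  let E : K2rec.El (K2rec.arr K2rec.nat fn) :=
    ⟨e, by rintro _ ⟨i, rfl⟩; exact ⟨K2.pad i, he i, trivial⟩⟩
  refine ⟨_, ⟨E, fun _ => rfl⟩, fun i => Subtype.ext (app_eq ?_)⟩
  rw [numeral_val]
  exact he i

/-- Unbounded search, for tests which are known to succeed. -/
theorem exists_mu {S : K2rec.Ty} {t : K2rec.El S → K2rec.El fn} (ht : Repr t)
    (h : ∀ a, ∃ n, val (t a) n = 0) : ∃ m : K2rec.El S → K2rec.El K2rec.nat, Repr m ∧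
      ∀ a, ∃ n, m a = K2rec.numeral n ∧ val (t a) n = 0 := by
  obtain ⟨e, he⟩ := K2.exists_mu
  -- the type of the functions having a zero
  let Z : Set K2.Rec := {u : K2.Rec | ∃ n, u.1 n = 0}
  have hZ : ∀ u ∈ Z, K2.num (sInf {n | u.1 n = 0}) ∈ K2.ap e u := fun u hu =>
    he u _ (Nat.sInf_mem hu) fun i hi h => Nat.notMem_of_lt_sInf hi h
  let E : K2rec.El (K2rec.arr Z K2rec.nat) := ⟨e, fun u hu => ⟨_, hZ u hu, ⟨_, rfl⟩⟩⟩
  obtain ⟨T, hT⟩ := ht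
  let T' : K2rec.El (K2rec.arr S Z) := ⟨T.1, fun a ha => ⟨_, PCA.app_mem (P := K2.pca) T ⟨a, ha⟩,
    (congrArg (fun x => ∃ n, val x n = 0) (hT ⟨a, ha⟩)).mpr (h ⟨a, ha⟩)⟩⟩
  refine ⟨_, (Repr.elt E).comp (Repr.elt T'), fun a => ?_⟩
  have e1 : (Subtype.val (K2rec.app T' a) : K2.Rec) = (t a).1 := by
    rw [← hT]
    exact app_eq (PCA.app_mem (P := K2.pca) T a)
  refine ⟨_, eq_numeral (app_eq (hZ _ (K2rec.app T' a).2)), ?_⟩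
  have : ((K2rec.app T' a).1 : K2.Rec).1 (sInf {n | ((K2rec.app T' a).1 : K2.Rec).1 n = 0}) = 0 :=
    Nat.sInf_mem (K2rec.app T' a).2
  rw [e1] at this ⊢
  exact this

/-- Represented operations from functions to numbers are continuous. -/
theorem exists_modulus {F : K2rec.El fn → K2rec.El K2rec.nat} (hF : Repr F) (u : K2rec.El fn) :
    ∃ J, ∀ u', (∀ i < J, val u' i = val u i) → F u' = F u := by
  obtain ⟨e, he⟩ := hF
  have hm : ∀ u, (Subtype.val (F u) : K2.Rec) ∈ K2.ap (Subtype.val e) (Subtype.val u) := fun u => by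
    have := PCA.app_mem (P := K2.pca) e u
    rwa [show PCA.app e u = F u from he u] at this
  obtain ⟨J, hJ⟩ := K2.exists_modulus (hm u) 0
  refine ⟨J, fun u' hu => ?_⟩
  obtain ⟨n, hn⟩ := exists_numeral (F u)
  obtain ⟨n', hn'⟩ := exists_numeral (F u')
  have := hJ _ _ hu (hm u')
  rw [hn, hn', numeral_val, numeral_val] at this
  rw [hn, hn', show n' = n from this]

end K2rec

/-! ### Converse extensionality at the second level -/

namespace ApType

variable {T : TCA}

/-- Functionals with numerical values respect equality. -/
theorem app_eq_of_not_apart (hT : T.Consistent) {A : ApType T} {f : T.El (arr A (nat hT)).pos}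
    (hf : f ∈ (arr A (nat hT)).carrier) {a b : T.El A.pos} (ha : a ∈ A.carrier) (hb : b ∈ A.carrier)
    (h : ∀ n, ¬ A.apart a b n) : T.app (p1 f) a = T.app (p1 f) b := by
  by_contra hne
  exact h _ (hf.2 _ ha _ hb T.zero ⟨hf.1 _ ha, hf.1 _ hb, hne⟩)

theorem not_apart_of_forall_numeral (hT : T.Consistent) {f g : T.El (arr (nat hT) (nat hT)).pos}
    (h : ∀ n : ℕ, T.app (p1 f) (T.numeral n) = T.app (p1 g) (T.numeral n)) (m) :
    ¬ (arr (nat hT) (nat hT)).apart f g m := by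
  rintro ⟨-, -, ⟨n, hn⟩, -, -, hne⟩
  rw [← hn] at hne
  exact hne (h n)

/-- A representation of functions on the numbers by realizers is one by premorphisms, any negative
part being correct. -/
theorem exists_premorphism (hT : T.Consistent) {S : T.Ty} {F : T.El S → T.El (T.arr T.nat T.nat)}
    (hF : Repr F) : ∃ c : T.El S → T.El (arr (nat hT) (nat hT)).pos, Repr c ∧
      (∀ x, (∀ n, ∃ k, T.app (F x) (T.numeral n) = T.numeral k) →
        c x ∈ (arr (nat hT) (nat hT)).carrier) ∧ ∀ x, p1 (c x) = F x := by
  obtain ⟨z, -⟩ := Repr.abs3 (S := T.nat) (U := T.nat) (V := T.nat) (Repr.const T.zero)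
  refine ⟨_, hF.pr (Repr.const z), fun x h => ⟨?_, ?_⟩, fun x => TCA.p1_pr _ _⟩
  · rintro _ ⟨n, rfl⟩
    obtain ⟨k, hk⟩ := h n
    exact ⟨k, by rw [TCA.p1_pr, hk]⟩
  · intro a ha b hb n hn
    refine ⟨ha, hb, ?_⟩
    rintro rfl
    exact (nat hT).irrefl _ _ hn

end ApType

namespace K2rec

open ApType

/-- Every recursive function is given by a premorphism, uniformly. -/
theorem exists_ofFn : ∃ c : K2rec.El fn →
      K2rec.El (ApType.arr (ApType.nat K2rec_consistent) (ApType.nat K2rec_consistent)).pos,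
    Repr c ∧ (∀ u, c u ∈ (ApType.arr (ApType.nat K2rec_consistent)
      (ApType.nat K2rec_consistent)).carrier) ∧
    ∀ u n, K2rec.app (p1 (c u)) (K2rec.numeral n) = K2rec.numeral (val u n) := by
  obtain ⟨C, hC, hC'⟩ := exists_code
  obtain ⟨c, hc, hc', h⟩ := exists_premorphism K2rec_consistent hC
  exact ⟨c, hc, fun u => hc' u fun n => ⟨_, hC' u n⟩, fun u n => by rw [h, hC']⟩

/-- By continuity, two functionals which differ at `a` also differ at a function which agrees with
`a` on a large initial segment and vanishes from there on. Such functions can be enumerated. -/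
theorem ce_one_valid {Γ : Ctx} : (Assembly.ofFm ApK2rec (CE 1 : Fm Γ)).Valid := by
  let hT := K2rec_consistent
  let A : ApType K2rec := arr (nat hT) (nat hT)
  let B : ApType K2rec := arr A (nat hT)
  let S := K2rec.prod (K2rec.prod B.pos B.pos) A.pos
  obtain ⟨R, hR, hR'⟩ := exists_raw
  obtain ⟨P, hP, hP'⟩ := exists_pad
  obtain ⟨c, hc, hc', hcv⟩ := exists_ofFn
  obtain ⟨E, hE, hE'⟩ := K2rec.exists_natEq
  have hE1 : ∀ x y, (x = y → E (pr x y) = K2rec.numeral (0 + 1)) ∧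
      (x ≠ y → E (pr x y) = K2rec.numeral 0) := by
    intro x y
    obtain ⟨m, rfl⟩ := exists_numeral x
    obtain ⟨n, rfl⟩ := exists_numeral y
    rw [hE']
    exact ⟨fun h => by rw [if_pos (hT.numeral_inj h)],
      fun h => by rw [if_neg fun e => h (by rw [e])]⟩
  -- the test whether `f` and `g` take the same values at the `i`-th function as at `a`
  have hu : Repr fun x : K2rec.El (K2rec.prod S K2rec.nat) => c (P (p2 x)) :=
    hc.comp (hP.comp Repr.id.p2)
  have hv : Repr fun x : K2rec.El (K2rec.prod S K2rec.nat) => c (R (p1 (p2 (p1 x)))) :=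
    hc.comp (hR.comp Repr.id.p1.p2.p1)
  obtain ⟨D₁, hD₁, h10, h11⟩ := Repr.cond
    (hE.comp ((Repr.id.p1.p1.p2.p1.app hu).pr (Repr.id.p1.p1.p2.p1.app hv)))
    (Repr.const (K2rec.numeral 1)) (Repr.const (K2rec.numeral 0))
  obtain ⟨D, hD, h0, h1⟩ := Repr.cond
    (hE.comp ((Repr.id.p1.p1.p1.p1.app hu).pr (Repr.id.p1.p1.p1.p1.app hv)))
    (Repr.const (K2rec.numeral 1)) hD₁
  have hDz : ∀ (s : K2rec.El S) (i : ℕ), D (pr s (K2rec.numeral i)) = K2rec.numeral 0 ↔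
        K2rec.app (p1 (p1 (p1 s))) (c (mk (K2.pad i))) =
            K2rec.app (p1 (p1 (p1 s))) (c (R (p1 (p2 s)))) ∧
        K2rec.app (p1 (p2 (p1 s))) (c (mk (K2.pad i))) =
            K2rec.app (p1 (p2 (p1 s))) (c (R (p1 (p2 s)))) := by
    intro s i
    by_cases hf : K2rec.app (p1 (p1 (p1 s))) (c (mk (K2.pad i))) =
        K2rec.app (p1 (p1 (p1 s))) (c (R (p1 (p2 s))))
    · rw [h1 _ 0 (by simpa only [TCA.p1_pr, TCA.p2_pr, hP'] using (hE1 _ _).1 hf)]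
      by_cases hg : K2rec.app (p1 (p2 (p1 s))) (c (mk (K2.pad i))) =
          K2rec.app (p1 (p2 (p1 s))) (c (R (p1 (p2 s))))
      · rw [h11 _ 0 (by simpa only [TCA.p1_pr, TCA.p2_pr, hP'] using (hE1 _ _).1 hg)]
        exact ⟨fun _ => ⟨hf, hg⟩, fun _ => rfl⟩
      · rw [h10 _ (by simpa only [TCA.p1_pr, TCA.p2_pr, hP'] using (hE1 _ _).2 hg)]
        exact ⟨fun h => absurd (hT.numeral_inj h) one_ne_zero, fun h => (hg h.2).elim⟩
    · rw [h0 _ (by simpa only [TCA.p1_pr, TCA.p2_pr, hP'] using (hE1 _ _).2 hf)]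
      exact ⟨fun h => absurd (hT.numeral_inj h) one_ne_zero, fun h => (hf h.1).elim⟩
  obtain ⟨t, ht, ht'⟩ := hD.curry
  have htv : ∀ s i, val (R (t s)) i = 0 ↔ D (pr s (K2rec.numeral i)) = K2rec.numeral 0 := by
    intro s i
    rw [← ht', hR']
    exact ⟨fun h => by rw [h], fun h => hT.numeral_inj h⟩
  obtain ⟨β, hβ, hβ'⟩ := exists_mu (hR.comp ht) (by
    intro s
    obtain ⟨J, hJ⟩ := exists_modulus ((Repr.elt (p1 (p1 (p1 s)))).comp hc) (R (p1 (p2 s)))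
    obtain ⟨J', hJ'⟩ := exists_modulus ((Repr.elt (p1 (p2 (p1 s)))).comp hc) (R (p1 (p2 s)))
    obtain ⟨i, hi⟩ := K2.exists_pad_eq (val (R (p1 (p2 s)))) (max J J')
    exact ⟨i, (htv _ _).2 ((hDz _ _).2 ⟨hJ _ fun n hn => hi n (hn.trans_le (le_max_left _ _)),
      hJ' _ fun n hn => hi n (hn.trans_le (le_max_right _ _))⟩)⟩)
  obtain ⟨e, he⟩ := exists_ce hT (A := A) (hc.comp hP) (fun n => hc' _) hβ (by
    intro f hf g hg a ha hne
    obtain ⟨i, hi, hz⟩ := hβ' (pr (pr f g) a)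
    refine ⟨i, hi, ?_⟩
    rw [htv, hDz, TCA.p1_pr, TCA.p2_pr, TCA.p1_pr, TCA.p2_pr] at hz
    have hsim : ∀ n, ¬ A.apart (c (R (p1 a))) a n :=
      not_apart_of_forall_numeral hT fun n => by rw [hcv, hR']
    rw [hP', hz.1, hz.2, app_eq_of_not_apart hT hf (hc' _) ha hsim,
      app_eq_of_not_apart hT hg (hc' _) ha hsim]
    exact hne)
  exact Assembly.ce_valid_of_realizer (n := 1) (extensional hT) e he

end K2rec

/-! ### Refuting Markov's principle -/

namespace ApType

variable {T : TCA}

/-- A realizer of Markov's principle acts on all functionals, as a total operation of `T`. -/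
theorem exists_search_of_mp (hT : T.Consistent) {n : ℕ}
    (h : Assembly.Models (ApTypes T hT) (MP n)) {A : ApType T}
    (hA : A = (Assembly.ofTy (ApTypes T hT) (FTy.pure n)).ty) :
    ∃ M : T.El (arr A (nat hT)).pos → T.El A.pos, Repr M ∧
      ∀ f ∈ (arr A (nat hT)).carrier, (∃ a ∈ A.carrier, T.app (p1 f) a = T.numeral 0) →
        M f ∈ A.carrier ∧ T.app (p1 f) (M f) = T.numeral 0 := by
  subst hA
  obtain ⟨c⟩ := (extensional hT).bot
  obtain ⟨M, ⟨m, hm⟩, hM⟩ := Assembly.exists_search_of_mp c h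
  obtain ⟨m, hm', rfl⟩ := exists_cls (A := arr (arr _ (nat hT)) _) m
  refine ⟨_, Repr.elt (p1 m), fun f hf ⟨a, ha, hfa⟩ => ⟨hm'.1 f hf, ?_⟩⟩
  obtain ⟨F, hF⟩ := (Assembly.ofTy_basic (extensional hT) (FTy.pure (n + 1))).1 (cls f hf)
  obtain ⟨x, hx⟩ := (Assembly.ofTy_basic (extensional hT) (FTy.pure n)).1 (cls a ha)
  have h0 : F.1 x = (0 : ℕ) := by
    have h1 := hF x _ hx
    exact cls_numeral_inj hT ((numeral_eq_cls hT _).symm.trans (h1.symm.trans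
      ((cls_nat_eq_iff hT).2 hfa)))
  obtain ⟨y, hy, hMy⟩ := hM F _ hF ⟨x, h0⟩
  have h1 := hF y _ ((hm (cls f hf)).symm ▸ hMy)
  have h2 : F.1 y = (0 : ℕ) := hy
  rw [h2] at h1
  exact (cls_nat_eq_iff hT).1 (h1.trans (numeral_eq_cls hT 0))

/-- At both of the lowest levels, Markov's principle yields a total operation finding a zero of any
function on the numbers which has one. -/
theorem exists_nat_search_of_mp (hT : T.Consistent) {n : ℕ} (hn : n = 0 ∨ n = 1)
    (h : Assembly.Models (ApTypes T hT) (MP n)) :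
    ∃ M : T.El (arr (nat hT) (nat hT)).pos → T.El T.nat, Repr M ∧
      ∀ f ∈ (arr (nat hT) (nat hT)).carrier, (∃ k : ℕ, T.app (p1 f) (T.numeral k) = T.numeral 0) →
        ∃ k, M f = T.numeral k ∧ T.app (p1 f) (T.numeral k) = T.numeral 0 := by
  rcases hn with rfl | rfl
  · obtain ⟨M, hM, hM'⟩ := exists_search_of_mp hT h (A := nat hT) rfl
    refine ⟨M, hM, fun f hf ⟨k, hk⟩ => ?_⟩
    obtain ⟨⟨i, hi⟩, h0⟩ := hM' f hf ⟨_, ⟨k, rfl⟩, hk⟩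
    exact ⟨i, hi.symm, by rw [hi]; exact h0⟩
  · let A := arr (nat hT) (nat hT)
    obtain ⟨M, hM, hM'⟩ := exists_search_of_mp hT h (A := A) rfl
    -- a zero of `x ↦ g (x 0)` yields the zero `x 0` of `g`
    have hF : IsMor (prod A A) (nat hT) _ := IsMor.app (B := nat hT) IsMor.id.p1
      (IsMor.app (B := nat hT) IsMor.id.p2 (IsMor.const (b := T.numeral 0) ⟨0, rfl⟩))
    obtain ⟨G, hG, hG'⟩ := hF.curry
    obtain ⟨c, -, hc, hc'⟩ := exists_premorphism hT (S := T.nat)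
      (F := fun x => T.app (T.k T.nat T.nat) x)
      (Repr.elt _)
    refine ⟨_, (hM.comp hG.1).p1.app (Repr.const (T.numeral 0)), fun g hg ⟨k, hk⟩ => ?_⟩
    obtain ⟨h1, h2⟩ := hM' (G g) (hG.2.1 g hg) ⟨c (T.numeral k), hc _ fun n => ⟨k, T.k_eq _ _⟩, by
      rw [hG', TCA.p1_pr, TCA.p2_pr, hc', T.k_eq, hk]⟩
    obtain ⟨i, hi⟩ := h1.1 (T.numeral 0) ⟨0, rfl⟩
    rw [hG', TCA.p1_pr, TCA.p2_pr, ← hi] at h2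
    exact ⟨i, hi.symm, h2⟩

end ApType

namespace K2rec

/-- The result of the search at a function without zeros is settled by an initial segment of that
function, which can be continued so as to have only larger zeros. -/
theorem not_models_mp {n : ℕ} (hn : n = 0 ∨ n = 1) : ¬ Assembly.Models ApK2rec (MP n) := by
  intro h
  obtain ⟨M, hM, hM'⟩ := ApType.exists_nat_search_of_mp K2rec_consistent hn h
  obtain ⟨c, hc, hc', hcv⟩ := exists_ofFn
  obtain ⟨k, hk⟩ := exists_numeral (M (c (mk (K2.num 1))))
  obtain ⟨J, hJ⟩ := exists_modulus (hM.comp hc) (mk (K2.num 1))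
  let u : K2rec.El fn := mk ⟨fun n => if n < max J (k + 1) then 1 else 0,
    (Primrec.ite (Primrec.nat_lt.comp Primrec.id (Primrec.const _)) (Primrec.const 1)
      (Primrec.const 0)).to_comp⟩
  have hu : ∀ n, val u n = if n < max J (k + 1) then 1 else 0 := fun n => rfl
  obtain ⟨i, hi, h0⟩ := hM' (c u) (hc' u) ⟨max J (k + 1), by rw [hcv, hu, if_neg (lt_irrefl _)]⟩
  have e : M (c u) = M (c (mk (K2.num 1))) := hJ u fun n hn => by
    rw [hu, if_pos (hn.trans_le (le_max_left _ _))]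
    rfl
  obtain rfl : k = i := K2rec_consistent.numeral_inj (hk.symm.trans (e.symm.trans hi))
  rw [hcv, hu, if_pos (lt_max_of_lt_right (Nat.lt_succ_self k))] at h0
  exact absurd (K2rec_consistent.numeral_inj h0) one_ne_zero

end K2rec

namespace K1

open Nat.Partrec (Code)

theorem numeral_val (n : ℕ) : (Subtype.val (K1.numeral n) : ℕ) = n := K1.pca.numeral_eq n

theorem eq_numeral (x : K1.El K1.nat) : x = K1.numeral (Subtype.val x : ℕ) :=
  Subtype.ext (numeral_val _).symm

/-- Represented operations on the numbers are computable. -/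
theorem computable_of_repr {F : K1.El K1.nat → K1.El K1.nat} (hF : Repr F) :
    Computable fun n : ℕ => (Subtype.val (F (K1.numeral n)) : ℕ) := by
  obtain ⟨e, he⟩ := hF
  refine (partrec_ap.comp (Computable.const (Subtype.val e : ℕ))
    Computable.id).of_eq_tot fun n => ?_
  have := PCA.app_mem (P := K1.pca) e (K1.numeral n)
  rw [numeral_val, show PCA.app e (K1.numeral n) = F (K1.numeral n) from he _] at this
  exact this

/-- A computable family of functions is represented. -/
theorem exists_family {F : ℕ → ℕ → ℕ} (hF : Computable₂ F) :
    ∃ C : K1.El K1.nat → K1.El (K1.arr K1.nat K1.nat), Repr C ∧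
      ∀ m n, K1.app (C (K1.numeral m)) (K1.numeral n) = K1.numeral (F m n) := by
  obtain ⟨e, he⟩ := rep2 (F := fun x => Part.some (F x.1 x.2)) hF.partrec
  choose f hf hf' using he
  have hv : ∀ m n, F m n ∈ ap (f m) n := fun m n => by
    rw [hf']
    exact Part.mem_some _
  have hmem : ∀ m, f m ∈ K1.pca.arr K1.nat K1.nat := fun m n _ => ⟨F m n, hv m n, ⟨_, rfl⟩⟩
  let E : K1.El (K1.arr K1.nat (K1.arr K1.nat K1.nat)) := ⟨e, fun m _ => ⟨f m, hf m, hmem m⟩⟩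
  refine ⟨_, Repr.elt E, fun m n => ?_⟩
  have e1 : (Subtype.val (K1.app E (K1.numeral m)) : ℕ) = f m := by
    refine PCA.app_eq (P := K1.pca) ?_
    rw [numeral_val]
    exact hf m
  refine Subtype.ext ((PCA.app_eq (P := K1.pca) ?_).trans (numeral_val (F m n)).symm)
  rw [numeral_val, e1]
  exact hv m n

/-- The function which vanishes where the computation with code `m` has halted. -/
def halt (m k : ℕ) : ℕ := if (Code.evaln k (Denumerable.ofNat Code m) 0).isSome then 0 else 1

theorem computable_halt : Computable₂ halt := by
  refine (Primrec.ite (Primrec.eq.comp (Primrec.option_isSome.comp (Code.primrec_evaln.comp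
    ((Primrec.snd.pair ((Primrec.ofNat Code).comp Primrec.fst)).pair (Primrec.const 0))))
    (Primrec.const true)) (Primrec.const 0) (Primrec.const 1)).to_comp

theorem dom_eval_iff (c : Code) : (c.eval 0).Dom ↔ ∃ k, halt (Encodable.encode c) k = 0 := by
  simp only [halt, Denumerable.ofNat_encode, ite_eq_left_iff, one_ne_zero, imp_false, not_not]
  constructor
  · intro h
    obtain ⟨k, hk⟩ := Code.evaln_complete.1 (Part.get_mem h)
    exact ⟨k, Option.isSome_iff_exists.2 ⟨_, hk⟩⟩
  · rintro ⟨k, hk⟩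
    obtain ⟨x, hx⟩ := Option.isSome_iff_exists.1 hk
    exact Part.dom_iff_mem.2 ⟨x, Code.evaln_sound hx⟩

/-- A search for zeros decides the halting problem: it suffices to test the number found. -/
theorem not_models_mp : ¬ Assembly.Models ApK1 (MP 0) := by
  intro h
  obtain ⟨M, hM, hM'⟩ := ApType.exists_nat_search_of_mp K1_consistent (Or.inl rfl) h
  obtain ⟨C, hC, hC'⟩ := exists_family computable_halt
  have hCn : ∀ x n, ∃ k, K1.app (C x) (K1.numeral n) = K1.numeral k := fun x n => ⟨_, eq_numeral _⟩
  obtain ⟨c, hc, hc', e⟩ := ApType.exists_premorphism K1_consistent hC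
  let s : ℕ → ℕ := fun m => Subtype.val (M (c (K1.numeral m)))
  have hs : Computable s := computable_of_repr (hM.comp hc)
  refine ComputablePred.halting_problem 0 (ComputablePred.computable_iff.2
    ⟨fun a => halt (Encodable.encode a) (s (Encodable.encode a)) == 0, ?_, ?_⟩)
  · exact (Primrec.beq.comp Primrec.id (Primrec.const 0)).to_comp.comp
      (computable_halt.comp Computable.encode (hs.comp Computable.encode))
  · funext a
    refine propext ((dom_eval_iff a).trans ⟨fun ⟨k, hk⟩ => ?_, fun h => ⟨_, by simpa using h⟩⟩)
    obtain ⟨i, hi, h0⟩ := hM' (c (K1.numeral (Encodable.encode a))) (hc' _ (hCn _))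
      ⟨k, by rw [e, hC', hk]⟩
    have hsi : s (Encodable.encode a) = i := (congrArg Subtype.val hi).trans (numeral_val i)
    rw [e, hC'] at h0
    simp only [hsi, K1_consistent.numeral_inj h0, beq_self_eq_true]

end K1

end ConvExt

theorem mainTheorem3 :
    (ConvExt.Assembly.IP ConvExt.ApK1 ∧ ConvExt.Assembly.AC ConvExt.ApK1 ∧
      ConvExt.Assembly.Models ConvExt.ApK1 (ConvExt.CE 0) ∧
      ¬ ConvExt.Assembly.Models ConvExt.ApK1 (ConvExt.MP 0)) ∧
    (ConvExt.Assembly.IP ConvExt.ApK2rec ∧ ConvExt.Assembly.AC ConvExt.ApK2rec ∧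
      ConvExt.Assembly.Models ConvExt.ApK2rec (ConvExt.CE 0) ∧
      ConvExt.Assembly.Models ConvExt.ApK2rec (ConvExt.CE 1) ∧
      ¬ ConvExt.Assembly.Models ConvExt.ApK2rec (ConvExt.MP 0)) ∧
    ∀ n : ℕ, n = 0 ∨ n = 1 →
      ¬ ConvExt.Prov (ConvExt.ACCE n) [] (ConvExt.MP n : ConvExt.Fm []) := by
  have h1 := ConvExt.ApType.extensional ConvExt.K1_consistent
  have h2 := ConvExt.ApType.extensional ConvExt.K2rec_consistent
  refine ⟨⟨ConvExt.Assembly.ip h1, ConvExt.Assembly.ac h1, ConvExt.ApType.ce_zero_valid _,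
    ConvExt.K1.not_models_mp⟩, ⟨ConvExt.Assembly.ip h2, ConvExt.Assembly.ac h2,
    ConvExt.ApType.ce_zero_valid _, ConvExt.K2rec.ce_one_valid,
    ConvExt.K2rec.not_models_mp (Or.inl rfl)⟩, fun n hn h => ?_⟩
  obtain ⟨c⟩ := h2.bot
  refine ConvExt.K2rec.not_models_mp hn (ConvExt.Assembly.models_of_prov c (fun Γ φ hφ => ?_) h)
  rcases hφ with rfl | ⟨σ, τ, φ, rfl⟩
  · rcases hn with rfl | rfl
    · exact ConvExt.ApType.ce_zero_valid _
    · exact ConvExt.K2rec.ce_one_valid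
  · exact ConvExt.Assembly.acFm_valid h2 σ τ φ
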